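/- Let $R$ be an integral domain and let $f\in R[x_1,\dots,x_n]$ be a polynomial with at most $T$ nonzero terms and total degree less than $D$. For a prime $p$ and $1\le k\le n$ put $$f_{(D,p)}=f\bigl(x,x^{D\bmod p},\dots,x^{D^{n-1}\bmod p}\bigr)$$ (the substitution $x_i=x^{D^{i-1}\bmod p}$, $i=1,\dots,n$), and let $f_{(D,p,k)}$ be obtained in the same way, except that $x_k=x^{(D^{k-1}\bmod p)+p}$. Let $f^{\mathrm{mod}}_{(D,p)}$ be the remainder of $f_{(D,p)}$ modulo $x^p-1$, let $\#g$ be the number of nonzero terms of $g$, and let $p_j$ be the $j$-th prime. Consider the following algorithm MIPoly2. Its input is $n,T,D$ and a procedure that returns the terms of $f(x^{a_1},\dots,x^{a_n})$ for requested exponents $a_1,\dots,a_n$ (one univariate interpolation per request). 1. Compute the first $K=\max\{4,\lceil n(T-1)\log_2D\rceil+\lceil nT\log_2D\rceil,4\lceil nT\log_2D\rceil\}$ primes. 2. Let $N_1,N_2,N_3\ge1$ be the least integers with $p_1\cdots p_{N_1}\ge D^{n(T-1)}$, $p_1\cdots p_{N_2}\ge D^{nT}$, $p_1\cdots p_{N_3}\ge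 D^{4n(T-1)}$, and let $N=\max\{N_1+N_2-1,N_3\}$. 3. For $j=1,\dots,N$ interpolate $f_j=f_{(D,p_j)}$ and compute $f_j^{\mathrm{mod}}=f^{\mathrm{mod}}_{(D,p_j)}$. Set $h=0$. 4. Choose $j_0\le N$ such that $\#f^{\mathrm{mod}}_{j_0}$ is maximal. If $f^{\mathrm{mod}}_{j_0}=0$, return $h$. Otherwise, with $p=p_{j_0}$: - (a) For $k=1,\dots,n$ interpolate $f_{(D,p,k)}$ and let $g_k=f_{(D,p,k)}-h_{(D,p,k)}$. - (b) Form the set of all terms $a\,x_1^{e_1}\cdots x_n^{e_n}$ such that, for some term $a x^d$ of $f^{\mathrm{mod}}_{j_0}$, the part of $f_{j_0}$ with exponents congruent to $d$ modulo $p$ is a single term $ax^{\gamma}$, the corresponding part of each $g_k$ is a single term $ax^{\beta_k}$, $e_k=(\beta_k-\gamma)/p\in\mathbb N$ for all $k$, $\gamma=\sum_k e_k(D^{k-1}\bmod p)$, and $\sum_ke_k<D$. - (c) Let $s$ be the sum of those terms $u$ of this set for which $\#(f_j^{\mathrm{mod}}-u^{\mathrm{mod}}_{(D,p_j)})<\#f_j^{\mathrm{mod}}$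 for at least $N_2$ indices $j\le N_1+N_2-1$. - (d) Replace $h$ by $h+s$ and $T$ by $T-\#s$, recompute $N_1,N_2,N_3,N$ as in step 2, replace $f_j$ by $f_j-s_{(D,p_j)}$ and $f_j^{\mathrm{mod}}$ by $f_j^{\mathrm{mod}}-s^{\mathrm{mod}}_{(D,p_j)}$ for $j\le N$, and repeat step 4. **Theorem.** The algorithm terminates and returns $f$ (the list of its terms, each once). If moreover $n\ge1$, $T\ge1$, $D\ge2$, then it interpolates $O(nT\log D)$ univariate polynomials. Each of them is of the form $f_{(D,p_j)}$ or $f_{(D,p_j,k)}$ with $j=O(nT\log D)$, has degree less than $\tilde O(nDT)$, and has at most $T$ terms. Besides these interpolations, the algorithm, with schoolbook integer arithmetic, uses $\tilde O(nT^2\log D)$ ring operations in $R$ and $\tilde O(n^2T^2\log^2D)$ bit operations. All implied constants are absolute. Here $\tilde O(F)$ means $O(F\cdot\log^c(2+F))$ for some constant $c$. -/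

import Mathlib

/-! Sparse interpolation by modulus changing Kronecker substitutions: the substitutions, the step
counting model, and the algorithm as a step counting program. -/

universe u v

namespace KroneckerInterp

/-! ## Substitutions and sparse representations -/

section Polynomials

variable {R : Type u} [CommRing R]

/-- Exponents of the substitution `x_i = x ^ (d ^ (i - 1) mod p)` (here `i` is counted from `0`). -/
def kronExp (n d p : ℕ) : Fin n → ℕ := fun i => d ^ (i : ℕ) % p

/-- The same exponents, with `p` added to the exponent of the `k`-th variable. -/
def kronExpShift (n d p : ℕ) (k : Fin n) : Fin n → ℕ :=
  fun i => d ^ (i : ℕ) % p + if i = k then p else 0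

/-- The univariate polynomial `f (x ^ e_1, ..., x ^ e_n)`. With `e = kronExp n d p` this is
`f_(d,p)`, with `e = kronExpShift n d p k` it is `f_(d,p,k)`. -/
noncomputable def subst {n : ℕ} (e : Fin n → ℕ) (f : MvPolynomial (Fin n) R) : Polynomial R :=
  MvPolynomial.aeval (fun i => (Polynomial.X : Polynomial R) ^ e i) f

/-- `l` lists the terms `(exponent, coefficient)` of `g`, each exactly once, in any order. -/
structure IsUniTerms (l : List (ℕ × R)) (g : Polynomial R) : Prop where
  nodup : (l.map Prod.fst).Nodup
  ne_zero : ∀ t ∈ l, t.2 ≠ 0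
  sum_eq : (l.map fun t => Polynomial.monomial t.1 t.2).sum = g

/-- The exponent vector stored in a list. -/
noncomputable def expVec (n : ℕ) (es : List ℕ) : Fin n →₀ ℕ :=
  Finsupp.equivFunOnFinite.symm fun i => es.getD (i : ℕ) 0

/-- `h` lists the terms `(exponent vector, coefficient)` of `f`, each exactly once. -/
structure IsMvTerms {n : ℕ} (h : List (List ℕ × R)) (f : MvPolynomial (Fin n) R) : Prop where
  nodup : (h.map Prod.fst).Nodup
  length_eq : ∀ t ∈ h, t.1.length = n
  ne_zero : ∀ t ∈ h, t.2 ≠ 0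
  sum_eq : (h.map fun t => MvPolynomial.monomial (expVec n t.1) t.2).sum = f

/-- `I` interpolates the univariate images of `f`: asked for the exponents `e_1, ..., e_n`, it
returns the terms of `f (x ^ e_1, ..., x ^ e_n)`. -/
def IsInterpolator {n : ℕ} (f : MvPolynomial (Fin n) R) (I : List ℕ → List (ℕ × R)) : Prop :=
  ∀ e : Fin n → ℕ, IsUniTerms (I (List.ofFn e)) (subst e f)

end Polynomials

/-- `C * F * (log F) ^ c`, with `2 + F` in the logarithm so that it is at least `log 2`:
the soft-Oh class of `F` consists of what is bounded by this for some constants `C` and `c`. -/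
noncomputable def softBound (C c : ℕ) (F : ℝ) : ℝ := C * F * Real.log (2 + F) ^ c

/-! ## The step counting model

A program is a composition of the primitives below. Each one carries its price: ring operations
(additions, negations, subtractions, equality tests) cost one ring operation each; operations on
natural numbers cost bit operations, at the price of the schoolbook methods on binary
representations; walking through lists and trees and branching cost bit operations too. A call of
the interpolation procedure is recorded, and is charged for writing down the request. -/

/-- The outcome of a program: its value, the ring operations and the bit operations used, and the
list of the requests made to the interpolation procedure. -/
structure Run (α : Type u) where
  val : α
  ringOps : ℕ
  bitOps : ℕ
  queries : List (List ℕ)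

namespace Run

def ret {α : Type u} (a : α) : Run α := ⟨a, 0, 0, []⟩

def bind {α : Type u} {β : Type v} (x : Run α) (g : α → Run β) : Run β :=
  let y := g x.val
  ⟨y.val, x.ringOps + y.ringOps, x.bitOps + y.bitOps, x.queries ++ y.queries⟩

end Run

open Run

/-- Spend `b` bit operations. -/
def tick (b : ℕ) : Run Unit := ⟨(), 0, b, []⟩

/-- Length of the binary representation (with a sign or end marker, so it is never `0`). -/
def len (a : ℕ) : ℕ := Nat.size a + 1

def natAdd (a b : ℕ) : Run ℕ := ⟨a + b, 0, len a + len b, []⟩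
def natSub (a b : ℕ) : Run ℕ := ⟨a - b, 0, len a + len b, []⟩
def natMax (a b : ℕ) : Run ℕ := ⟨max a b, 0, len a + len b, []⟩
def natMul (a b : ℕ) : Run ℕ := ⟨a * b, 0, len a * len b, []⟩
def natDiv (a b : ℕ) : Run ℕ := ⟨a / b, 0, len a * len b, []⟩
def natMod (a b : ℕ) : Run ℕ := ⟨a % b, 0, len a * len b, []⟩
def natEq (a b : ℕ) : Run Bool := ⟨decide (a = b), 0, len a + len b, []⟩
def natLt (a b : ℕ) : Run Bool := ⟨decide (a < b), 0, len a + len b, []⟩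
def natLe (a b : ℕ) : Run Bool := ⟨decide (a ≤ b), 0, len a + len b, []⟩

/-- The ceiling of the binary logarithm, read off from the binary representation. -/
def natCeilLog (a : ℕ) : Run ℕ := ⟨Nat.clog 2 a, 0, len a, []⟩

/-- The binary representation, least significant bit first. -/
def natBits (a : ℕ) : Run (List Bool) := ⟨a.bits, 0, len a, []⟩

/-- `D ^ m` by repeated multiplication. -/
def natPow (D : ℕ) : ℕ → Run ℕ
  | 0 => (tick 1).bind fun _ => ret 1
  | m + 1 =>
    (tick (len m)).bind fun _ =>
    (natPow D m).bind fun x =>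
    natMul x D

/-- The first `k` entries of a list. -/
def takeList {α : Type u} : ℕ → List α → Run (List α)
  | 0, _ => (tick 1).bind fun _ => ret []
  | _ + 1, [] => (tick 1).bind fun _ => ret []
  | k + 1, a :: l =>
    (tick (len k)).bind fun _ =>
    (takeList k l).bind fun l' =>
    ret (a :: l')

/-- The length of a list. -/
def lengthList {α : Type u} : List α → Run ℕ
  | [] => (tick 1).bind fun _ => ret 0
  | _ :: l =>
    (lengthList l).bind fun m =>
    natAdd m 1

/-- The concatenation of two lists. -/
def appendList {α : Type u} : List α → List α → Run (List α)
  | [], l' => (tick 1).bind fun _ => ret l'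
  | a :: l, l' =>
    (tick 1).bind fun _ =>
    (appendList l l').bind fun r =>
    ret (a :: r)

/-- `reverseList l acc` is the reverse of `l`, followed by `acc`. -/
def reverseList {α : Type u} : List α → List α → Run (List α)
  | [], acc => (tick 1).bind fun _ => ret acc
  | a :: l, acc => (tick 1).bind fun _ => reverseList l (a :: acc)

section RingPrimitives

variable {R : Type u} [CommRing R] [DecidableEq R]

def ringAdd (a b : R) : Run R := ⟨a + b, 1, 0, []⟩
def ringSub (a b : R) : Run R := ⟨a - b, 1, 0, []⟩
def ringNeg (a : R) : Run R := ⟨-a, 1, 0, []⟩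
def ringEq (a b : R) : Run Bool := ⟨decide (a = b), 1, 0, []⟩
def ringIsZero (a : R) : Run Bool := ⟨decide (a = 0), 1, 0, []⟩

end RingPrimitives

/-- One call of the interpolation procedure. -/
def query {R : Type u} (I : List ℕ → List (ℕ × R)) (e : List ℕ) : Run (List (ℕ × R)) :=
  ⟨I e, 0, (e.map len).sum + 1, [e]⟩

/-! ## Dictionaries keyed by binary strings -/

/-- A binary tree; the value of a key is found by following the bits of the key. -/
inductive Trie (α : Type u) where
  | leaf : Trie α
  | node (v : Option α) (l r : Trie α) : Trie α

namespace Trie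

variable {α : Type u}

/-- The value of a key. -/
def find : Trie α → List Bool → Run (Option α)
  | leaf, _ => (tick 1).bind fun _ => ret none
  | node v _ _, [] => (tick 1).bind fun _ => ret v
  | node _ l r, b :: bs =>
    (tick 1).bind fun _ =>
    if b then r.find bs else l.find bs

/-- Replace the value `v` of a key by `g v`. -/
def alter (g : Option α → Run (Option α)) : Trie α → List Bool → Run (Trie α)
  | leaf, [] =>
    (tick 1).bind fun _ =>
    (g none).bind fun v =>
    ret (node v leaf leaf)
  | node v l r, [] =>
    (tick 1).bind fun _ =>
    (g v).bind fun v' =>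
    ret (node v' l r)
  | leaf, b :: bs =>
    (tick 1).bind fun _ =>
    (alter g leaf bs).bind fun t =>
    ret (if b then node none leaf t else node none t leaf)
  | node v l r, b :: bs =>
    (tick 1).bind fun _ =>
    if b then (alter g r bs).bind fun t => ret (node v l t)
    else (alter g l bs).bind fun t => ret (node v t r)

/-- The list of all values, followed by `acc`. -/
def values : Trie α → List α → Run (List α)
  | leaf, acc => (tick 1).bind fun _ => ret acc
  | node v l r, acc =>
    (tick 1).bind fun _ =>
    (r.values acc).bind fun acc' =>
    (l.values acc').bind fun acc'' =>
    match v with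
    | none => ret acc''
    | some a => ret (a :: acc'')

/-- The number of values. -/
def count : Trie α → Run ℕ
  | leaf => (tick 1).bind fun _ => ret 0
  | node v l r =>
    (tick 1).bind fun _ =>
    l.count.bind fun a =>
    r.count.bind fun b =>
    (natAdd a b).bind fun m =>
    match v with
    | none => ret m
    | some _ => natAdd m 1

end Trie

/-! ## Univariate polynomials -/

/-- A sparse univariate polynomial: the nonzero terms `(exponent, coefficient)`, each stored under
the bits of its exponent. -/
abbrev UPoly (R : Type u) := Trie (ℕ × R)

section Algorithm

variable {R : Type u} [CommRing R] [DecidableEq R]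

/-- Add the term `c x ^ e`. -/
def addTerm (t : UPoly R) (e : ℕ) (c : R) : Run (UPoly R) :=
  (natBits e).bind fun bs =>
  t.alter (fun o =>
    match o with
    | none =>
      (ringIsZero c).bind fun z =>
      ret (if z then none else some (e, c))
    | some (_, b) =>
      (ringAdd b c).bind fun s =>
      (ringIsZero s).bind fun z =>
      ret (if z then none else some (e, s))) bs

/-- Subtract the term `c x ^ e`. -/
def subTerm (t : UPoly R) (e : ℕ) (c : R) : Run (UPoly R) :=
  (ringNeg c).bind fun c' =>
  addTerm t e c'

/-- The coefficient of `x ^ e`. -/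
def coeffAt (t : UPoly R) (e : ℕ) : Run R :=
  (natBits e).bind fun bs =>
  (t.find bs).bind fun o =>
  match o with
  | none => ret 0
  | some (_, b) => ret b

/-- Add a list of terms. -/
def addTerms : List (ℕ × R) → UPoly R → Run (UPoly R)
  | [], t => (tick 1).bind fun _ => ret t
  | (e, c) :: l, t =>
    (tick 1).bind fun _ =>
    (addTerm t e c).bind fun t' =>
    addTerms l t'

/-- Add a list of terms, reduced modulo `x ^ p - 1`. -/
def addTermsMod (p : ℕ) : List (ℕ × R) → UPoly R → Run (UPoly R)
  | [], t => (tick 1).bind fun _ => ret t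
  | (e, c) :: l, t =>
    (tick 1).bind fun _ =>
    (natMod e p).bind fun r =>
    (addTerm t r c).bind fun t' =>
    addTermsMod p l t'

/-- `a_1 b_1 + a_2 b_2 + ...`. -/
def dot : List ℕ → List ℕ → Run ℕ
  | a :: as, b :: bs =>
    (tick 1).bind fun _ =>
    (natMul a b).bind fun x =>
    (dot as bs).bind fun y =>
    natAdd x y
  | _, _ => (tick 1).bind fun _ => ret 0

/-- `a_1 + a_2 + ...`. -/
def sumList : List ℕ → Run ℕ
  | [] => (tick 1).bind fun _ => ret 0
  | a :: as =>
    (tick 1).bind fun _ =>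
    (sumList as).bind fun y =>
    natAdd a y

/-- Subtract from `t` the image of a list of multivariate terms under `x_i = x ^ w_i`. -/
def subImage (w : List ℕ) : List (List ℕ × R) → UPoly R → Run (UPoly R)
  | [], t => (tick 1).bind fun _ => ret t
  | (es, c) :: s, t =>
    (tick 1).bind fun _ =>
    (dot es w).bind fun e =>
    (subTerm t e c).bind fun t' =>
    subImage w s t'

/-- The same, with the image reduced modulo `x ^ p - 1`. -/
def subImageMod (p : ℕ) (w : List ℕ) : List (List ℕ × R) → UPoly R → Run (UPoly R)
  | [], t => (tick 1).bind fun _ => ret t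
  | (es, c) :: s, t =>
    (tick 1).bind fun _ =>
    (dot es w).bind fun e =>
    (natMod e p).bind fun r =>
    (subTerm t r c).bind fun t' =>
    subImageMod p w s t'

/-! ## Primes and the numbers `N_1, N_2, N_3` -/

/-- Whether no member of the list divides `c`. -/
def noDivisor (c : ℕ) : List ℕ → Run Bool
  | [] => (tick 1).bind fun _ => ret true
  | q :: qs =>
    (natMod c q).bind fun r =>
    (natEq r 0).bind fun z =>
    if z then ret false else noDivisor c qs

/-- The first number from `c` on that no member of `ps` divides. The first argument only bounds
the length of the search. -/
def searchPrime (ps : List ℕ) : ℕ → ℕ → Run ℕ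
  | 0, c => ret c
  | m + 1, c =>
    (noDivisor c ps).bind fun b =>
    if b then ret c
    else
      (natAdd c 1).bind fun c' =>
      searchPrime ps m c'

/-- Find `k` more primes from `c` on, where `ps` holds the primes below `c`, in decreasing order.
The next prime is below `2 * c`, so `c` candidates suffice. -/
def morePrimes : ℕ → ℕ → List ℕ → Run (List ℕ)
  | 0, _, ps => reverseList ps []
  | k + 1, c, ps =>
    (tick (len k)).bind fun _ =>
    (searchPrime ps c c).bind fun q =>
    (natAdd q 1).bind fun c' =>
    morePrimes k c' (q :: ps)

/-- The first `K` primes, in increasing order. -/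
def firstPrimes (K : ℕ) : Run (List ℕ) := morePrimes K 2 []

/-- Multiply members of the list to `P` one after the other until the product is at least `B`; the
value is `m₀` plus the number of members used. From `P = 1` and `m₀ = 0` this is the smallest
`m ≥ 1` such that the product of the first `m` members is at least `B`. -/
def leastCount (B : ℕ) : List ℕ → ℕ → ℕ → Run ℕ
  | [], _, m₀ => (tick 1).bind fun _ => ret m₀
  | q :: qs, P, m₀ =>
    (natMul P q).bind fun P' =>
    (natAdd m₀ 1).bind fun m₁ =>
    (natLe B P').bind fun b =>
    if b then ret m₁ else leastCount B qs P' m₁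

/-- The smallest numbers `N_1, N_2, N_3 ≥ 1` for which `p_1 ⋯ p_{N_1} ≥ D ^ (n (T - 1))`,
`p_1 ⋯ p_{N_2} ≥ D ^ (n T)` and `p_1 ⋯ p_{N_3} ≥ D ^ (4 n (T - 1))`. -/
def thresholds (n T D : ℕ) (primes : List ℕ) : Run (ℕ × ℕ × ℕ) :=
  (natSub T 1).bind fun T₁ =>
  (natMul n T₁).bind fun a =>
  (natMul n T).bind fun b =>
  (natMul 4 a).bind fun c =>
  (natPow D a).bind fun A =>
  (natPow D b).bind fun B =>
  (natPow D c).bind fun E =>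
  (leastCount A primes 1 0).bind fun N₁ =>
  (leastCount B primes 1 0).bind fun N₂ =>
  (leastCount E primes 1 0).bind fun N₃ =>
  ret (N₁, N₂, N₃)

/-- `max (N_1 + N_2 - 1) N_3`. -/
def sampleCount (N₁ N₂ N₃ : ℕ) : Run ℕ :=
  (natAdd N₁ N₂).bind fun a =>
  (natSub a 1).bind fun b =>
  natMax b N₃

/-- `K = max {4, ⌈n (T - 1) log₂ D⌉ + ⌈n T log₂ D⌉, 4 ⌈n T log₂ D⌉}`. -/
def primeBudget (n T D : ℕ) : Run ℕ :=
  (natSub T 1).bind fun T₁ =>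
  (natMul n T₁).bind fun a =>
  (natMul n T).bind fun b =>
  (natPow D a).bind fun A =>
  (natPow D b).bind fun B =>
  (natCeilLog A).bind fun x =>
  (natCeilLog B).bind fun y =>
  (natAdd x y).bind fun z =>
  (natMul 4 y).bind fun w =>
  (natMax z w).bind fun m =>
  natMax 4 m

/-! ## The univariate images -/

/-- What is stored for a prime `p`: the exponents `D ^ (i - 1) mod p`, the image
`(f - h)_(D,p)`, and this image reduced modulo `x ^ p - 1`. -/
structure Sample (R : Type u) where
  p : ℕ
  w : List ℕ
  poly : UPoly R
  red : UPoly R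

/-- `r, r d, r d ^ 2, ...` modulo `p` (`n` entries). -/
def geometric (d p : ℕ) : ℕ → ℕ → Run (List ℕ)
  | 0, _ => (tick 1).bind fun _ => ret []
  | n + 1, r =>
    (tick (len n)).bind fun _ =>
    (natMul r d).bind fun x =>
    (natMod x p).bind fun r' =>
    (geometric d p n r').bind fun l =>
    ret (r :: l)

/-- The list of the `D ^ (i - 1) mod p` for `i = 1, ..., n`. -/
def residues (n D p : ℕ) : Run (List ℕ) :=
  (natMod D p).bind fun d =>
  (natMod 1 p).bind fun r =>
  geometric d p n r

/-- Interpolate `f_(D,p)` and reduce it modulo `x ^ p - 1`. -/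
def takeSample (I : List ℕ → List (ℕ × R)) (n D p : ℕ) : Run (Sample R) :=
  (residues n D p).bind fun w =>
  (query I w).bind fun l =>
  (addTerms l Trie.leaf).bind fun t =>
  (addTermsMod p l Trie.leaf).bind fun t' =>
  ret ⟨p, w, t, t'⟩

def takeSamples (I : List ℕ → List (ℕ × R)) (n D : ℕ) : List ℕ → Run (List (Sample R))
  | [] => (tick 1).bind fun _ => ret []
  | p :: ps =>
    (tick 1).bind fun _ =>
    (takeSample I n D p).bind fun x =>
    (takeSamples I n D ps).bind fun xs =>
    ret (x :: xs)

/-- The largest number of terms of a reduced image, and a sample where it is attained. -/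
def bestSample : List (Sample R) → Run (Option (ℕ × Sample R))
  | [] => (tick 1).bind fun _ => ret none
  | x :: xs =>
    (tick 1).bind fun _ =>
    x.red.count.bind fun a =>
    (bestSample xs).bind fun o =>
    match o with
    | none => ret (some (a, x))
    | some (b, y) =>
      (natLe b a).bind fun c =>
      ret (if c then some (a, x) else some (b, y))

/-- Subtract the images of the terms `s` in all samples. -/
def updateSamples (s : List (List ℕ × R)) : List (Sample R) → Run (List (Sample R))
  | [] => (tick 1).bind fun _ => ret []
  | x :: xs =>
    (tick 1).bind fun _ =>
    (subImage x.w s x.poly).bind fun t =>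
    (subImageMod x.p x.w s x.red).bind fun t' =>
    (updateSamples s xs).bind fun ys =>
    ret (⟨x.p, x.w, t, t'⟩ :: ys)

/-- Add `p` to the entry number `k` (counted from `0`). -/
def shiftAt (p : ℕ) : ℕ → List ℕ → Run (List ℕ)
  | _, [] => (tick 1).bind fun _ => ret []
  | 0, r :: rs =>
    (natAdd r p).bind fun r' =>
    ret (r' :: rs)
  | k + 1, r :: rs =>
    (tick (len k)).bind fun _ =>
    (shiftAt p k rs).bind fun rs' =>
    ret (r :: rs')

/-- The polynomials `g_k = f_(D,p,k) - h_(D,p,k)` for the last `m` of the `n` indices `k`. -/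
def shiftedImages (I : List ℕ → List (ℕ × R)) (n : ℕ) (x : Sample R) (h : List (List ℕ × R)) :
    ℕ → Run (List (UPoly R))
  | 0 => (tick 1).bind fun _ => ret []
  | m + 1 =>
    (natSub n (m + 1)).bind fun k =>
    (shiftAt x.p k x.w).bind fun w' =>
    (query I w').bind fun l =>
    (addTerms l Trie.leaf).bind fun t =>
    (subImage w' h t).bind fun g =>
    (shiftedImages I n x h m).bind fun gs =>
    ret (g :: gs)

/-! ## The candidate terms -/

/-- Sort terms by the residue of the exponent modulo `p`. For each residue that occurs, one term
is kept, with a flag that says whether it is the only one. -/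
def fillBlocks (p : ℕ) : List (ℕ × R) → Trie ((ℕ × R) × Bool) → Run (Trie ((ℕ × R) × Bool))
  | [], B => (tick 1).bind fun _ => ret B
  | (e, c) :: l, B =>
    (tick 1).bind fun _ =>
    (natMod e p).bind fun r =>
    (natBits r).bind fun bs =>
    (B.alter (fun o =>
      match o with
      | none => ret (some ((e, c), true))
      | some (t, _) => ret (some (t, false))) bs).bind fun B' =>
    fillBlocks p l B'

/-- The blocks of a polynomial: its terms sorted by the residue of the exponent modulo `p`. -/
def blocks (p : ℕ) (t : UPoly R) : Run (Trie ((ℕ × R) × Bool)) :=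
  (t.values []).bind fun l =>
  fillBlocks p l Trie.leaf

def blocksList (p : ℕ) : List (UPoly R) → Run (List (Trie ((ℕ × R) × Bool)))
  | [] => (tick 1).bind fun _ => ret []
  | t :: ts =>
    (tick 1).bind fun _ =>
    (blocks p t).bind fun B =>
    (blocksList p ts).bind fun Bs =>
    ret (B :: Bs)

/-- If the block of the residue `d` is a single term `a x ^ e` with the given `a`, return `e`. -/
def singleExponent (B : Trie ((ℕ × R) × Bool)) (d : ℕ) (a : R) : Run (Option ℕ) :=
  (natBits d).bind fun bs =>
  (B.find bs).bind fun o =>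
  match o with
  | none => ret none
  | some (_, false) => ret none
  | some ((e, c), true) =>
    (ringEq c a).bind fun b =>
    ret (if b then some e else none)

/-- The exponents `e_k = (β_k - γ) / p`, provided that they exist and are natural numbers. -/
def recoverExponents (p γ d : ℕ) (a : R) :
    List (Trie ((ℕ × R) × Bool)) → Run (Option (List ℕ))
  | [] => (tick 1).bind fun _ => ret (some [])
  | B :: Bs =>
    (tick 1).bind fun _ =>
    (singleExponent B d a).bind fun o =>
    match o with
    | none => ret none
    | some β =>
      (natLe γ β).bind fun b =>
      if b then
        (natSub β γ).bind fun δ =>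
        (natMod δ p).bind fun r =>
        (natEq r 0).bind fun z =>
        if z then
          (natDiv δ p).bind fun e =>
          (recoverExponents p γ d a Bs).bind fun o' =>
          match o' with
          | none => ret none
          | some es => ret (some (e :: es))
        else ret none
      else ret none

/-- The candidate term that belongs to the term `a x ^ d` of the reduced image, if any. -/
def candidate (D p : ℕ) (w : List ℕ) (B : Trie ((ℕ × R) × Bool))
    (Bs : List (Trie ((ℕ × R) × Bool))) (d : ℕ) (a : R) : Run (Option (List ℕ × R)) :=
  (singleExponent B d a).bind fun o =>
  match o with
  | none => ret none
  | some γ =>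
    (recoverExponents p γ d a Bs).bind fun o' =>
    match o' with
    | none => ret none
    | some es =>
      (dot es w).bind fun γ' =>
      (natEq γ' γ).bind fun b =>
      if b then
        (sumList es).bind fun m =>
        (natLt m D).bind fun b' =>
        ret (if b' then some (es, a) else none)
      else ret none

def candidates (D p : ℕ) (w : List ℕ) (B : Trie ((ℕ × R) × Bool))
    (Bs : List (Trie ((ℕ × R) × Bool))) : List (ℕ × R) → Run (List (List ℕ × R))
  | [] => (tick 1).bind fun _ => ret []
  | (d, a) :: l =>
    (tick 1).bind fun _ =>
    (candidate D p w B Bs d a).bind fun o =>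
    (candidates D p w B Bs l).bind fun us =>
    match o with
    | none => ret us
    | some u => ret (u :: us)

/-- The subroutine `TSTerms`: the terms `a x_1 ^ e_1 ⋯ x_n ^ e_n` such that `a x ^ d` is a term of
the reduced image, its blocks in `(f - h)_(D,p)` and in the `g_k` are single terms `a x ^ γ` and
`a x ^ β_k`, `e_k = (β_k - γ) / p` is a natural number, `γ = ∑ e_k (D ^ (k - 1) mod p)`, and
`∑ e_k < D`. -/
def tsTerms (D : ℕ) (x : Sample R) (gs : List (UPoly R)) : Run (List (List ℕ × R)) :=
  (blocks x.p x.poly).bind fun B =>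
  (blocksList x.p gs).bind fun Bs =>
  (x.red.values []).bind fun l =>
  candidates D x.p x.w B Bs l

/-! ## The term test -/

/-- The number of samples for which subtracting the image of the term `u` from the reduced image
lowers the number of terms. Only one coefficient `b` changes, so the number of terms is lowered
exactly if `b` is not zero but becomes zero. -/
def loweredCount (u : List ℕ × R) : List (Sample R) → Run ℕ
  | [] => (tick 1).bind fun _ => ret 0
  | x :: xs =>
    (tick 1).bind fun _ =>
    (dot u.1 x.w).bind fun e =>
    (natMod e x.p).bind fun r =>
    (coeffAt x.red r).bind fun b =>
    (ringSub b u.2).bind fun b' =>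
    (ringIsZero b).bind fun z =>
    (ringIsZero b').bind fun z' =>
    (loweredCount u xs).bind fun m =>
    if !z && z' then natAdd m 1 else ret m

/-- The candidates that pass the term test. -/
def selectTerms (N₂ : ℕ) (xs : List (Sample R)) :
    List (List ℕ × R) → Run (List (List ℕ × R))
  | [] => (tick 1).bind fun _ => ret []
  | u :: us =>
    (tick 1).bind fun _ =>
    (loweredCount u xs).bind fun m =>
    (natLe N₂ m).bind fun b =>
    (selectTerms N₂ xs us).bind fun s =>
    ret (if b then u :: s else s)

/-! ## The algorithm -/

/-- The `while` loop. The first argument bounds the number of rounds; the value is `none` if the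
loop has not ended by then, and a larger bound changes nothing once the loop has ended. -/
def mainLoop (I : List ℕ → List (ℕ × R)) (n D : ℕ) (primes : List ℕ) :
    ℕ → ℕ → ℕ → ℕ → List (Sample R) → List (List ℕ × R) → Run (Option (List (List ℕ × R)))
  | 0, _, _, _, _, _ => ret none
  | rounds + 1, T, N₁, N₂, xs, h =>
    (bestSample xs).bind fun o =>
    match o with
    | none => ret (some h)
    | some (α, x) =>
      (natEq α 0).bind fun finished =>
      if finished then ret (some h)
      else
        (shiftedImages I n x h n).bind fun gs =>
        (tsTerms D x gs).bind fun us =>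
        (natAdd N₁ N₂).bind fun a =>
        (natSub a 1).bind fun a' =>
        (takeList a' xs).bind fun ys =>
        (selectTerms N₂ ys us).bind fun s =>
        (appendList s h).bind fun h' =>
        (lengthList s).bind fun m =>
        (natSub T m).bind fun T' =>
        (thresholds n T' D primes).bind fun N =>
        (sampleCount N.1 N.2.1 N.2.2).bind fun M =>
        (takeList M xs).bind fun zs =>
        (updateSamples s zs).bind fun xs' =>
        mainLoop I n D primes rounds T' N.1 N.2.1 xs' h'

/-- The algorithm `MIPoly2`, with at most `rounds` tests of its `while` condition. Its input is
the interpolation procedure `I`, the number `n` of variables, a bound `T` for the number of terms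
and a strict bound `D` for the degree; its output is a list of terms. -/
def mipoly2 (I : List ℕ → List (ℕ × R)) (n T D rounds : ℕ) :
    Run (Option (List (List ℕ × R))) :=
  (primeBudget n T D).bind fun K =>
  (firstPrimes K).bind fun primes =>
  (thresholds n T D primes).bind fun N =>
  (sampleCount N.1 N.2.1 N.2.2).bind fun M =>
  (takeList M primes).bind fun ps =>
  (takeSamples I n D ps).bind fun xs =>
  mainLoop I n D primes rounds T N.1 N.2.1 xs []

end Algorithm

end KroneckerInterp

set_option linter.unusedSectionVars false

namespace KroneckerInterp
open Run

/-! ## Bookkeeping for runs -/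

namespace Run

variable {α : Type u} {β : Type v}

/-! The central object is the Kronecker exponent `kron D s`, the number whose base `D` digits are
the exponents of the monomial `s`. On monomials of total degree below `D` it is injective, with
values below `M = D ^ n`. Substituting `x_i = x ^ (D ^ (i - 1) mod p)` and reducing modulo `x ^ p -
1` sends `s` to the exponent `kron D s % p`. So two monomials collide for `p` exactly when `p`
divides the difference of their Kronecker exponents. A monomial that collides with no other one is
isolated, and the reduced image shows its coefficient unchanged.

Counting collisions. Let `u` be a monomial facing at most `k` others. Every prime for which `u`
collides divides the product of at most `k` nonzero differences, each at most `M - 1`, so these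
primes have product at most `(M - 1) ^ k`. If the first `N` primes have product at least `M ^ k`,
there are fewer than `N` such primes (`card_collisions_lt`). This yields the term test
`termTest_iff`. A true term sees fewer than `N₁` bad primes, so at least `N₂` of `N₁ + N₂ - 1`
primes confirm it; a false term can only be confirmed by a collision, hence fewer than `N₂` times.
Multiplying the same estimate over all `t` monomials gives `exists_card_collided_lt`: if a quarter
of the monomials collided for each of the first `N₃` primes, the product of these primes would be
too small. So some prime leaves more than `3t/4` monomials isolated.

Progress of a round. The chosen prime has at least as many terms in its reduced image as that prime,
so more than `3t/4` residues are occupied. An occupied residue holds either one isolated monomial or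
at least two monomials, so `two_mul_card_image_le` gives more than `t/2` isolated monomials at the
chosen prime. An isolated monomial is alone in its residue block in `f_(D,p)` and in every shifted
image, where its exponent grows by `s k * p`; this reveals all `s k`, and `tsTerms_spec` shows that
the term becomes a candidate. Other candidates may be accidental, but the term test keeps precisely
those that are terms of the remaining polynomial. Hence a round removes only true terms and more
than half of them, and a zero best image means that nothing remains (`mainLoop_result`).

Costs. Bounds are composed along the program by `Run.Within.bind`, with two word lengths: `m` for
numbers polynomial in `n * T * log D`, and `L` for exponents, which also involve `log D`. Since the
product of `j` primes is at least `2 ^ j`, the `K = O(n T log D)` primes computed at the start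
suffice for all rounds, and a Chebyshev bound makes the `K`-th one `O(K log K)`. Dictionaries never
lose nodes, but each receives at most `2 T` terms in all. A round costs `O((n T L) ^ 2 m ^ 2)` bit
operations and the trial divisions `O((n T L) ^ 2 m ^ 3)`. The number of tests of the loop condition
is bounded logarithmically for the operation counts, and by `2 T` for the requests, whose bound has
no extra logarithm. -/

@[simp] theorem ret_val (a : α) : (ret a).val = a := rfl
@[simp] theorem ret_queries (a : α) : (ret a).queries = [] := rfl

@[simp] theorem bind_val (x : Run α) (g : α → Run β) : (x.bind g).val = (g x.val).val := rfl

@[simp] theorem bind_queries (x : Run α) (g : α → Run β) :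
    (x.bind g).queries = x.queries ++ (g x.val).queries := rfl

/-- The run uses at most `r` ring operations, `b` bit operations and `q` requests. -/
structure Within (x : Run α) (r b q : ℕ) : Prop where
  ring : x.ringOps ≤ r
  bit : x.bitOps ≤ b
  query : x.queries.length ≤ q

theorem Within.bind {x : Run α} {g : α → Run β} {r b q r' b' q' : ℕ} (hx : x.Within r b q)
    (hg : (g x.val).Within r' b' q') : (x.bind g).Within (r + r') (b + b') (q + q') := by
  constructor
  · exact Nat.add_le_add hx.ring hg.ring
  · exact Nat.add_le_add hx.bit hg.bit
  · simpa using Nat.add_le_add hx.query hg.query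

theorem Within.mono {x : Run α} {r b q r' b' q' : ℕ} (hx : x.Within r b q) (hr : r ≤ r')
    (hb : b ≤ b') (hq : q ≤ q') : x.Within r' b' q' :=
  ⟨hx.ring.trans hr, hx.bit.trans hb, hx.query.trans hq⟩

theorem Within.ite {c : Prop} [Decidable c] {x y : Run α} {r b q : ℕ} (hx : c → x.Within r b q)
    (hy : ¬c → y.Within r b q) : (if c then x else y).Within r b q := by
  split_ifs with h
  exacts [hx h, hy h]

theorem Within.ret (a : α) : (Run.ret a).Within 0 0 0 := ⟨le_rfl, le_rfl, le_rfl⟩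

/-- Every request satisfies `P`. -/
def Asks (x : Run α) (P : List ℕ → Prop) : Prop := ∀ e ∈ x.queries, P e

theorem Asks.bind {x : Run α} {g : α → Run β} {P : List ℕ → Prop} (hx : x.Asks P)
    (hg : (g x.val).Asks P) : (x.bind g).Asks P := by
  intro e he
  rcases List.mem_append.1 he with h | h
  · exact hx e h
  · exact hg e h

/-- A budget of zero requests leaves the list of requests empty, so any assertion about them is
vacuous. -/
theorem Within.asks {x : Run α} {r b : ℕ} (hx : x.Within r b 0) (P : List ℕ → Prop) :
    x.Asks P := by
  have : x.queries = [] := List.length_eq_zero_iff.1 (Nat.le_zero.1 hx.query)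
  simp [Asks, this]

theorem Asks.ret (a : α) (P : List ℕ → Prop) : (Run.ret a).Asks P := by simp [Asks]

end Run

open Run

theorem tick_within (b : ℕ) : (tick b).Within 0 b 0 := ⟨le_rfl, le_rfl, le_rfl⟩

theorem tick_ret_within {α : Type u} (b : ℕ) (a : α) :
    ((tick b).bind fun _ => ret a).Within 0 b 0 := ⟨le_rfl, le_rfl, le_rfl⟩

@[simp] theorem natAdd_val (a b : ℕ) : (natAdd a b).val = a + b := rfl
@[simp] theorem natSub_val (a b : ℕ) : (natSub a b).val = a - b := rfl
@[simp] theorem natMax_val (a b : ℕ) : (natMax a b).val = max a b := rfl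
@[simp] theorem natMul_val (a b : ℕ) : (natMul a b).val = a * b := rfl
@[simp] theorem natDiv_val (a b : ℕ) : (natDiv a b).val = a / b := rfl
@[simp] theorem natMod_val (a b : ℕ) : (natMod a b).val = a % b := rfl
@[simp] theorem natEq_val (a b : ℕ) : (natEq a b).val = decide (a = b) := rfl
@[simp] theorem natLt_val (a b : ℕ) : (natLt a b).val = decide (a < b) := rfl
@[simp] theorem natLe_val (a b : ℕ) : (natLe a b).val = decide (a ≤ b) := rfl
@[simp] theorem natCeilLog_val (a : ℕ) : (natCeilLog a).val = Nat.clog 2 a := rfl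
@[simp] theorem natBits_val (a : ℕ) : (natBits a).val = a.bits := rfl

/-! ### Values and prices of ring operations -/

section RingVal
variable {R : Type u} [CommRing R] [DecidableEq R]
@[simp] theorem ringAdd_val (a b : R) : (ringAdd a b).val = a + b := rfl
@[simp] theorem ringSub_val (a b : R) : (ringSub a b).val = a - b := rfl
@[simp] theorem ringNeg_val (a : R) : (ringNeg a).val = -a := rfl
@[simp] theorem ringEq_val (a b : R) : (ringEq a b).val = decide (a = b) := rfl
@[simp] theorem ringIsZero_val (a : R) : (ringIsZero a).val = decide (a = 0) := rfl
@[simp] theorem query_val (I : List ℕ → List (ℕ × R)) (e : List ℕ) : (query I e).val = I e := rfl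

theorem ringAdd_within (a b : R) : (ringAdd a b).Within 1 0 0 := ⟨le_rfl, le_rfl, le_rfl⟩
theorem ringSub_within (a b : R) : (ringSub a b).Within 1 0 0 := ⟨le_rfl, le_rfl, le_rfl⟩
theorem ringNeg_within (a : R) : (ringNeg a).Within 1 0 0 := ⟨le_rfl, le_rfl, le_rfl⟩
theorem ringEq_within (a b : R) : (ringEq a b).Within 1 0 0 := ⟨le_rfl, le_rfl, le_rfl⟩
theorem ringIsZero_within (a : R) : (ringIsZero a).Within 1 0 0 := ⟨le_rfl, le_rfl, le_rfl⟩
end RingVal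

/-! ## Lengths of binary representations -/

theorem len_mono {a b : ℕ} (h : a ≤ b) : len a ≤ len b :=
  Nat.add_le_add_right (Nat.size_le_size h) 1

theorem one_le_len (a : ℕ) : 1 ≤ len a := Nat.le_add_left _ _

theorem len_zero : len 0 = 1 := rfl

theorem len_one : len 1 = 2 := by simp [len]

theorem lt_two_pow_len (a : ℕ) : a < 2 ^ len a :=
  (Nat.lt_size_self a).trans_le (Nat.pow_le_pow_right (by norm_num) (Nat.le_succ _))

theorem len_le_self {a : ℕ} : len a ≤ a + 1 :=
  Nat.add_le_add_right (Nat.size_le.2 a.lt_two_pow_self) 1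

theorem len_mul (a b : ℕ) : len (a * b) ≤ len a + len b := by
  have : Nat.size (a * b) ≤ Nat.size a + Nat.size b := by
    rw [Nat.size_le, pow_add]
    exact Nat.mul_lt_mul'' (Nat.lt_size_self a) (Nat.lt_size_self b)
  unfold len; omega

theorem len_add (a b : ℕ) : len (a + b) ≤ max (len a) (len b) + 1 := by
  have : Nat.size (a + b) ≤ max (Nat.size a) (Nat.size b) + 1 := by
    rw [Nat.size_le, pow_succ]
    have ha := (Nat.lt_size_self a).trans_le
      (Nat.pow_le_pow_right (n := 2) (by norm_num) (le_max_left (Nat.size a) (Nat.size b)))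
    have hb := (Nat.lt_size_self b).trans_le
      (Nat.pow_le_pow_right (n := 2) (by norm_num) (le_max_right (Nat.size a) (Nat.size b)))
    omega
  unfold len; omega

theorem len_pow (D m : ℕ) : len (D ^ m) ≤ m * len D + 2 := by
  induction m with
  | zero => simp [len]
  | succ m ih =>
    rw [pow_succ, add_mul, one_mul]
    have := len_mul (D ^ m) D
    omega

theorem bits_length (a : ℕ) : a.bits.length + 1 = len a := by
  rw [Nat.size_eq_bits_len]; rfl

/-- Exponents serve as dictionary keys through their bits, so different exponents must have
different keys. Induction strips off the least significant bit. -/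
theorem bits_injective : Function.Injective Nat.bits := by
  intro a b h
  induction a using Nat.binaryRec' generalizing b with
  | zero =>
    have := congrArg List.length h
    rw [Nat.size_eq_bits_len] at this
    simpa [eq_comm, Nat.size_eq_bits_len, Nat.size_eq_zero] using this
  | bit c n hn ih =>
    induction b using Nat.binaryRec' with
    | zero => rw [Nat.bits_append_bit _ _ hn] at h; simp at h
    | bit c' m hm _ =>
      rw [Nat.bits_append_bit _ _ hn, Nat.bits_append_bit _ _ hm] at h
      injection h with h1 h2
      rw [h1, ih h2]

/-! ### Prices of integer operations in terms of length bounds -/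

section NatCosts

variable {a b l m : ℕ}

theorem natAdd_within (ha : len a ≤ l) (hb : len b ≤ m) : (natAdd a b).Within 0 (l + m) 0 :=
  ⟨le_rfl, Nat.add_le_add ha hb, le_rfl⟩
theorem natSub_within (ha : len a ≤ l) (hb : len b ≤ m) : (natSub a b).Within 0 (l + m) 0 :=
  ⟨le_rfl, Nat.add_le_add ha hb, le_rfl⟩
theorem natMax_within (ha : len a ≤ l) (hb : len b ≤ m) : (natMax a b).Within 0 (l + m) 0 :=
  ⟨le_rfl, Nat.add_le_add ha hb, le_rfl⟩
theorem natEq_within (ha : len a ≤ l) (hb : len b ≤ m) : (natEq a b).Within 0 (l + m) 0 :=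
  ⟨le_rfl, Nat.add_le_add ha hb, le_rfl⟩
theorem natLt_within (ha : len a ≤ l) (hb : len b ≤ m) : (natLt a b).Within 0 (l + m) 0 :=
  ⟨le_rfl, Nat.add_le_add ha hb, le_rfl⟩
theorem natLe_within (ha : len a ≤ l) (hb : len b ≤ m) : (natLe a b).Within 0 (l + m) 0 :=
  ⟨le_rfl, Nat.add_le_add ha hb, le_rfl⟩
theorem natMul_within (ha : len a ≤ l) (hb : len b ≤ m) : (natMul a b).Within 0 (l * m) 0 :=
  ⟨le_rfl, Nat.mul_le_mul ha hb, le_rfl⟩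
theorem natDiv_within (ha : len a ≤ l) (hb : len b ≤ m) : (natDiv a b).Within 0 (l * m) 0 :=
  ⟨le_rfl, Nat.mul_le_mul ha hb, le_rfl⟩
theorem natMod_within (ha : len a ≤ l) (hb : len b ≤ m) : (natMod a b).Within 0 (l * m) 0 :=
  ⟨le_rfl, Nat.mul_le_mul ha hb, le_rfl⟩
theorem natCeilLog_within (ha : len a ≤ l) : (natCeilLog a).Within 0 l 0 :=
  ⟨le_rfl, ha, le_rfl⟩
theorem natBits_within (ha : len a ≤ l) : (natBits a).Within 0 l 0 :=
  ⟨le_rfl, ha, le_rfl⟩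

end NatCosts

/-! ## Lists -/

section Lists

variable {α : Type u}

@[simp] theorem takeList_val (k : ℕ) (l : List α) : (takeList k l).val = l.take k := by
  induction k generalizing l with
  | zero => simp [takeList]
  | succ k ih => cases l <;> simp [takeList, ih]

theorem takeList_within (k : ℕ) (l : List α) {m : ℕ} (hm : len k ≤ m) :
    (takeList k l).Within 0 (k * m + 1) 0 := by
  induction k generalizing l with
  | zero => exact (tick_ret_within 1 _).mono le_rfl (by simp) le_rfl
  | succ k ih =>
    have hk : len k ≤ m := (len_mono k.le_succ).trans hm
    cases l with
    | nil => exact (tick_ret_within 1 _).mono le_rfl (by simp) le_rfl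
    | cons a l =>
      refine Within.mono ((tick_within _).bind ((ih l hk).bind (Within.ret _))) (by simp) ?_ (by simp)
      rw [add_mul]; omega

@[simp] theorem lengthList_val (l : List α) : (lengthList l).val = l.length := by
  induction l with
  | nil => rfl
  | cons a l ih => simp [lengthList, ih]

theorem lengthList_within (l : List α) {m : ℕ} (hm : len l.length ≤ m) :
    (lengthList l).Within 0 (l.length * (m + 2) + 1) 0 := by
  induction l with
  | nil => exact (tick_ret_within 1 _).mono le_rfl (by simp) le_rfl
  | cons a l ih =>
    have hk : len l.length ≤ m := (len_mono (by simp)).trans hm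
    refine Within.mono ((ih hk).bind (natAdd_within (by simpa using hk) len_one.le)) (by simp) ?_ (by simp)
    rw [List.length_cons, add_mul]; omega

@[simp] theorem appendList_val (l l' : List α) : (appendList l l').val = l ++ l' := by
  induction l with
  | nil => rfl
  | cons a l ih => simp [appendList, ih]

theorem appendList_within (l l' : List α) :
    (appendList l l').Within 0 (l.length + 1) 0 := by
  induction l with
  | nil => exact (tick_ret_within 1 _).mono le_rfl (by simp) le_rfl
  | cons a l ih =>
    refine Within.mono ((tick_within 1).bind (ih.bind (Within.ret _))) (by simp) ?_ (by simp)
    rw [List.length_cons]; omega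

@[simp] theorem reverseList_val (l l' : List α) : (reverseList l l').val = l.reverse ++ l' := by
  induction l generalizing l' with
  | nil => rfl
  | cons a l ih => simp [reverseList, ih]

theorem reverseList_within (l l' : List α) :
    (reverseList l l').Within 0 (l.length + 1) 0 := by
  induction l generalizing l' with
  | nil => exact (tick_ret_within 1 _).mono le_rfl (by simp) le_rfl
  | cons a l ih =>
    refine Within.mono ((tick_within 1).bind (ih _)) (by simp) ?_ (by simp)
    rw [List.length_cons]; omega

end Lists

/-! ## Dictionaries -/

namespace Trie

variable {α : Type u}

/-- The value of a key. -/
def get : Trie α → List Bool → Option α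
  | leaf, _ => none
  | node v _ _, [] => v
  | node _ l r, b :: bs => if b then r.get bs else l.get bs

/-- All pairs of a key and its value. -/
def entries : Trie α → List (List Bool × α)
  | leaf => []
  | node v l r => (match v with | none => [] | some a => [([], a)]) ++
      (l.entries.map (fun x => (false :: x.1, x.2)) ++ r.entries.map (fun x => (true :: x.1, x.2)))

/-- The number of nodes and leaves. -/
def nodes : Trie α → ℕ
  | leaf => 1
  | node _ l r => 1 + l.nodes + r.nodes

@[simp] theorem get_leaf (k : List Bool) : (leaf : Trie α).get k = none := rfl

@[simp] theorem find_val (t : Trie α) (k : List Bool) : (t.find k).val = t.get k := by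
  induction t generalizing k with
  | leaf => rfl
  | node v l r ihl ihr =>
    cases k with
    | nil => rfl
    | cons b bs => cases b <;> simp [find, get, ihl, ihr]

theorem find_within (t : Trie α) (k : List Bool) : (t.find k).Within 0 (k.length + 1) 0 := by
  induction t generalizing k with
  | leaf => exact (tick_ret_within 1 _).mono le_rfl (by simp) le_rfl
  | node v l r ihl ihr =>
    cases k with
    | nil => exact (tick_ret_within 1 _).mono le_rfl (by simp) le_rfl
    | cons b bs =>
      cases b
      · exact Within.mono ((tick_within 1).bind (ihl bs)) (by simp) (by simp; omega) (by simp)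
      · exact Within.mono ((tick_within 1).bind (ihr bs)) (by simp) (by simp; omega) (by simp)

theorem get_alter (g : Option α → Run (Option α)) (t : Trie α) (k k' : List Bool) :
    (alter g t k).val.get k' = if k' = k then (g (t.get k)).val else t.get k' := by
  induction k generalizing t k' with
  | nil => cases t <;> cases k' <;> simp [alter, get]
  | cons b bs ih =>
    cases t <;> cases b <;> cases k' with
    | nil => simp [alter, get]
    | cons b' bs' => cases b' <;> simp [alter, get, ih]

theorem alter_within {g : Option α → Run (Option α)} {r b : ℕ} (hg : ∀ o, (g o).Within r b 0)
    (t : Trie α) (k : List Bool) : (alter g t k).Within r (b + k.length + 1) 0 := by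
  induction k generalizing t with
  | nil =>
    cases t <;>
    exact Within.mono ((tick_within 1).bind ((hg _).bind (Within.ret _))) (by simp)
      (by simp [add_comm]) (by simp)
  | cons c bs ih =>
    cases t with
    | leaf =>
      exact Within.mono ((tick_within 1).bind ((ih leaf).bind (Within.ret _))) (by simp)
        (by simp; omega) (by simp)
    | node v l r =>
      cases c
      · change ((tick 1).bind fun _ => (alter g l bs).bind fun t => ret (node v t _)).Within _ _ _
        exact Within.mono ((tick_within 1).bind ((ih l).bind (Within.ret _))) (by simp)
          (by simp; omega) (by simp)
      · change ((tick 1).bind fun _ => (alter g _ bs).bind fun t => ret (node v l t)).Within _ _ _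
        exact Within.mono ((tick_within 1).bind ((ih r).bind (Within.ret _))) (by simp)
          (by simp; omega) (by simp)

/-- `alter` only creates nodes along the path of the key, each step bringing at most one node and
one leaf, and never deletes any, even when a value becomes `none`. Traversal costs are therefore
charged to all insertions ever made. -/
theorem nodes_alter (g : Option α → Run (Option α)) (t : Trie α) (k : List Bool) :
    (alter g t k).val.nodes ≤ t.nodes + 2 * (k.length + 1) := by
  induction k generalizing t with
  | nil => cases t <;> simp [alter, nodes]
  | cons c bs ih =>
    cases t with
    | leaf => have := ih leaf; cases c <;> simp [alter, nodes] at this ⊢ <;> omega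
    | node v l r =>
      cases c
      · have := ih l; simp [alter, nodes]; omega
      · have := ih r; simp [alter, nodes]; omega

@[simp] theorem values_val (t : Trie α) (acc : List α) :
    (t.values acc).val = t.entries.map Prod.snd ++ acc := by
  induction t generalizing acc with
  | leaf => rfl
  | node v l r ihl ihr =>
    cases v <;> simp [values, entries, ihl, ihr, Function.comp_def]

theorem values_within (t : Trie α) (acc : List α) : (t.values acc).Within 0 t.nodes 0 := by
  induction t generalizing acc with
  | leaf => exact (tick_ret_within 1 _).mono (by simp) (by simp [nodes]) (by simp)
  | node v l r ihl ihr =>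
    have : (match v with
      | none => ret (l.values (r.values acc).val).val
      | some a => ret (a :: (l.values (r.values acc).val).val)).Within 0 0 0 := by
      cases v <;> exact Within.ret _
    refine Within.mono ((tick_within 1).bind ((ihr acc).bind ((ihl _).bind this))) (by simp)
      (by simp [nodes]; omega) (by simp)

@[simp] theorem count_val (t : Trie α) : t.count.val = t.entries.length := by
  induction t with
  | leaf => rfl
  | node v l r ihl ihr => cases v <;> simp [count, entries, ihl, ihr, add_comm]

theorem entries_length_le (t : Trie α) : t.entries.length ≤ t.nodes := by
  induction t with
  | leaf => simp [entries, nodes]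
  | node v l r ihl ihr => cases v <;> simp [entries, nodes] <;> omega

theorem count_within (t : Trie α) {m : ℕ} (hm : len t.nodes ≤ m) :
    t.count.Within 0 (t.nodes * (3 * m + 3)) 0 := by
  induction t with
  | leaf =>
    exact (tick_ret_within 1 _).mono (by simp)
      (by simp only [nodes]; omega) (by simp)
  | node v l r ihl ihr =>
    have hl : len l.nodes ≤ m := (len_mono (by simp [nodes]; omega)).trans hm
    have hr : len r.nodes ≤ m := (len_mono (by simp [nodes])).trans hm
    have hl' : len l.count.val ≤ m := (len_mono (by simpa using entries_length_le l)).trans hl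
    have hr' : len r.count.val ≤ m := (len_mono (by simpa using entries_length_le r)).trans hr
    have hs : len (l.count.val + r.count.val) ≤ m := by
      refine (len_mono ?_).trans hm
      have := entries_length_le l
      have := entries_length_le r
      simp [nodes]; omega
    refine Within.mono ((tick_within 1).bind ((ihl hl).bind ((ihr hr).bind
      ((natAdd_within hl' hr').bind (r' := 0) (b' := m + 2) (q' := 0) ?_)))) (by simp) ?_ (by simp)
    · cases v
      · exact (Within.ret _).mono le_rfl (Nat.zero_le _) le_rfl
      · exact natAdd_within hs len_one.le
    · simp only [nodes, add_mul]; omega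

theorem mem_entries {t : Trie α} {k : List Bool} {a : α} :
    (k, a) ∈ t.entries ↔ t.get k = some a := by
  induction t generalizing k with
  | leaf => simp [entries]
  | node v l r ihl ihr =>
    cases v <;> rcases k with _ | ⟨_ | _, bs⟩ <;> simp [entries, get, ihl, ihr, eq_comm]

theorem nodup_keys (t : Trie α) : (t.entries.map Prod.fst).Nodup := by
  induction t with
  | leaf => simp [entries]
  | node v l r ihl ihr =>
    have hl : ((l.entries.map (fun x => (false :: x.1, x.2))).map Prod.fst).Nodup := by
      have : ((l.entries.map (fun x => (false :: x.1, x.2))).map Prod.fst) =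
        (l.entries.map Prod.fst).map (List.cons false) := by simp [Function.comp_def]
      rw [this]; exact ihl.map (List.cons_injective)
    have hr : ((r.entries.map (fun x => (true :: x.1, x.2))).map Prod.fst).Nodup := by
      have : ((r.entries.map (fun x => (true :: x.1, x.2))).map Prod.fst) =
        (r.entries.map Prod.fst).map (List.cons true) := by simp [Function.comp_def]
      rw [this]; exact ihr.map (List.cons_injective)
    have hlr : ((l.entries.map (fun x => (false :: x.1, x.2))).map Prod.fst ++
        (r.entries.map (fun x => (true :: x.1, x.2))).map Prod.fst).Nodup := by
      refine List.Nodup.append hl hr ?_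
      intro x hx hx'
      simp only [List.mem_map] at hx hx'
      obtain ⟨_, ⟨_, _, rfl⟩, rfl⟩ := hx
      obtain ⟨_, ⟨_, _, rfl⟩, h⟩ := hx'
      simp at h
    cases v with
    | none => simpa [entries] using hlr
    | some a =>
      simp only [entries, List.map_append, List.map_cons, List.singleton_append,
        List.nodup_cons]
      refine ⟨?_, hlr⟩
      simp

end Trie

/-! ## Sparse univariate polynomials -/

section FoldMod

variable {R : Type u} [CommRing R]

/-- The remainder modulo `x ^ p - 1`, obtained by reducing all exponents modulo `p`. -/
noncomputable def foldMod (p : ℕ) : Polynomial R →ₗ[R] Polynomial R :=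
  Polynomial.lsum fun e => Polynomial.monomial (e % p)

@[simp] theorem foldMod_monomial (p e : ℕ) (c : R) :
    foldMod p (Polynomial.monomial e c) = Polynomial.monomial (e % p) c := by
  simp [foldMod, Polynomial.lsum_apply, Polynomial.sum_monomial_index]

end FoldMod

section UPolyOps

variable {R : Type u} [CommRing R] [DecidableEq R]

/-- The dictionary `t` stores the terms of `g`. -/
structure Represents (t : UPoly R) (g : Polynomial R) : Prop where
  get_bits : ∀ e : ℕ, t.get e.bits = if g.coeff e = 0 then none else some (e, g.coeff e)
  key_eq : ∀ k v, t.get k = some v → k = v.1.bits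

theorem represents_leaf : Represents (Trie.leaf : UPoly R) 0 :=
  ⟨fun e => by simp, fun k v h => by simp at h⟩

theorem Represents.addTerm {t : UPoly R} {g : Polynomial R} (h : Represents t g) (e : ℕ) (c : R) :
    Represents (addTerm t e c).val (g + Polynomial.monomial e c) := by
  constructor
  · intro e'
    simp only [KroneckerInterp.addTerm, bind_val, natBits_val, Trie.get_alter, h.get_bits,
      Polynomial.coeff_add, Polynomial.coeff_monomial]
    by_cases he : e' = e
    · subst he
      simp only [if_true]
      by_cases hg : g.coeff e' = 0
      · simp [hg]
      · simp [hg]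
    · have : ¬ e'.bits = e.bits := fun hh => he (bits_injective hh)
      simp [this, Ne.symm he]
  · intro k v
    simp only [KroneckerInterp.addTerm, bind_val, natBits_val, Trie.get_alter, h.get_bits]
    split_ifs with hk hg
    · intro hv
      simp at hv
      rw [← hv.2, hk]
    · intro hv
      simp at hv
      rw [← hv.2, hk]
    · exact h.key_eq k v

theorem addTerm_within (t : UPoly R) {e L : ℕ} (c : R) (he : len e ≤ L) :
    (addTerm t e c).Within 2 (2 * L) 0 := by
  refine Within.mono ((natBits_within he).bind (Trie.alter_within (r := 2) (b := 0) ?_ _ _))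
    le_rfl ?_ le_rfl
  · rintro (_ | ⟨_, b⟩)
    · exact Within.mono (Within.bind (ringIsZero_within _) (Within.ret _)) (by simp) le_rfl le_rfl
    · change ((ringAdd b c).bind fun s => (ringIsZero s).bind fun z =>
        ret (if z then none else some (e, s))).Within 2 0 0
      exact Within.mono (Within.bind (ringAdd_within _ _) (Within.bind (ringIsZero_within _)
        (Within.ret _))) le_rfl le_rfl le_rfl
  · have := bits_length e
    simp only [natBits_val]; omega

theorem nodes_addTerm (t : UPoly R) {e L : ℕ} (c : R) (he : len e ≤ L) :
    (addTerm t e c).val.nodes ≤ t.nodes + 2 * L := by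
  refine (Trie.nodes_alter _ _ _).trans ?_
  rw [natBits_val, bits_length]; omega

theorem Represents.subTerm {t : UPoly R} {g : Polynomial R} (h : Represents t g) (e : ℕ) (c : R) :
    Represents (subTerm t e c).val (g - Polynomial.monomial e c) := by
  rw [sub_eq_add_neg, ← map_neg]
  exact h.addTerm e (-c)

theorem subTerm_within (t : UPoly R) {e L : ℕ} (c : R) (he : len e ≤ L) :
    (subTerm t e c).Within 3 (2 * L) 0 :=
  Within.mono ((ringNeg_within c).bind (addTerm_within t _ he)) (by simp) (by simp) le_rfl

theorem nodes_subTerm (t : UPoly R) {e L : ℕ} (c : R) (he : len e ≤ L) :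
    (subTerm t e c).val.nodes ≤ t.nodes + 2 * L := nodes_addTerm t (-c) he

theorem Represents.coeffAt_val {t : UPoly R} {g : Polynomial R} (h : Represents t g) (e : ℕ) :
    (coeffAt t e).val = g.coeff e := by
  simp only [coeffAt, bind_val, natBits_val, Trie.find_val, h.get_bits]
  by_cases hg : g.coeff e = 0 <;> simp [hg]

theorem coeffAt_within (t : UPoly R) {e L : ℕ} (he : len e ≤ L) :
    (coeffAt t e).Within 0 (2 * L) 0 := by
  refine Within.mono ((natBits_within he).bind ((Trie.find_within _ _).bind
    (r' := 0) (b' := 0) (q' := 0) ?_)) (by simp) ?_ (by simp)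
  · split <;> exact Within.ret _
  · have := bits_length e
    simp only [natBits_val]; omega

/-- The values stored in a dictionary that represents `g` are the terms of `g`. -/
theorem Represents.isUniTerms {t : UPoly R} {g : Polynomial R} (h : Represents t g) :
    ((t.values []).val.map Prod.fst).Nodup ∧
      (∀ e c, (e, c) ∈ (t.values []).val ↔ c ≠ 0 ∧ g.coeff e = c) := by
  have hmem : ∀ e c, (e, c) ∈ (t.values []).val ↔ c ≠ 0 ∧ g.coeff e = c := by
    intro e c
    simp only [Trie.values_val, List.append_nil, List.mem_map, Prod.exists, exists_eq_right]
    constructor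
    · rintro ⟨k, hk⟩
      rw [Trie.mem_entries] at hk
      -- Not every binary string is the bits of a number, so `get_bits` alone does not control the
      -- traversal; `key_eq` excludes other keys.
      have := h.key_eq _ _ hk
      rw [this, h.get_bits] at hk
      split_ifs at hk with h0
      simp at hk
      exact ⟨hk ▸ h0, hk⟩
    · rintro ⟨h0, rfl⟩
      exact ⟨e.bits, by rw [Trie.mem_entries, h.get_bits, if_neg h0]⟩
  refine ⟨?_, hmem⟩
  have h1 := t.nodup_keys
  have h2 : t.entries.map Prod.fst = (t.entries.map fun x => x.2.1).map Nat.bits := by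
    rw [List.map_map]
    refine List.map_congr_left ?_
    rintro ⟨k, v⟩ hx
    exact h.key_eq _ _ (Trie.mem_entries.1 hx)
  rw [h2] at h1
  have := List.Nodup.of_map _ h1
  simpa [Function.comp_def] using this

theorem Represents.values_length {t : UPoly R} {g : Polynomial R} (h : Represents t g) :
    (t.values []).val.length = g.support.card := by
  obtain ⟨h1, h2⟩ := h.isUniTerms
  have : ((t.values []).val.map Prod.fst).toFinset = g.support := by
    ext e
    rw [List.mem_toFinset, List.mem_map, Polynomial.mem_support_iff]
    constructor
    · rintro ⟨⟨e', c⟩, hx, rfl⟩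
      rw [h2] at hx
      rw [hx.2]; exact hx.1
    · intro hx
      exact ⟨_, (h2 _ _).2 ⟨hx, rfl⟩, rfl⟩
  rw [← this, List.toFinset_card_of_nodup h1, List.length_map]

theorem Represents.count_val {t : UPoly R} {g : Polynomial R} (h : Represents t g) :
    t.count.val = g.support.card := by
  rw [← h.values_length]; simp

theorem Represents.addTerms {t : UPoly R} {g : Polynomial R} (h : Represents t g)
    (l : List (ℕ × R)) : Represents (addTerms l t).val
      (g + (l.map fun t => Polynomial.monomial t.1 t.2).sum) := by
  induction l generalizing t g with
  | nil => simpa [KroneckerInterp.addTerms] using h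
  | cons a l ih =>
    simp only [List.map_cons, List.sum_cons, ← add_assoc]
    exact ih (h.addTerm a.1 a.2)

theorem addTerms_within (l : List (ℕ × R)) (t : UPoly R) {L : ℕ} (hl : ∀ x ∈ l, len x.1 ≤ L) :
    (addTerms l t).Within (2 * l.length) (l.length * (2 * L + 1) + 1) 0 := by
  induction l generalizing t with
  | nil => exact (tick_ret_within 1 _).mono (by simp) (by simp) le_rfl
  | cons a l ih =>
    refine Within.mono ((tick_within 1).bind ((addTerm_within t a.2 (hl a (by simp))).bind
      (ih _ fun x hx => hl x (by simp [hx])))) (by simp; omega) ?_ le_rfl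
    rw [List.length_cons, add_mul]; omega

theorem nodes_addTerms (l : List (ℕ × R)) (t : UPoly R) {L : ℕ} (hl : ∀ x ∈ l, len x.1 ≤ L) :
    (addTerms l t).val.nodes ≤ t.nodes + 2 * L * l.length := by
  induction l generalizing t with
  | nil => simp [addTerms]
  | cons a l ih =>
    refine (ih _ fun x hx => hl x (by simp [hx])).trans ?_
    have := nodes_addTerm t a.2 (hl a (by simp))
    rw [List.length_cons, mul_add]; omega

theorem Represents.addTermsMod {t : UPoly R} {g : Polynomial R} (h : Represents t g) (p : ℕ)
    (l : List (ℕ × R)) : Represents (addTermsMod p l t).val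
      (g + foldMod p (l.map fun t => Polynomial.monomial t.1 t.2).sum) := by
  induction l generalizing t g with
  | nil => simpa [KroneckerInterp.addTermsMod] using h
  | cons a l ih =>
    simp only [List.map_cons, List.sum_cons, map_add, foldMod_monomial, ← add_assoc]
    exact ih (h.addTerm (a.1 % p) a.2)

theorem len_mod_le {e p m : ℕ} (hp : 0 < p) (hm : len p ≤ m) : len (e % p) ≤ m :=
  (len_mono (Nat.mod_lt e hp).le).trans hm

theorem addTermsMod_within {p m : ℕ} (hp : 0 < p) (hm : len p ≤ m) (l : List (ℕ × R))
    (t : UPoly R) {L : ℕ} (hl : ∀ x ∈ l, len x.1 ≤ L) :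
    (addTermsMod p l t).Within (2 * l.length) (l.length * (L * m + 2 * m + 1) + 1) 0 := by
  induction l generalizing t with
  | nil => exact (tick_ret_within 1 _).mono (by simp) (by simp) le_rfl
  | cons a l ih =>
    refine Within.mono ((tick_within 1).bind ((natMod_within (hl a (by simp)) hm).bind
      ((addTerm_within t a.2 (len_mod_le hp hm)).bind
      (ih _ fun x hx => hl x (by simp [hx]))))) (by simp; omega) ?_ le_rfl
    rw [List.length_cons, add_mul]; omega

theorem nodes_addTermsMod {p m : ℕ} (hp : 0 < p) (hm : len p ≤ m) (l : List (ℕ × R))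
    (t : UPoly R) : (addTermsMod p l t).val.nodes ≤ t.nodes + 2 * m * l.length := by
  induction l generalizing t with
  | nil => simp [addTermsMod]
  | cons a l ih =>
    refine (ih _).trans ?_
    have := nodes_addTerm t (e := a.1 % p) a.2 (len_mod_le hp hm)
    rw [List.length_cons, mul_add]; simp only [natMod_val] at *; omega

/-! ### Scalar products -/

/-- The sum of the products of the entries of two lists. -/
def dotp (as bs : List ℕ) : ℕ := (List.zipWith (· * ·) as bs).sum

@[simp] theorem dot_val (as bs : List ℕ) : (dot as bs).val = dotp as bs := by
  induction as generalizing bs with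
  | nil => cases bs <;> rfl
  | cons a as ih => cases bs <;> simp [dot, dotp, ih]

/-- All summands are natural numbers, so a length bound for the whole scalar product also bounds
every product and every partial sum formed on the way. -/
theorem dot_within (as bs : List ℕ) {L m : ℕ} (ha : ∀ a ∈ as, len a ≤ L) (hb : ∀ b ∈ bs, len b ≤ m)
    (hd : len (dotp as bs) ≤ L) : (dot as bs).Within 0 (as.length * (4 * L * m) + 1) 0 := by
  induction as generalizing bs with
  | nil => cases bs <;> exact (tick_ret_within 1 _).mono (by simp) (by simp) le_rfl
  | cons a as ih =>
    cases bs with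
    | nil => exact (tick_ret_within 1 _).mono (by simp) (by simp) le_rfl
    | cons b bs =>
      have h1 : len (a * b) ≤ L := (len_mono (by simp [dotp])).trans hd
      have h2 : len (dotp as bs) ≤ L := (len_mono (by simp [dotp])).trans hd
      have hL : 1 ≤ L := (one_le_len _).trans h1
      have hm : 1 ≤ m := (one_le_len _).trans (hb b (by simp))
      refine Within.mono ((tick_within 1).bind ((natMul_within (ha a (by simp)) (hb b (by simp))).bind
        ((ih bs (fun x hx => ha x (by simp [hx])) (fun x hx => hb x (by simp [hx])) h2).bind
        (natAdd_within h1 (by simpa using h2))))) le_rfl ?_ le_rfl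
      rw [List.length_cons, add_mul]
      nlinarith [Nat.mul_le_mul hL hm, Nat.mul_le_mul (le_refl L) hm]

@[simp] theorem sumList_val (as : List ℕ) : (sumList as).val = as.sum := by
  induction as with
  | nil => rfl
  | cons a as ih => simp [sumList, ih]

theorem sumList_within (as : List ℕ) {L : ℕ} (hs : len as.sum ≤ L) :
    (sumList as).Within 0 (as.length * (2 * L + 1) + 1) 0 := by
  induction as with
  | nil => exact (tick_ret_within 1 _).mono (by simp) (by simp) le_rfl
  | cons a as ih =>
    have h1 : len a ≤ L := (len_mono (by simp)).trans hs
    have h2 : len as.sum ≤ L := (len_mono (by simp)).trans hs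
    refine Within.mono ((tick_within 1).bind ((ih h2).bind
      (natAdd_within h1 (by simpa using h2)))) le_rfl ?_ le_rfl
    rw [List.length_cons, add_mul]; omega

theorem Represents.subImage {t : UPoly R} {g : Polynomial R} (h : Represents t g) (w : List ℕ)
    (s : List (List ℕ × R)) : Represents (subImage w s t).val
      (g - (s.map fun u => Polynomial.monomial (dotp u.1 w) u.2).sum) := by
  induction s generalizing t g with
  | nil => simpa [KroneckerInterp.subImage] using h
  | cons a l ih =>
    simp only [List.map_cons, List.sum_cons, ← sub_sub]
    rw [← dot_val]
    exact ih (h.subTerm _ a.2)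

theorem Represents.subImageMod {t : UPoly R} {g : Polynomial R} (h : Represents t g) (p : ℕ)
    (w : List ℕ) (s : List (List ℕ × R)) : Represents (subImageMod p w s t).val
      (g - foldMod p (s.map fun u => Polynomial.monomial (dotp u.1 w) u.2).sum) := by
  induction s generalizing t g with
  | nil => simpa [KroneckerInterp.subImageMod] using h
  | cons a l ih =>
    simp only [List.map_cons, List.sum_cons, map_add, foldMod_monomial, ← sub_sub]
    rw [← dot_val]
    exact ih (h.subTerm _ a.2)

/-- All numbers that come up when the image of the terms `s` under `x_i = x ^ w_i` is computed
have at most `L` bits, and there are `n` variables. -/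
structure ImageBounds (n L : ℕ) (w : List ℕ) (s : List (List ℕ × R)) : Prop where
  length_eq : ∀ u ∈ s, u.1.length = n
  len_entry : ∀ u ∈ s, ∀ e ∈ u.1, len e ≤ L
  len_dotp : ∀ u ∈ s, len (dotp u.1 w) ≤ L

theorem ImageBounds.tail {n L : ℕ} {w : List ℕ} {a : List ℕ × R} {s : List (List ℕ × R)}
    (h : ImageBounds n L w (a :: s)) : ImageBounds n L w s :=
  ⟨fun u hu => h.length_eq u (by simp [hu]), fun u hu => h.len_entry u (by simp [hu]),
    fun u hu => h.len_dotp u (by simp [hu])⟩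

theorem ImageBounds.dot_within {n L m : ℕ} (hn : 1 ≤ n) (hm : 1 ≤ m) {w : List ℕ}
    (hw : ∀ x ∈ w, len x ≤ m) {s : List (List ℕ × R)} (h : ImageBounds n L w s) {u : List ℕ × R}
    (hu : u ∈ s) : (dot u.1 w).Within 0 (5 * (n * L * m)) 0 := by
  refine (KroneckerInterp.dot_within u.1 w (h.len_entry u hu) hw (h.len_dotp u hu)).mono
    le_rfl ?_ le_rfl
  rw [h.length_eq u hu]
  have hL : 1 ≤ L := (one_le_len _).trans (h.len_dotp u hu)
  have : 1 ≤ n * L * m := Nat.mul_pos (Nat.mul_pos hn hL) hm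
  nlinarith

/-- Each factor is at least one, so every partial product is absorbed by `n * L * m`; this leaves
linear inequalities in the cost estimates. -/
theorem le_mul_mul {n L m : ℕ} (hn : 1 ≤ n) (hL : 1 ≤ L) (hm : 1 ≤ m) :
    1 ≤ n * L * m ∧ L ≤ n * L * m ∧ m ≤ n * L * m ∧ L * m ≤ n * L * m ∧ n ≤ n * L * m ∧
      n * L ≤ n * L * m ∧ n * m ≤ n * L * m := by
  have h1 : 1 ≤ n * L := Nat.mul_pos hn hL
  have h2 : L ≤ n * L := Nat.le_mul_of_pos_left L hn
  have h3 : n * L ≤ n * L * m := Nat.le_mul_of_pos_right _ hm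
  have h4 : m ≤ n * L * m := Nat.le_mul_of_pos_left m h1
  have h5 : L * m ≤ n * L * m := Nat.mul_le_mul_right m h2
  have h6 : n ≤ n * L := Nat.le_mul_of_pos_right n hL
  exact ⟨h1.trans h3, h2.trans h3, h4, h5, h6.trans h3, h3, Nat.mul_le_mul_right m h6⟩

theorem subImage_within {n L m : ℕ} (hn : 1 ≤ n) (hm : 1 ≤ m) {w : List ℕ}
    (hw : ∀ x ∈ w, len x ≤ m) {s : List (List ℕ × R)} (h : ImageBounds n L w s) (t : UPoly R) :
    (subImage w s t).Within (3 * s.length) (s.length * (8 * (n * L * m)) + 1) 0 := by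
  induction s generalizing t with
  | nil => exact (tick_ret_within 1 _).mono (by simp) (by simp) le_rfl
  | cons a s ih =>
    have hd := h.len_dotp a (by simp)
    refine Within.mono ((tick_within 1).bind ((h.dot_within hn hm hw (List.mem_cons_self)).bind
      ((subTerm_within t a.2 (by simpa using hd)).bind (ih h.tail _)))) (by simp; omega) ?_ le_rfl
    obtain ⟨h1, h2, h3, h4, h5⟩ := le_mul_mul hn ((one_le_len _).trans hd) hm
    rw [List.length_cons, add_mul]; omega

theorem nodes_subImage {n L : ℕ} {w : List ℕ} {s : List (List ℕ × R)}
    (h : ImageBounds n L w s) (t : UPoly R) :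
    (subImage w s t).val.nodes ≤ t.nodes + 2 * L * s.length := by
  induction s generalizing t with
  | nil => simp [subImage]
  | cons a s ih =>
    refine (ih h.tail _).trans ?_
    have := nodes_subTerm t (e := dotp a.1 w) a.2 (h.len_dotp a (by simp))
    rw [List.length_cons, mul_add]; simp only [dot_val] at *; omega

theorem subImageMod_within {n L m p : ℕ} (hn : 1 ≤ n) (hp : 0 < p) (hpm : len p ≤ m)
    {w : List ℕ} (hw : ∀ x ∈ w, len x ≤ m) {s : List (List ℕ × R)} (h : ImageBounds n L w s)
    (t : UPoly R) :
    (subImageMod p w s t).Within (3 * s.length) (s.length * (9 * (n * L * m)) + 1) 0 := by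
  have hm : 1 ≤ m := (one_le_len _).trans hpm
  induction s generalizing t with
  | nil => exact (tick_ret_within 1 _).mono (by simp) (by simp) le_rfl
  | cons a s ih =>
    have hd := h.len_dotp a (by simp)
    refine Within.mono ((tick_within 1).bind ((h.dot_within hn hm hw (List.mem_cons_self)).bind
      ((natMod_within (by simpa using hd) hpm).bind
      ((subTerm_within t a.2 (len_mod_le hp hpm)).bind (ih h.tail _))))) (by simp; omega) ?_ le_rfl
    obtain ⟨h1, h2, h3, h4, h5⟩ := le_mul_mul hn ((one_le_len _).trans hd) hm
    rw [List.length_cons, add_mul]; omega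

theorem nodes_subImageMod {m p : ℕ} (hp : 0 < p) (hpm : len p ≤ m) (w : List ℕ)
    (s : List (List ℕ × R)) (t : UPoly R) :
    (subImageMod p w s t).val.nodes ≤ t.nodes + 2 * m * s.length := by
  induction s generalizing t with
  | nil => simp [subImageMod]
  | cons a s ih =>
    refine (ih _).trans ?_
    have := nodes_subTerm t (e := dotp a.1 w % p) a.2 (len_mod_le hp hpm)
    rw [List.length_cons, mul_add]; simp only [dot_val, natMod_val] at *; omega

end UPolyOps

/-! ## Primes -/

/-- The primes in increasing order, counted from `0`. -/
noncomputable abbrev prm (i : ℕ) : ℕ := Nat.nth Nat.Prime i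

theorem prm_prime (i : ℕ) : (prm i).Prime := Nat.prime_nth_prime i

theorem prm_strictMono : StrictMono prm := Nat.nth_strictMono Nat.infinite_setOfPred_prime

theorem exists_prm_eq {p : ℕ} (hp : p.Prime) : ∃ i, prm i = p :=
  ⟨_, Nat.nth_count hp⟩

/-- Chebyshev's lower bound for the prime counting function at `P = prm k`, where it equals `k + 1`,
gives `P * log 2 ≤ (k + 1) * log P + log (P + 1)`. The last summand is at most `2 * log P`, whence
`k + 3`, and `log P` is at most `log 2` times the binary size. -/
theorem prm_le_mul_size (k : ℕ) : prm k ≤ (k + 3) * Nat.size (prm k) := by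
  set P := prm k with hP
  have h2 : 2 ≤ P := (prm_prime k).two_le
  have hpi : Nat.primeCounting P = k + 1 := by
    have := Nat.primeCounting'_nth_eq k
    rw [Nat.primeCounting, Nat.primeCounting', Nat.count_succ] at *
    simp [hP, prm_prime k, this]
  have h := Chebyshev.pi_ge P
  rw [hpi] at h
  have hlog : 0 < Real.log P := Real.log_pos (by exact_mod_cast h2)
  rw [div_le_iff₀ hlog] at h
  have h3 : Real.log (P + 1) ≤ 2 * Real.log P := by
    rw [← Real.log_rpow (by positivity), Real.log_le_log_iff (by positivity) (by positivity)]
    have : (2 : ℝ) ≤ P := by exact_mod_cast h2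
    norm_num
    nlinarith
  have h4 : Real.log P ≤ Nat.size P * Real.log 2 := by
    rw [← Real.log_pow, Real.log_le_log_iff (by positivity) (by positivity)]
    exact_mod_cast (Nat.lt_size_self P).le
  have h5 : (P : ℝ) * Real.log 2 ≤ ((k + 3 : ℝ) * Nat.size P) * Real.log 2 := by
    push_cast at h
    nlinarith
  have := le_of_mul_le_mul_right h5 (Real.log_pos one_lt_two)
  exact_mod_cast this

/-- A weak form of Chebyshev's bound. -/
theorem size_prm_le (k : ℕ) : Nat.size (prm k) ≤ 2 * Nat.size (k + 3) + 6 := by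
  set s := Nat.size (prm k) with hs
  set r := Nat.size (k + 3) with hr
  by_contra! hlt
  have h1 : 2 ^ (s - 1) ≤ prm k := by
    by_contra! h
    rw [← Nat.size_le] at h
    omega
  have h2 : prm k ≤ (k + 3) * s := prm_le_mul_size k
  have h3 : k + 3 < 2 ^ r := Nat.lt_size_self _
  have h4 : 2 ^ (s - 1) < 2 ^ r * s :=
    (h1.trans h2).trans_lt (Nat.mul_lt_mul_of_pos_right h3 (by omega))
  -- The size `s` satisfies `2 ^ (s - 1) < 2 ^ r * s`; from `2 * r + 7` on the exponential has
  -- overtaken the linear factor, so `s` cannot be that large.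
  have h5 : ∀ j, 2 * r + 7 ≤ j → 2 ^ r * j < 2 ^ (j - 1) := by
    intro j hj
    induction j, hj using Nat.le_induction with
    | base =>
      have e : 2 * r + 7 - 1 = r + (r + 6) := by omega
      rw [e, pow_add 2 r]
      refine Nat.mul_lt_mul_of_pos_left ?_ (by positivity)
      have : r < 2 ^ r := Nat.lt_two_pow_self
      rw [pow_add]; omega
    | succ j hj ih =>
      have e : j + 1 - 1 = (j - 1) + 1 := by omega
      rw [e, pow_succ]
      have : 2 ^ r * (j + 1) ≤ 2 ^ r * (2 * j) := Nat.mul_le_mul_left _ (by omega)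
      nlinarith
  have := h5 s (by omega)
  omega

theorem prm_le (k : ℕ) : prm k ≤ (k + 3) * (2 * Nat.size (k + 3) + 6) :=
  (prm_le_mul_size k).trans (Nat.mul_le_mul_left _ (size_prm_le k))

@[simp] theorem noDivisor_val (c : ℕ) (l : List ℕ) :
    (noDivisor c l).val = decide (∀ q ∈ l, ¬ q ∣ c) := by
  induction l with
  | nil => rfl
  | cons q l ih =>
    by_cases h : c % q = 0
    · simp [noDivisor, h, Nat.dvd_of_mod_eq_zero h]
    · simp [noDivisor, h, ih, Nat.dvd_iff_mod_eq_zero]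

theorem noDivisor_within {c m : ℕ} (hc : len c ≤ m) (l : List ℕ)
    (hl : ∀ q ∈ l, 0 < q ∧ len q ≤ m) :
    (noDivisor c l).Within 0 (l.length * (3 * m ^ 2) + 1) 0 := by
  have hm : 1 ≤ m := (one_le_len _).trans hc
  induction l with
  | nil => exact (tick_ret_within 1 _).mono (by simp) (by simp) le_rfl
  | cons q l ih =>
    obtain ⟨hq, hqm⟩ := hl q (by simp)
    refine Within.mono ((natMod_within hc hqm).bind
      ((natEq_within (len_mod_le hq hqm) len_zero.le).bind
      (Within.ite (fun _ => (Within.ret _).mono le_rfl (Nat.zero_le _) le_rfl)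
      (fun _ => ih fun x hx => hl x (by simp [hx]))))) le_rfl ?_ le_rfl
    rw [List.length_cons, add_mul]; nlinarith

/-- A composite number has a smaller prime divisor, its least factor, so trial division by all
smaller primes decides primality. -/
theorem prime_iff_of_mem_iff {c : ℕ} (hc : 2 ≤ c) {ps : List ℕ}
    (hps : ∀ q, q ∈ ps ↔ q.Prime ∧ q < c) : (∀ q ∈ ps, ¬ q ∣ c) ↔ c.Prime := by
  constructor
  · intro h
    by_contra hp
    have h1 : c.minFac.Prime := Nat.minFac_prime (by omega)
    refine h c.minFac ((hps _).2 ⟨h1, ?_⟩) (Nat.minFac_dvd c)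
    refine lt_of_le_of_ne (Nat.minFac_le (by omega)) ?_
    intro he
    exact hp (he ▸ h1)
  · intro hp q hq hd
    obtain ⟨h1, h2⟩ := (hps q).1 hq
    exact h2.ne ((Nat.prime_dvd_prime_iff_eq h1 hp).1 hd)

theorem searchPrime_val {ps : List ℕ} {P : ℕ} (hP : P.Prime) (f c : ℕ) (hc : 2 ≤ c) (hcP : c ≤ P)
    (hbetween : ∀ x, c ≤ x → x < P → ¬ x.Prime) (hf : P ≤ c + f)
    (hps : ∀ q, q ∈ ps ↔ q.Prime ∧ q < c) : (searchPrime ps f c).val = P := by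
  induction f generalizing c with
  | zero => exact le_antisymm hcP hf
  | succ f ih =>
    simp only [searchPrime, bind_val, noDivisor_val, prime_iff_of_mem_iff hc hps, decide_eq_true_eq]
    split_ifs with h
    · by_contra hne
      exact hbetween c le_rfl (lt_of_le_of_ne hcP hne) h
    · have hcP' : c + 1 ≤ P := by
        refine lt_of_le_of_ne hcP ?_
        rintro rfl
        exact h hP
      refine ih (c + 1) (by omega) hcP' (fun x hx => hbetween x (by omega)) (by omega) fun q => ?_
      rw [hps]
      constructor
      · rintro ⟨h1, h2⟩
        exact ⟨h1, by omega⟩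
      · rintro ⟨h1, h2⟩
        refine ⟨h1, lt_of_le_of_ne (by omega) ?_⟩
        rintro rfl
        exact h h1

/-- The search stops at `P` at the latest, since no smaller prime divides it. The cost thus depends
on the gap `P - c` and not on the search bound `f`. -/
theorem searchPrime_within {ps : List ℕ} {P m : ℕ} (hP : P.Prime) (f c : ℕ) (hc : 2 ≤ c)
    (hcP : c ≤ P) (hm : len P ≤ m) (hps : ∀ q ∈ ps, q.Prime ∧ q < c) :
    (searchPrime ps f c).Within 0
      ((P - c + 1) * (ps.length * (3 * m ^ 2) + m + 3)) 0 := by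
  induction f generalizing c with
  | zero => exact (Within.ret _).mono le_rfl (Nat.zero_le _) le_rfl
  | succ f ih =>
    have hcm : len c ≤ m := (len_mono hcP).trans hm
    have h1 := noDivisor_within hcm ps fun q hq =>
      ⟨(hps q hq).1.pos, (len_mono (hps q hq).2.le).trans hcm⟩
    by_cases hcP' : c + 1 ≤ P
    · refine Within.mono (h1.bind (Within.ite (fun _ => (Within.ret _).mono le_rfl (Nat.zero_le _)
        le_rfl) fun _ => (natAdd_within hcm len_one.le).bind
        (ih (c + 1) (by omega) hcP' fun q hq => ⟨(hps q hq).1, (hps q hq).2.trans (by omega)⟩)))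
        le_rfl ?_ le_rfl
      have e : P - c + 1 = (P - (c + 1) + 1) + 1 := by omega
      rw [e, add_mul (P - (c + 1) + 1) 1]; omega
    · obtain rfl : c = P := by omega
      have hd : ∀ q ∈ ps, ¬ q ∣ c := fun q hq hd =>
        (hps q hq).2.ne ((Nat.prime_dvd_prime_iff_eq (hps q hq).1 hP).1 hd)
      refine Within.mono (h1.bind (Within.ite (fun _ => Within.ret _) fun h => ?_))
        le_rfl ?_ le_rfl
      · simp only [noDivisor_val, decide_eq_true_eq] at h
        exact absurd hd h
      · simp; omega

/-- The first primes, in decreasing order, are the primes below `c`. -/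
structure PrimesBelow (i c : ℕ) (ps : List ℕ) : Prop where
  eq : ps = ((List.range i).map prm).reverse
  two_le : 2 ≤ c
  le_prm : c ≤ prm i
  prm_lt : ∀ j < i, prm j < c

theorem PrimesBelow.mem_iff {i c : ℕ} {ps : List ℕ} (h : PrimesBelow i c ps) (q : ℕ) :
    q ∈ ps ↔ q.Prime ∧ q < c := by
  rw [h.eq]
  simp only [List.mem_reverse, List.mem_map, List.mem_range]
  constructor
  · rintro ⟨j, hj, rfl⟩
    exact ⟨prm_prime j, h.prm_lt j hj⟩
  · rintro ⟨hq, hqc⟩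
    obtain ⟨j, rfl⟩ := exists_prm_eq hq
    exact ⟨j, prm_strictMono.lt_iff_lt.1 (hqc.trans_le h.le_prm), rfl⟩

theorem PrimesBelow.search_val {i c : ℕ} {ps : List ℕ} (h : PrimesBelow i c ps) :
    (searchPrime ps c c).val = prm i := by
  refine searchPrime_val (prm_prime i) c c h.two_le h.le_prm ?_ ?_ h.mem_iff
  · intro x hx hxi hp
    obtain ⟨j, rfl⟩ := exists_prm_eq hp
    have := h.prm_lt j (prm_strictMono.lt_iff_lt.1 hxi)
    omega
  -- Bertrand's postulate: a prime in `(c, 2 * c]` shows that `c` candidates are enough.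
  · obtain ⟨p, hp, h1, h2⟩ := Nat.exists_prime_lt_and_le_two_mul c (by have := h.two_le; omega)
    obtain ⟨j, rfl⟩ := exists_prm_eq hp
    have : i ≤ j := by
      by_contra! hj
      have := h.prm_lt j hj
      omega
    have := prm_strictMono.monotone this
    omega

theorem PrimesBelow.succ {i c : ℕ} {ps : List ℕ} (h : PrimesBelow i c ps) :
    PrimesBelow (i + 1) (prm i + 1) (prm i :: ps) where
  eq := by rw [h.eq, List.range_succ]; simp
  two_le := by have := h.two_le; have := h.le_prm; omega
  le_prm := prm_strictMono (Nat.lt_succ_self i)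
  prm_lt := fun j hj => Nat.lt_succ_of_le (prm_strictMono.monotone (Nat.le_of_lt_succ hj))

theorem morePrimes_val (k : ℕ) {i c : ℕ} {ps : List ℕ} (h : PrimesBelow i c ps) :
    (morePrimes k c ps).val = (List.range (i + k)).map prm := by
  induction k generalizing i c ps with
  | zero => simp [morePrimes, h.eq]
  | succ k ih =>
    have := ih h.succ
    simp only [morePrimes, bind_val, natAdd_val, h.search_val]
    rw [this]
    congr 2
    omega

/-- The gaps between consecutive primes telescope, so over the whole run about `prm (i + k) - c`
candidates are tested, each by at most `K` divisions. -/
theorem morePrimes_within (k : ℕ) {i c K m : ℕ} {ps : List ℕ} (h : PrimesBelow i c ps)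
    (hK : i + k ≤ K) (hm : len (prm K) ≤ m) :
    (morePrimes k c ps).Within 0
      ((prm (i + k) - c) * (K * (3 * m ^ 2) + m + 3) + k * (2 * m + 2) + K + 1) 0 := by
  have hlen : ps.length = i := by rw [h.eq]; simp
  induction k generalizing i c ps with
  | zero =>
    refine Within.mono (reverseList_within _ _) le_rfl ?_ le_rfl
    omega
  | succ k ih =>
    have hiK : len (prm i) ≤ m := (len_mono (prm_strictMono.monotone (by omega))).trans hm
    have hkK : len k ≤ m := by
      refine (len_mono ?_).trans hm
      exact (by omega : k ≤ K).trans (prm_strictMono.le_apply)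
    have h1 := ih h.succ (by omega) (by simp [hlen])
    have h2 := searchPrime_within (prm_prime i) c c h.two_le h.le_prm hiK
      fun q hq => (h.mem_iff q).1 hq
    refine Within.mono ((tick_within _).bind (h2.bind ((natAdd_within (l := m)
      (by rw [h.search_val]; exact hiK) len_one.le).bind (r' := 0) (q' := 0)
      (b' := (prm (i + 1 + k) - (prm i + 1)) * (K * (3 * m ^ 2) + m + 3) + k * (2 * m + 2) + K + 1)
      ?_))) le_rfl ?_ le_rfl
    · simpa [h.search_val] using h1
    -- The search starts again at `prm i + 1`, so the interval splits into the candidates up to `prm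
    -- i` inclusive and those treated by the recursion.
    · have e : prm (i + (k + 1)) - c = (prm i - c + 1) + (prm (i + 1 + k) - (prm i + 1)) := by
        have := h.le_prm
        have : prm i < prm (i + (k + 1)) := prm_strictMono (by omega)
        rw [show i + 1 + k = i + (k + 1) by omega]
        omega
      rw [e, hlen, add_mul (prm i - c + 1), add_mul k 1]
      have : (prm i - c + 1) * (i * (3 * m ^ 2) + m + 3) ≤
          (prm i - c + 1) * (K * (3 * m ^ 2) + m + 3) := by
        gcongr; omega
      omega

theorem primesBelow_two : PrimesBelow 0 2 [] where
  eq := rfl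
  two_le := le_rfl
  le_prm := (prm_prime 0).two_le
  prm_lt := by simp

@[simp] theorem firstPrimes_val (K : ℕ) : (firstPrimes K).val = (List.range K).map prm := by
  rw [firstPrimes, morePrimes_val K primesBelow_two, zero_add]

theorem firstPrimes_within {K m : ℕ} (hK : 1 ≤ K) (hm : len (prm K) ≤ m) :
    (firstPrimes K).Within 0 (13 * (prm K * (K * m ^ 2))) 0 := by
  refine (morePrimes_within K primesBelow_two (K := K) (by simp) hm).mono le_rfl ?_ le_rfl
  have hm1 : 1 ≤ m := (one_le_len _).trans hm
  have hP : 2 ≤ prm K := (prm_prime K).two_le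
  have h1 : (prm (0 + K) - 2) * (K * (3 * m ^ 2) + m + 3) ≤ prm K * (7 * (K * m ^ 2)) := by
    rw [zero_add]
    refine Nat.mul_le_mul (Nat.sub_le _ _) ?_
    nlinarith [Nat.mul_le_mul hK (Nat.mul_le_mul hm1 hm1), Nat.mul_le_mul hK (Nat.mul_le_mul_left m hm1)]
  have h2 : K * m ≤ K * m ^ 2 := by rw [sq]; exact Nat.mul_le_mul_left K (Nat.le_mul_of_pos_left m hm1)
  have h3 : K ≤ K * m := Nat.le_mul_of_pos_right K hm1
  have h4 : 2 * (K * m ^ 2) ≤ prm K * (K * m ^ 2) := Nat.mul_le_mul_right _ hP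
  nlinarith

/-! ## The numbers of samples -/

/-- The number of members of the list that are multiplied until the product is at least `B`. -/
def leastNum (B : ℕ) (l : List ℕ) : ℕ := (leastCount B l 1 0).val

/-- The comparison comes after a multiplication, so at least one member is used as soon as the list
is nonempty; this explains `1 ≤ k` and the restriction of minimality to `1 ≤ j`. -/
theorem leastCount_spec (B : ℕ) (l : List ℕ) (P m₀ : ℕ) :
    ∃ k ≤ l.length, (leastCount B l P m₀).val = m₀ + k ∧ (l ≠ [] → 1 ≤ k) ∧
      (B ≤ P * l.prod → l ≠ [] → B ≤ P * (l.take k).prod) ∧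
      ∀ j, 1 ≤ j → j < k → P * (l.take j).prod < B := by
  induction l generalizing P m₀ with
  | nil => exact ⟨0, by simp [leastCount]⟩
  | cons q l ih =>
    simp only [leastCount, bind_val, natMul_val, natAdd_val, natLe_val, decide_eq_true_eq]
    split_ifs with h
    · exact ⟨1, by simp, by simp, by simp, by simp [h], by omega⟩
    · obtain ⟨k, h1, h2, h3, h4, h5⟩ := ih (P * q) (m₀ + 1)
      refine ⟨k + 1, by simpa using h1, by rw [h2]; omega, by omega, ?_, ?_⟩
      · intro hB _
        rw [List.prod_cons, ← mul_assoc] at hB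
        rw [List.take_succ_cons, List.prod_cons, ← mul_assoc]
        refine h4 hB ?_
        rintro rfl
        simp at hB; omega
      · rintro (_ | _ | j) hj hjk
        · omega
        · simpa using h
        · rw [List.take_succ_cons, List.prod_cons, ← mul_assoc]
          exact h5 (j + 1) (by omega) (by omega)

theorem leastCount_mono {B B' : ℕ} (hB : B ≤ B') (l : List ℕ) (P m₀ : ℕ) :
    (leastCount B l P m₀).val ≤ (leastCount B' l P m₀).val := by
  induction l generalizing P m₀ with
  | nil => exact le_rfl
  | cons q l ih =>
    simp only [leastCount, bind_val, natMul_val, natAdd_val, natLe_val, decide_eq_true_eq]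
    split_ifs with h h' h'
    · exact le_rfl
    · obtain ⟨k, _, h2, _⟩ := leastCount_spec B' l (P * q) (m₀ + 1)
      rw [h2]; simp
    · exact absurd (hB.trans h') h
    · exact ih _ _

theorem leastNum_mono {B B' : ℕ} (hB : B ≤ B') (l : List ℕ) : leastNum B l ≤ leastNum B' l :=
  leastCount_mono hB l 1 0

/-- The recursion continues only while the product is below `B`, so the accumulated product always
fits in `L` bits; only the product being tested may need `m` more. -/
theorem leastCount_within {B L m K : ℕ} (hB : len B ≤ L) (hK : len K ≤ m) (l : List ℕ) (P m₀ : ℕ)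
    (hP : len P ≤ L) (hl : ∀ q ∈ l, len q ≤ m) (hm₀ : m₀ + l.length ≤ K) :
    (leastCount B l P m₀).Within 0 (l.length * (7 * L * m) + 1) 0 := by
  have hL : 1 ≤ L := (one_le_len _).trans hB
  have hm : 1 ≤ m := (one_le_len _).trans hK
  induction l generalizing P m₀ with
  | nil => exact (tick_ret_within 1 _).mono (by simp) (by simp) le_rfl
  | cons q l ih =>
    rw [List.length_cons] at hm₀
    have hq := hl q (by simp)
    have hPq : len (P * q) ≤ L + m := (len_mul P q).trans (Nat.add_le_add hP hq)
    have hm₀' : len m₀ ≤ m := (len_mono (by omega)).trans hK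
    have h1 : ∀ b : Bool, (b = false → ¬ B ≤ P * q) → (if b = true then ret (m₀ + 1)
        else leastCount B l (P * q) (m₀ + 1)).Within 0 (l.length * (7 * L * m) + 1) 0 := by
      intro b hb
      refine Within.ite (fun _ => (Within.ret _).mono le_rfl (Nat.zero_le _) le_rfl) fun h => ?_
      have := hb (by simpa using h)
      exact ih _ _ ((len_mono (by omega)).trans hB) (fun x hx => hl x (by simp [hx])) (by omega)
    refine Within.mono ((natMul_within hP hq).bind ((natAdd_within hm₀' len_one.le).bind
      ((natLe_within hB hPq).bind (h1 _ (by simp))))) le_rfl ?_ le_rfl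
    rw [List.length_cons, add_mul]
    have := Nat.mul_le_mul hL hm
    have := Nat.mul_le_mul_right m hL
    have := Nat.mul_le_mul_left L hm
    nlinarith

/-- The list of the first `K` primes. -/
noncomputable def prmList (K : ℕ) : List ℕ := (List.range K).map prm

theorem take_prmList_prod {j K : ℕ} (h : j ≤ K) :
    ((prmList K).take j).prod = ∏ i ∈ Finset.range j, prm i := by
  rw [prmList, ← List.map_take, List.take_range, min_eq_left h]
  simp [Finset.prod, Multiset.range, Finset.range]

theorem two_pow_le_prod_prm (j : ℕ) : 2 ^ j ≤ ∏ i ∈ Finset.range j, prm i := by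
  calc 2 ^ j = ∏ i ∈ Finset.range j, 2 := by simp
    _ ≤ _ := Finset.prod_le_prod' fun i _ => (prm_prime i).two_le

/-- Every prime is at least `2`, so `Nat.clog 2 B` primes already have product at least `B`.
Conversely, one factor fewer than the minimal number keeps the product below `B`, which bounds that
number by the logarithm. -/
theorem leastNum_spec {B K : ℕ} (hK : 1 ≤ K) (hB : Nat.clog 2 B ≤ K) :
    1 ≤ leastNum B (prmList K) ∧ leastNum B (prmList K) ≤ K ∧
      B ≤ ∏ i ∈ Finset.range (leastNum B (prmList K)), prm i ∧
      leastNum B (prmList K) ≤ max 1 (Nat.clog 2 B) := by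
  have hlen : (prmList K).length = K := by simp [prmList]
  have hne : prmList K ≠ [] := by
    intro h
    rw [h] at hlen
    simp at hlen; omega
  obtain ⟨k, h1, h2, h3, h4, h5⟩ := leastCount_spec B (prmList K) 1 0
  have hk : leastNum B (prmList K) = k := by rw [leastNum, h2, zero_add]
  rw [hk]
  rw [hlen] at h1
  simp only [one_mul] at h4 h5
  have hprod : B ≤ (prmList K).prod := by
    have := take_prmList_prod (le_refl K)
    rw [List.take_of_length_le hlen.le] at this
    rw [this]
    exact ((Nat.clog_le_iff_le_pow one_lt_two).1 hB).trans (two_pow_le_prod_prm K)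
  refine ⟨h3 hne, h1, ?_, ?_⟩
  · rw [← take_prmList_prod h1]
    exact h4 hprod hne
  · by_contra! hlt
    have h6 := h5 (k - 1) (by omega) (by omega)
    rw [take_prmList_prod (by omega)] at h6
    have h7 := (two_pow_le_prod_prm (k - 1)).trans_lt h6
    rw [← Nat.lt_clog_iff_pow_lt one_lt_two] at h7
    omega

@[simp] theorem natPow_val (D m : ℕ) : (natPow D m).val = D ^ m := by
  induction m with
  | zero => rfl
  | succ m ih => simp [natPow, ih, pow_succ]

/-- The intermediate powers have at most `A * d + 2` bits, and each of at most `A` multiplications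
is by a number of `d` bits. The total is quadratic in the length of the result, which the final bit
bound can afford. -/
theorem natPow_within {D d A : ℕ} (hd : len D ≤ d) (hA : 1 ≤ A) (m : ℕ) (hm : m ≤ A) :
    (natPow D m).Within 0 (6 * (A * d) ^ 2) 0 := by
  have hd1 : 1 ≤ d := (one_le_len _).trans hd
  have key : (natPow D m).Within 0 (m * (A + 1 + (A * d + 2) * d) + 1) 0 := by
    induction m with
    | zero => exact (tick_ret_within 1 _).mono (by simp) (by simp) le_rfl
    | succ m ih =>
      have h1 : len m ≤ A + 1 := len_le_self.trans (by omega)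
      have h2 : len (D ^ m) ≤ A * d + 2 := (len_pow D m).trans
        (Nat.add_le_add_right (Nat.mul_le_mul (by omega) hd) 2)
      refine Within.mono ((tick_within _).bind ((ih (by omega)).bind
        (natMul_within (by simpa using h2) hd))) le_rfl ?_ le_rfl
      rw [add_mul m 1]; omega
  refine key.mono le_rfl ?_ le_rfl
  have h1 : m * (A + 1 + (A * d + 2) * d) ≤ A * (A + 1 + (A * d + 2) * d) :=
    Nat.mul_le_mul_right _ hm
  have h2 : A ≤ A * d := Nat.le_mul_of_pos_right A hd1
  have h3 : 1 ≤ A * d := hA.trans h2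
  nlinarith [Nat.mul_le_mul h2 h2, Nat.mul_le_mul h3 h3, Nat.mul_le_mul h2 h3, Nat.mul_le_mul h3 h2]

/-- The numbers `N_1, N_2, N_3` computed from a list of primes. -/
def thresholdNums (n T D : ℕ) (primes : List ℕ) : ℕ × ℕ × ℕ :=
  (leastNum (D ^ (n * (T - 1))) primes, leastNum (D ^ (n * T)) primes,
    leastNum (D ^ (4 * (n * (T - 1)))) primes)

@[simp] theorem thresholds_val (n T D : ℕ) (primes : List ℕ) :
    (thresholds n T D primes).val = thresholdNums n T D primes := by
  simp [thresholds, thresholdNums, leastNum]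

theorem thresholds_within {n T T₀ D d K m : ℕ} (hn : 1 ≤ n) (hT₀ : 1 ≤ T₀) (hT : T ≤ T₀)
    (hd : len D ≤ d) (hm : len (4 * (n * T₀)) ≤ m) (hK : len K ≤ m) (primes : List ℕ)
    (hlen : primes.length ≤ K) (hp : ∀ q ∈ primes, len q ≤ m) :
    (thresholds n T D primes).Within 0
      (18 * (4 * (n * T₀) * d) ^ 2 + 63 * (K * (4 * (n * T₀) * d) * m) + 14 * m ^ 2) 0 := by
  set A := 4 * (n * T₀) with hA
  have hA1 : 1 ≤ A := by
    have := Nat.mul_pos hn hT₀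
    omega
  have hd1 : 1 ≤ d := (one_le_len _).trans hd
  have hm1 : 1 ≤ m := (one_le_len _).trans hm
  have a1 : T ≤ A := by nlinarith
  have a2 : n ≤ A := by nlinarith
  have a3 : n * T ≤ n * T₀ := Nat.mul_le_mul_left n hT
  have a4 : n * (T - 1) ≤ n * T₀ := Nat.mul_le_mul_left n (by omega)
  have hpow : ∀ e ≤ A, len (D ^ e) ≤ 3 * (A * d) := by
    intro e he
    have h1 := len_pow D e
    have h2 := Nat.mul_le_mul he hd
    have h3 := Nat.mul_le_mul hA1 hd1
    omega
  have hle : ∀ x ≤ A, len x ≤ m := fun x hx => (len_mono hx).trans hm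
  have hleast : ∀ e ≤ A, (leastCount (D ^ e) primes 1 0).Within 0
      (K * (7 * (3 * (A * d)) * m) + 1) 0 := by
    intro e he
    refine (leastCount_within (hpow e he) hK primes 1 0 ?_ hp (by simpa using hlen)).mono le_rfl
      (Nat.add_le_add_right (Nat.mul_le_mul_right _ hlen) _) le_rfl
    rw [len_one]
    have h3 := Nat.mul_le_mul hA1 hd1
    omega
  have b1 := natSub_within (hle T a1) (hle 1 hA1)
  have b2 := natMul_within (hle n a2) (hle (T - 1) (by omega))
  have b3 := natMul_within (hle n a2) (hle T a1)
  have b4 := natMul_within (hle 4 (by omega)) (hle (n * (T - 1)) (by omega))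
  have c1 := natPow_within hd hA1 (n * (T - 1)) (by omega)
  have c2 := natPow_within hd hA1 (n * T) (by omega)
  have c3 := natPow_within hd hA1 (4 * (n * (T - 1))) (by omega)
  have e1 := hleast (n * (T - 1)) (by omega)
  have e2 := hleast (n * T) (by omega)
  have e3 := hleast (4 * (n * (T - 1))) (by omega)
  rw [← natPow_val] at e1 e2 e3
  refine Within.mono (b1.bind (b2.bind (b3.bind (b4.bind (c1.bind (c2.bind (c3.bind
    (e1.bind (e2.bind (e3.bind (Within.ret _))))))))))) le_rfl ?_ le_rfl
  have h1 : K * (7 * (3 * (A * d)) * m) = 21 * (K * (A * d) * m) := by ring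
  have hm2 : m ≤ m ^ 2 := Nat.le_self_pow two_ne_zero m
  rw [← sq m, h1]
  omega

/-- The number of samples that are needed. -/
def numSamples (N : ℕ × ℕ × ℕ) : ℕ := max (N.1 + N.2.1 - 1) N.2.2

@[simp] theorem sampleCount_val (N : ℕ × ℕ × ℕ) :
    (sampleCount N.1 N.2.1 N.2.2).val = numSamples N := rfl

theorem sampleCount_within {N : ℕ × ℕ × ℕ} {m : ℕ} (h1 : len N.1 ≤ m) (h2 : len N.2.1 ≤ m)
    (h3 : len N.2.2 ≤ m) : (sampleCount N.1 N.2.1 N.2.2).Within 0 (5 * m + 4) 0 := by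
  have h4 : len (N.1 + N.2.1) ≤ m + 1 := (len_add _ _).trans (by omega)
  have h5 : len (N.1 + N.2.1 - 1) ≤ m + 1 := (len_mono (Nat.sub_le _ _)).trans h4
  refine Within.mono ((natAdd_within h1 h2).bind ((natSub_within h4 len_one.le).bind
    (natMax_within h5 h3))) le_rfl ?_ le_rfl
  omega

/-- The number of primes that are computed. -/
def budget (n T D : ℕ) : ℕ :=
  max 4 (max (Nat.clog 2 (D ^ (n * (T - 1))) + Nat.clog 2 (D ^ (n * T)))
    (4 * Nat.clog 2 (D ^ (n * T))))

@[simp] theorem primeBudget_val (n T D : ℕ) : (primeBudget n T D).val = budget n T D := by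
  simp [primeBudget, budget]

theorem clog_pow_le (D e : ℕ) : Nat.clog 2 (D ^ e) ≤ e * len D := by
  refine Nat.clog_le_of_le_pow ?_
  rw [mul_comm, pow_mul]
  exact Nat.pow_le_pow_left (lt_two_pow_len D).le e

theorem budget_le {n T D : ℕ} (hn : 1 ≤ n) (hT : 1 ≤ T) : budget n T D ≤ 4 * (n * T) * len D := by
  have h1 := clog_pow_le D (n * (T - 1))
  have h2 := clog_pow_le D (n * T)
  have h3 : n * (T - 1) * len D ≤ n * T * len D :=
    Nat.mul_le_mul_right _ (Nat.mul_le_mul_left n (Nat.sub_le _ _))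
  have h4 : 1 ≤ n * T * len D := Nat.mul_pos (Nat.mul_pos hn hT) (one_le_len D)
  rw [mul_assoc 4]
  refine max_le (by omega) (max_le (by omega) (by omega))

theorem primeBudget_within {n T D d m : ℕ} (hn : 1 ≤ n) (hT : 1 ≤ T) (hd : len D ≤ d)
    (hm : len (4 * (n * T)) ≤ m) :
    (primeBudget n T D).Within 0 (100 * (4 * (n * T) * d) ^ 2 + 4 * m ^ 2) 0 := by
  set A := 4 * (n * T) with hA
  have hnT := Nat.mul_pos hn hT
  have hA1 : 1 ≤ A := by omega
  have hd1 : 1 ≤ d := (one_le_len _).trans hd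
  have hm1 : 1 ≤ m := (one_le_len _).trans hm
  have a1 : T ≤ A := by nlinarith
  have a2 : n ≤ A := by nlinarith
  have a4 : n * (T - 1) ≤ n * T := Nat.mul_le_mul_left n (by omega)
  have hAd := Nat.mul_le_mul hA1 hd1
  have hpow : ∀ e ≤ A, len (D ^ e) ≤ 3 * (A * d) := by
    intro e he
    have h1 := len_pow D e
    have h2 := Nat.mul_le_mul he hd
    omega
  have hle : ∀ x ≤ A, len x ≤ m := fun x hx => (len_mono hx).trans hm
  have hclog : ∀ e ≤ n * T, 4 * Nat.clog 2 (D ^ e) ≤ A * d := by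
    intro e he
    have h1 := clog_pow_le D e
    have h2 := Nat.mul_le_mul he hd
    rw [hA, mul_assoc]; omega
  have g1 := hclog (n * (T - 1)) a4
  have g2 := hclog (n * T) le_rfl
  have hle' : ∀ x ≤ A * d, len x ≤ A * d + 1 := fun x hx => len_le_self.trans (by omega)
  have b1 := natSub_within (hle T a1) (hle 1 hA1)
  have b2 := natMul_within (hle n a2) (hle (T - 1) (by omega))
  have b3 := natMul_within (hle n a2) (hle T a1)
  have c1 := natPow_within hd hA1 (n * (T - 1)) (by omega)
  have c2 := natPow_within hd hA1 (n * T) (by omega)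
  have e1 := natCeilLog_within (hpow (n * (T - 1)) (by omega))
  have e2 := natCeilLog_within (hpow (n * T) (by omega))
  rw [← natPow_val] at e1 e2
  have f1 := natAdd_within (hle' (Nat.clog 2 (D ^ (n * (T - 1)))) (by omega))
    (hle' (Nat.clog 2 (D ^ (n * T))) (by omega))
  have f2 := natMul_within (le_refl (len 4)) (hle' (Nat.clog 2 (D ^ (n * T))) (by omega))
  have f3 := natMax_within (hle' (Nat.clog 2 (D ^ (n * (T - 1))) + Nat.clog 2 (D ^ (n * T)))
    (by omega)) (hle' (4 * Nat.clog 2 (D ^ (n * T))) (by omega))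
  have f4 := natMax_within (le_refl (len 4)) (hle' (max (Nat.clog 2 (D ^ (n * (T - 1))) +
    Nat.clog 2 (D ^ (n * T))) (4 * Nat.clog 2 (D ^ (n * T)))) (max_le (by omega) (by omega)))
  simp only [← natPow_val D (n * (T - 1)), ← natPow_val D (n * T)] at f1 f2 f3 f4
  have h4 : len 4 = 4 := by
    have : Nat.size 4 = 3 := by
      apply le_antisymm
      · rw [Nat.size_le]; norm_num
      · by_contra! h
        have := Nat.size_le.1 (Nat.le_of_lt_succ h)
        norm_num at this
    rw [len, this]
  rw [h4] at f2 f4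
  refine Within.mono (b1.bind (b2.bind (b3.bind (c1.bind (c2.bind (e1.bind (e2.bind
    (f1.bind (f2.bind (f3.bind f4)))))))))) le_rfl ?_ le_rfl
  have hm2 : m ≤ m ^ 2 := Nat.le_self_pow two_ne_zero m
  have hA2 : A * d ≤ (A * d) ^ 2 := Nat.le_self_pow two_ne_zero _
  rw [← sq m]
  omega

theorem four_le_budget (n T D : ℕ) : 4 ≤ budget n T D := le_max_left _ _

/-- The properties of `N_1, N_2, N_3` used in the correctness proof. -/
theorem thresholdNums_spec {n T T₀ D : ℕ} (hD : 1 ≤ D) (hT : T ≤ T₀) {N : ℕ × ℕ × ℕ}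
    (hN : thresholdNums n T D (prmList (budget n T₀ D)) = N) :
    (1 ≤ N.1 ∧ D ^ (n * (T - 1)) ≤ ∏ i ∈ Finset.range N.1, prm i) ∧
    (1 ≤ N.2.1 ∧ D ^ (n * T) ≤ ∏ i ∈ Finset.range N.2.1, prm i) ∧
    (1 ≤ N.2.2 ∧ D ^ (4 * (n * (T - 1))) ≤ ∏ i ∈ Finset.range N.2.2, prm i) ∧
    numSamples N ≤ budget n T₀ D ∧ N.1 ≤ budget n T₀ D ∧ N.2.1 ≤ budget n T₀ D ∧
    N.2.2 ≤ budget n T₀ D := by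
  set K := budget n T₀ D with hK
  have hK4 : 4 ≤ K := four_le_budget n T₀ D
  have i1 : n * (T - 1) ≤ n * (T₀ - 1) := Nat.mul_le_mul_left n (by omega)
  have i2 : n * T ≤ n * T₀ := Nat.mul_le_mul_left n hT
  have i3 : n * (T - 1) ≤ n * T₀ := Nat.mul_le_mul_left n (by omega)
  have j1 : Nat.clog 2 (D ^ (n * (T - 1))) ≤ Nat.clog 2 (D ^ (n * (T₀ - 1))) :=
    Nat.clog_mono_right _ (Nat.pow_le_pow_right hD i1)
  have j2 : Nat.clog 2 (D ^ (n * T)) ≤ Nat.clog 2 (D ^ (n * T₀)) :=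
    Nat.clog_mono_right _ (Nat.pow_le_pow_right hD i2)
  have j3 : Nat.clog 2 (D ^ (4 * (n * (T - 1)))) ≤ 4 * Nat.clog 2 (D ^ (n * T₀)) := by
    refine Nat.clog_le_of_le_pow ?_
    rw [mul_comm 4, mul_comm 4, pow_mul D, pow_mul 2]
    exact Nat.pow_le_pow_left ((Nat.pow_le_pow_right hD i3).trans
      (Nat.le_pow_clog one_lt_two _)) 4
  have k1 : Nat.clog 2 (D ^ (n * (T₀ - 1))) + Nat.clog 2 (D ^ (n * T₀)) ≤ K :=
    (le_max_left _ _).trans (le_max_right _ _)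
  have k2 : 4 * Nat.clog 2 (D ^ (n * T₀)) ≤ K := (le_max_right _ _).trans (le_max_right _ _)
  obtain ⟨a1, a2, a3, a4⟩ := leastNum_spec (B := D ^ (n * (T - 1))) (K := K) (by omega) (by omega)
  obtain ⟨b1, b2, b3, b4⟩ := leastNum_spec (B := D ^ (n * T)) (K := K) (by omega) (by omega)
  obtain ⟨c1, c2, c3, c4⟩ := leastNum_spec (B := D ^ (4 * (n * (T - 1)))) (K := K) (by omega)
    (by omega)
  rw [thresholdNums] at hN
  subst hN
  refine ⟨⟨a1, a3⟩, ⟨b1, b3⟩, ⟨c1, c3⟩, ?_, a2, b2, c2⟩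
  -- Each of `N_1`, `N_2` is bounded by the maximum of `1` and a logarithm. When a logarithm
  -- vanishes, the `- 1` and the lower bound `4` of the budget absorb the extra `1`.
  refine max_le ?_ c2
  simp only
  omega

/-- As terms are found, `T` decreases and so does the number of samples needed. Later rounds use a
prefix of the stored samples and interpolate no new `f_(D,p)`. -/
theorem numSamples_mono {n T T' D : ℕ} (hD : 1 ≤ D) (hT : T ≤ T') (ps : List ℕ) :
    numSamples (thresholdNums n T D ps) ≤ numSamples (thresholdNums n T' D ps) := by
  have h1 : leastNum (D ^ (n * (T - 1))) ps ≤ leastNum (D ^ (n * (T' - 1))) ps :=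
    leastNum_mono (Nat.pow_le_pow_right hD (Nat.mul_le_mul_left n (by omega))) ps
  have h2 : leastNum (D ^ (n * T)) ps ≤ leastNum (D ^ (n * T')) ps :=
    leastNum_mono (Nat.pow_le_pow_right hD (Nat.mul_le_mul_left n (by omega))) ps
  have h3 : leastNum (D ^ (4 * (n * (T - 1)))) ps ≤ leastNum (D ^ (4 * (n * (T' - 1)))) ps :=
    leastNum_mono (Nat.pow_le_pow_right hD (Nat.mul_le_mul_left 4
      (Nat.mul_le_mul_left n (by omega)))) ps
  exact max_le_max (by simp only [thresholdNums]; omega) h3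

/-! ## Collisions modulo primes -/

/-- Removing the largest index: if `a` exceeds all of `s`, then `s` lies in the range of `a`, so `a`
is at least the cardinality of `s`. -/
theorem prod_prm_range_card_le (J : Finset ℕ) :
    ∏ i ∈ Finset.range J.card, prm i ≤ ∏ j ∈ J, prm j := by
  induction J using Finset.induction_on_max with
  | empty => simp
  | insert a s hs ih =>
    have ha : a ∉ s := fun h => (hs a h).false
    rw [Finset.card_insert_of_notMem ha, Finset.prod_range_succ, Finset.prod_insert ha, mul_comm]
    refine Nat.mul_le_mul (prm_strictMono.monotone ?_) ih
    have : s ⊆ Finset.range a := fun x hx => Finset.mem_range.2 (hs x hx)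
    simpa using Finset.card_le_card this

/-- The product of the primes modulo which `u` agrees with some member of `S` is bounded. -/
theorem prod_collisions_le {ι : Type*} (E : ι → ℕ) (S : Finset ι) {u M : ℕ} (hu : u < M)
    (hS : ∀ s ∈ S, E s ≠ u ∧ E s < M) (J : Finset ℕ)
    (hJ : ∀ j ∈ J, ∃ s ∈ S, E s % prm j = u % prm j) :
    ∏ j ∈ J, prm j ≤ (M - 1) ^ S.card := by
  -- An agreement modulo a prime makes it divide one of the differences; distinct primes then divide
  -- their product jointly.
  have hW : ∏ j ∈ J, prm j ∣ ∏ s ∈ S, Nat.dist (E s) u := by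
    rw [← Finset.prod_image (g := prm) (f := fun p => p) (prm_strictMono.injective.injOn)]
    refine Finset.prod_primes_dvd _ ?_ ?_
    · intro p hp
      obtain ⟨j, _, rfl⟩ := Finset.mem_image.1 hp
      exact (prm_prime j).prime
    · intro p hp
      obtain ⟨j, hj, rfl⟩ := Finset.mem_image.1 hp
      obtain ⟨s, hs, h⟩ := hJ j hj
      refine dvd_trans ?_ (Finset.dvd_prod_of_mem _ hs)
      rcases le_total (E s) u with hle | hle
      · rw [Nat.dist_eq_sub_of_le hle]
        exact (Nat.modEq_iff_dvd' hle).1 h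
      · rw [Nat.dist_eq_sub_of_le_right hle]
        exact (Nat.modEq_iff_dvd' hle).1 h.symm
  have hpos : 0 < ∏ s ∈ S, Nat.dist (E s) u :=
    Finset.prod_pos fun s hs => Nat.dist_pos_of_ne (hS s hs).1
  refine (Nat.le_of_dvd hpos hW).trans ?_
  rw [← Finset.prod_const]
  refine Finset.prod_le_prod' fun s hs => ?_
  -- Both numbers are below `M`, so they differ by at most `M - 1`. This loss of one makes the later
  -- comparison with powers of `M` strict.
  have := (hS s hs).2
  unfold Nat.dist
  omega

/-- There are fewer than `N` primes modulo which `u` agrees with some member of `S`. -/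
theorem card_collisions_lt {ι : Type*} (E : ι → ℕ) (S : Finset ι) {u M k N : ℕ} (hu : u < M)
    (hS : ∀ s ∈ S, E s ≠ u ∧ E s < M) (hk : S.card ≤ k) (hN : 1 ≤ N)
    (hprod : M ^ k ≤ ∏ i ∈ Finset.range N, prm i) (J : Finset ℕ)
    (hJ : ∀ j ∈ J, ∃ s ∈ S, E s % prm j = u % prm j) : J.card < N := by
  -- With exponent zero `(M - 1) ^ k < M ^ k` fails, so the empty set is treated apart; there `1 ≤
  -- N` is used.
  rcases S.eq_empty_or_nonempty with rfl | hne
  · have : J = ∅ := Finset.eq_empty_of_forall_notMem fun j hj => by simpa using hJ j hj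
    rw [this, Finset.card_empty]; exact hN
  · by_contra! hle
    have h1 := prod_collisions_le E S hu hS J hJ
    have h2 : ∏ i ∈ Finset.range N, prm i ≤ ∏ i ∈ Finset.range J.card, prm i :=
      Finset.prod_le_prod_of_subset_of_one_le' (by simpa using hle)
        fun i _ _ => (prm_prime i).one_lt.le
    have h3 : (M - 1) ^ S.card < M ^ S.card :=
      Nat.pow_lt_pow_left (by omega) (Finset.card_ne_zero.2 hne)
    have h4 : M ^ S.card ≤ M ^ k := Nat.pow_le_pow_right (by omega) hk
    have := prod_prm_range_card_le J
    omega

/-- The members of `S` whose value under `r` is shared with another member. -/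
def collided {ι : Type*} [DecidableEq ι] (S : Finset ι) (r : ι → ℕ) : Finset ι :=
  S.filter fun u => ∃ v ∈ S, v ≠ u ∧ r v = r u

/-- The members of `S` whose value under `r` is not shared. -/
def isolated {ι : Type*} [DecidableEq ι] (S : Finset ι) (r : ι → ℕ) : Finset ι :=
  S.filter fun u => ¬ ∃ v ∈ S, v ≠ u ∧ r v = r u

theorem card_collided_add_card_isolated {ι : Type*} [DecidableEq ι] (S : Finset ι) (r : ι → ℕ) :
    (collided S r).card + (isolated S r).card = S.card :=
  Finset.card_filter_add_card_filter_not _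

/-- For some prime fewer than a quarter of the members of `S` collide. -/
theorem exists_card_collided_lt {ι : Type*} [DecidableEq ι] (E : ι → ℕ) (S : Finset ι)
    (hne : S.Nonempty) {M T N : ℕ} (hE : Set.InjOn E S) (hM : ∀ s ∈ S, E s < M) (hT : S.card ≤ T)
    (hN : 1 ≤ N) (hprod : M ^ (4 * (T - 1)) ≤ ∏ i ∈ Finset.range N, prm i) :
    ∃ j < N, 4 * (collided S fun s => E s % prm j).card < S.card := by
  by_contra! hall
  set t := S.card with ht
  have htpos : 0 < t := hne.card_pos
  obtain ⟨s₀, hs₀⟩ := hne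
  have hMpos : 0 < M := (Nat.zero_le _).trans_lt (hM s₀ hs₀)
  let J : ι → Finset ℕ := fun u => (Finset.range N).filter fun j =>
    ∃ v ∈ S, v ≠ u ∧ E v % prm j = E u % prm j
  have h1 : ∀ u ∈ S, ∏ j ∈ J u, prm j ≤ (M - 1) ^ (t - 1) := by
    intro u hu
    have := prod_collisions_le E (S.erase u) (hM u hu) (fun s hs =>
      ⟨fun h => (Finset.mem_erase.1 hs).1 (hE (Finset.mem_of_mem_erase hs) hu h),
        hM s (Finset.mem_of_mem_erase hs)⟩) (J u) (fun j hj => by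
          obtain ⟨_, v, hv, hvu, h⟩ := Finset.mem_filter.1 hj
          exact ⟨v, Finset.mem_erase.2 ⟨hvu, hv⟩, h⟩)
    rwa [Finset.card_erase_of_mem hu] at this
  -- Double counting: on the left each prime occurs once for every monomial that collides for it.
  -- Regrouping by monomials gives the products bounded in `h1`.
  have h2 : ∏ j ∈ Finset.range N, prm j ^ (collided S fun s => E s % prm j).card ≤
      ((M - 1) ^ (t - 1)) ^ t := by
    calc _ = ∏ u ∈ S, ∏ j ∈ J u, prm j := by
          simp only [J, collided, Finset.prod_filter, Finset.card_filter]
          rw [Finset.prod_comm]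
          refine Finset.prod_congr rfl fun j _ => ?_
          rw [← Finset.prod_pow_eq_pow_sum]
          refine Finset.prod_congr rfl fun u _ => ?_
          split_ifs <;> simp
      _ ≤ ∏ u ∈ S, (M - 1) ^ (t - 1) := Finset.prod_le_prod' h1
      _ = _ := by rw [Finset.prod_const]
  have h3 : (∏ j ∈ Finset.range N, prm j) ^ t ≤
      (∏ j ∈ Finset.range N, prm j ^ (collided S fun s => E s % prm j).card) ^ 4 := by
    rw [← Finset.prod_pow, ← Finset.prod_pow]
    refine Finset.prod_le_prod' fun j hj => ?_
    rw [← pow_mul]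
    refine Nat.pow_le_pow_right (prm_prime j).pos ?_
    have := hall j (Finset.mem_range.1 hj)
    omega
  -- For a single monomial the exponent `t - 1` vanishes and strictness is lost, but then nothing
  -- collides, against the assumption for the first prime.
  rcases Nat.lt_or_ge t 2 with ht2 | ht2
  · have h0 := hall 0 hN
    have : (collided S fun s => E s % prm 0) = ∅ := by
      refine Finset.eq_empty_of_forall_notMem fun u hu => ?_
      obtain ⟨hu, v, hv, hvu, _⟩ := Finset.mem_filter.1 hu
      exact hvu (Finset.card_le_one.1 (by omega : S.card ≤ 1) v hv u hu)
    rw [this, Finset.card_empty] at h0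
    omega
  -- Chain: the threshold hypothesis to the power `t`, then the assumption that a quarter collides
  -- for every prime, then the double counting to the fourth power.
  · have h4 : M ^ ((t - 1) * t * 4) ≤ (M - 1) ^ ((t - 1) * t * 4) := by
      calc M ^ ((t - 1) * t * 4) ≤ (M ^ (4 * (T - 1))) ^ t := by
            rw [← pow_mul]
            refine Nat.pow_le_pow_right hMpos ?_
            calc (t - 1) * t * 4 = 4 * (t - 1) * t := by ring
              _ ≤ _ := Nat.mul_le_mul_right _ (Nat.mul_le_mul_left _ (by omega))
        _ ≤ _ := (Nat.pow_le_pow_left hprod t).trans (h3.trans (Nat.pow_le_pow_left h2 4))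
        _ = _ := by rw [← pow_mul, ← pow_mul, mul_assoc]
    have h5 : (M - 1) ^ ((t - 1) * t * 4) < M ^ ((t - 1) * t * 4) := by
      refine Nat.pow_lt_pow_left (by omega) ?_
      have : 0 < (t - 1) * t := Nat.mul_pos (by omega) (by omega)
      omega
    omega

/-- Count fibre by fibre: a fibre with one element contributes one member and one isolated member,
any other fibre contributes at least two members. -/
theorem two_mul_card_image_le {ι : Type*} [DecidableEq ι] (S : Finset ι) (r : ι → ℕ) :
    2 * (S.image r).card ≤ S.card + (isolated S r).card := by
  have h1 : S.card = ∑ d ∈ S.image r, (S.filter fun s => r s = d).card :=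
    Finset.card_eq_sum_card_image r S
  have h2 : (isolated S r).card =
      ∑ d ∈ S.image r, ((isolated S r).filter fun s => r s = d).card :=
    Finset.card_eq_sum_card_fiberwise fun s hs =>
      Finset.mem_coe.2 (Finset.mem_image_of_mem r (Finset.mem_of_mem_filter s hs))
  rw [h1, h2, ← Finset.sum_add_distrib, mul_comm, ← smul_eq_mul, ← Finset.sum_const]
  refine Finset.sum_le_sum fun d hd => ?_
  obtain ⟨u, hu, rfl⟩ := Finset.mem_image.1 hd
  have hu' : u ∈ S.filter fun s => r s = r u := Finset.mem_filter.2 ⟨hu, rfl⟩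
  rcases Nat.lt_or_ge (S.filter fun s => r s = r u).card 2 with hlt | hge
  · have h3 : u ∈ (isolated S r).filter fun s => r s = r u := by
      refine Finset.mem_filter.2 ⟨Finset.mem_filter.2 ⟨hu, ?_⟩, rfl⟩
      rintro ⟨v, hv, hvu, h⟩
      exact hvu (Finset.card_le_one.1 (Nat.le_of_lt_succ hlt) v
        (Finset.mem_filter.2 ⟨hv, h⟩) u hu')
    have := Finset.card_pos.2 ⟨u, h3⟩
    have := Finset.card_pos.2 ⟨u, hu'⟩
    omega
  · omega

/-! ## Kronecker exponents -/

/-- The exponent of the image of the monomial `s` under `x_i = x ^ e_i`. -/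
def expDot {n : ℕ} (e : Fin n → ℕ) (s : Fin n →₀ ℕ) : ℕ := ∑ i, s i * e i

theorem sum_mul_pow_lt {n D : ℕ} (a : Fin n → ℕ) (ha : ∀ i, a i < D) :
    ∑ i, a i * D ^ (i : ℕ) < D ^ n := by
  induction n with
  | zero => simp
  | succ n ih =>
    have h1 := ih (fun i => a i.succ) fun i => ha _
    rw [Fin.sum_univ_succ]
    have h2 : ∑ i : Fin n, a i.succ * D ^ (i.succ : ℕ) =
        D * ∑ i : Fin n, a i.succ * D ^ (i : ℕ) := by
      rw [Finset.mul_sum]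
      refine Finset.sum_congr rfl fun i _ => ?_
      simp [pow_succ]; ring
    rw [h2, pow_succ]
    have := ha 0
    simp only [Fin.val_zero, pow_zero, mul_one]
    nlinarith

/-- The entries are base `D` digits: reduction modulo `D` recovers the lowest one, and cancelling it
and dividing by `D` leaves the others. -/
theorem sum_mul_pow_inj {n D : ℕ} (a b : Fin n → ℕ) (ha : ∀ i, a i < D) (hb : ∀ i, b i < D)
    (h : ∑ i, a i * D ^ (i : ℕ) = ∑ i, b i * D ^ (i : ℕ)) : a = b := by
  induction n with
  | zero => exact Subsingleton.elim _ _
  | succ n ih =>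
    have hc : ∀ c : Fin (n + 1) → ℕ, ∑ i, c i * D ^ (i : ℕ) =
        c 0 + D * ∑ i : Fin n, c i.succ * D ^ (i : ℕ) := by
      intro c
      rw [Fin.sum_univ_succ, Finset.mul_sum]
      congr 1
      · simp
      · refine Finset.sum_congr rfl fun i _ => ?_
        simp [pow_succ]; ring
    rw [hc a, hc b] at h
    have hD : 0 < D := (Nat.zero_le _).trans_lt (ha 0)
    have h0 : a 0 = b 0 := by
      have := congrArg (· % D) h
      simpa [Nat.add_mul_mod_self_left, Nat.mod_eq_of_lt (ha 0), Nat.mod_eq_of_lt (hb 0)] using this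
    have h1 : ∑ i : Fin n, a i.succ * D ^ (i : ℕ) = ∑ i : Fin n, b i.succ * D ^ (i : ℕ) := by
      rw [h0] at h
      exact Nat.eq_of_mul_eq_mul_left hD (Nat.add_left_cancel h)
    have h2 := ih (fun i => a i.succ) (fun i => b i.succ) (fun i => ha _) (fun i => hb _) h1
    funext i
    refine Fin.cases h0 (fun j => congrFun h2 j) i

/-- The Kronecker exponent of a monomial. -/
def kron {n : ℕ} (D : ℕ) (s : Fin n →₀ ℕ) : ℕ := expDot (fun i => D ^ (i : ℕ)) s

/-- The monomials of total degree less than `D`. -/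
def LowDegree {n : ℕ} (D : ℕ) (s : Fin n →₀ ℕ) : Prop := ∑ i, s i < D

theorem LowDegree.apply_lt {n D : ℕ} {s : Fin n →₀ ℕ} (h : LowDegree D s) (i : Fin n) :
    s i < D :=
  (Finset.single_le_sum (f := fun i => s i) (fun _ _ => Nat.zero_le _) (Finset.mem_univ i)).trans_lt h

theorem LowDegree.kron_lt {n D : ℕ} {s : Fin n →₀ ℕ} (h : LowDegree D s) : kron D s < D ^ n :=
  sum_mul_pow_lt _ h.apply_lt

theorem LowDegree.kron_inj {n D : ℕ} {s t : Fin n →₀ ℕ} (hs : LowDegree D s) (ht : LowDegree D t)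
    (h : kron D s = kron D t) : s = t :=
  DFunLike.coe_injective (sum_mul_pow_inj _ _ hs.apply_lt ht.apply_lt h)

/-- Reducing the powers of `D` before the substitution does not change residues modulo `p`. The
images have small degree and still show the Kronecker exponents modulo `p`. -/
theorem expDot_kronExp_mod {n : ℕ} (D p : ℕ) (s : Fin n →₀ ℕ) :
    expDot (kronExp n D p) s % p = kron D s % p := by
  unfold kron expDot kronExp
  rw [Finset.sum_nat_mod, Finset.sum_nat_mod Finset.univ p fun i => s i * D ^ (i : ℕ)]
  simp [Nat.mul_mod]

theorem expDot_le {n B : ℕ} {e : Fin n → ℕ} (he : ∀ i, e i ≤ B) (s : Fin n →₀ ℕ) :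
    expDot e s ≤ (∑ i, s i) * B := by
  rw [expDot, Finset.sum_mul]
  exact Finset.sum_le_sum fun i _ => Nat.mul_le_mul_left _ (he i)

/-- Adding `p` to one exponent of the substitution keeps all residues and displaces each monomial by
`p` times its exponent in that variable. Hence `(β_k - γ) / p` is the exponent sought. -/
theorem expDot_kronExpShift {n : ℕ} (D p : ℕ) (k : Fin n) (s : Fin n →₀ ℕ) :
    expDot (kronExpShift n D p k) s = expDot (kronExp n D p) s + s k * p := by
  simp [expDot, kronExpShift, kronExp, mul_add, Finset.sum_add_distrib]

/-! ## Images of a polynomial -/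

section Images

variable {R : Type u} [CommRing R] {n : ℕ}

theorem subst_monomial (e : Fin n → ℕ) (s : Fin n →₀ ℕ) (c : R) :
    subst e (MvPolynomial.monomial s c) = Polynomial.monomial (expDot e s) c := by
  rw [subst, MvPolynomial.aeval_monomial, Finsupp.prod_fintype _ _ (by simp)]
  simp only [← pow_mul, Finset.prod_pow_eq_pow_sum, Polynomial.algebraMap_eq]
  rw [Polynomial.C_mul_X_pow_eq_monomial]
  rw [expDot, Finset.sum_congr rfl fun i _ => mul_comm (e i) (s i)]

theorem subst_sub (e : Fin n → ℕ) (f g : MvPolynomial (Fin n) R) :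
    subst e (f - g) = subst e f - subst e g := map_sub _ _ _

theorem subst_list_sum (e : Fin n → ℕ) (l : List (MvPolynomial (Fin n) R)) :
    subst e l.sum = (l.map (subst e)).sum :=
  map_list_sum (MvPolynomial.aeval fun i => (Polynomial.X : Polynomial R) ^ e i) l

theorem subst_eq_sum (e : Fin n → ℕ) (f : MvPolynomial (Fin n) R) :
    subst e f = ∑ s ∈ f.support, Polynomial.monomial (expDot e s) (f.coeff s) := by
  conv_lhs => rw [f.as_sum]
  rw [subst, map_sum]
  exact Finset.sum_congr rfl fun s _ => subst_monomial e s _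

theorem coeff_subst (e : Fin n → ℕ) (f : MvPolynomial (Fin n) R) (d : ℕ) :
    (subst e f).coeff d = ∑ s ∈ f.support with expDot e s = d, f.coeff s := by
  rw [subst_eq_sum, Polynomial.finsetSum_coeff, Finset.sum_filter]
  simp only [Polynomial.coeff_monomial]

theorem coeff_foldMod_subst (p : ℕ) (e : Fin n → ℕ) (f : MvPolynomial (Fin n) R) (d : ℕ) :
    (foldMod p (subst e f)).coeff d = ∑ s ∈ f.support with expDot e s % p = d, f.coeff s := by
  rw [subst_eq_sum, map_sum, Polynomial.finsetSum_coeff, Finset.sum_filter]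
  refine Finset.sum_congr rfl fun s _ => ?_
  rw [foldMod_monomial, Polynomial.coeff_monomial]

theorem exists_of_mem_support_subst {e : Fin n → ℕ} {f : MvPolynomial (Fin n) R} {d : ℕ}
    (h : d ∈ (subst e f).support) : ∃ s ∈ f.support, expDot e s = d := by
  rw [Polynomial.mem_support_iff, coeff_subst] at h
  obtain ⟨s, hs, _⟩ := Finset.exists_ne_zero_of_sum_ne_zero h
  exact ⟨s, (Finset.mem_filter.1 hs).1, (Finset.mem_filter.1 hs).2⟩

theorem exists_of_mem_support_foldMod {p : ℕ} {e : Fin n → ℕ} {f : MvPolynomial (Fin n) R} {d : ℕ}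
    (h : d ∈ (foldMod p (subst e f)).support) : ∃ s ∈ f.support, expDot e s % p = d := by
  rw [Polynomial.mem_support_iff, coeff_foldMod_subst] at h
  obtain ⟨s, hs, _⟩ := Finset.exists_ne_zero_of_sum_ne_zero h
  exact ⟨s, (Finset.mem_filter.1 hs).1, (Finset.mem_filter.1 hs).2⟩

theorem card_support_subst_le (e : Fin n → ℕ) (f : MvPolynomial (Fin n) R) :
    (subst e f).support.card ≤ f.support.card := by
  refine (Finset.card_le_card fun d hd => ?_).trans
    (Finset.card_image_le (s := f.support) (f := expDot e))
  obtain ⟨s, hs, rfl⟩ := exists_of_mem_support_subst hd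
  exact Finset.mem_image_of_mem _ hs

/-- The image of `f` for the prime `p`, reduced modulo `x ^ p - 1`. -/
noncomputable def redImage (D p : ℕ) (f : MvPolynomial (Fin n) R) : Polynomial R :=
  foldMod p (subst (kronExp n D p) f)

theorem coeff_redImage (D p : ℕ) (f : MvPolynomial (Fin n) R) (d : ℕ) :
    (redImage D p f).coeff d = ∑ s ∈ f.support with kron D s % p = d, f.coeff s := by
  rw [redImage, coeff_foldMod_subst]
  simp only [expDot_kronExp_mod]

theorem support_redImage_subset (D p : ℕ) (f : MvPolynomial (Fin n) R) :
    (redImage D p f).support ⊆ f.support.image fun s => kron D s % p := by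
  intro d hd
  obtain ⟨s, hs, rfl⟩ := exists_of_mem_support_foldMod hd
  rw [expDot_kronExp_mod]
  exact Finset.mem_image_of_mem _ hs

theorem card_support_redImage_le (D p : ℕ) (f : MvPolynomial (Fin n) R) :
    (redImage D p f).support.card ≤ f.support.card :=
  (Finset.card_le_card (support_redImage_subset D p f)).trans Finset.card_image_le

/-- If no other monomial of `f` collides with `u`, the reduced image has the coefficient of `u`. -/
theorem coeff_redImage_of_forall (D p : ℕ) (f : MvPolynomial (Fin n) R) (u : Fin n →₀ ℕ)
    (h : ∀ v ∈ f.support, v ≠ u → kron D v % p ≠ kron D u % p) :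
    (redImage D p f).coeff (kron D u % p) = f.coeff u := by
  rw [coeff_redImage]
  by_cases hu : u ∈ f.support
  · refine Finset.sum_eq_single_of_mem u (Finset.mem_filter.2 ⟨hu, rfl⟩) ?_
    intro v hv hvu
    exact absurd (Finset.mem_filter.1 hv).2 (h v (Finset.mem_filter.1 hv).1 hvu)
  · rw [MvPolynomial.notMem_support_iff.1 hu]
    refine Finset.sum_eq_zero fun v hv => ?_
    obtain ⟨h1, h2⟩ := Finset.mem_filter.1 hv
    exact absurd h2 (h v h1 (by rintro rfl; exact hu h1))

theorem mem_isolated_iff {D p : ℕ} {f : MvPolynomial (Fin n) R} {u : Fin n →₀ ℕ} :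
    u ∈ isolated f.support (fun s => kron D s % p) ↔ u ∈ f.support ∧
      ∀ v ∈ f.support, v ≠ u → kron D v % p ≠ kron D u % p := by
  rw [isolated, Finset.mem_filter]
  push Not
  rfl

/-- Isolated monomials occupy different residues, and their coefficients arrive there without a
chance of cancellation. -/
theorem card_isolated_le (D p : ℕ) (f : MvPolynomial (Fin n) R) :
    (isolated f.support fun s => kron D s % p).card ≤ (redImage D p f).support.card := by
  refine Finset.card_le_card_of_injOn (fun s => kron D s % p) ?_ ?_
  · intro u hu
    obtain ⟨h1, h2⟩ := mem_isolated_iff.1 (Finset.mem_coe.1 hu)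
    rw [Finset.mem_coe, Polynomial.mem_support_iff, coeff_redImage_of_forall D p f u h2]
    exact MvPolynomial.mem_support_iff.1 h1
  · intro u hu v hv h
    obtain ⟨h1, h2⟩ := mem_isolated_iff.1 (Finset.mem_coe.1 hu)
    by_contra hne
    exact h2 v (mem_isolated_iff.1 (Finset.mem_coe.1 hv)).1 (Ne.symm hne) h.symm

/-- Where the reduced image has the most terms, more than half of the monomials are isolated. -/
theorem card_lt_two_mul_card_isolated {D T N M j₀ : ℕ} {f : MvPolynomial (Fin n) R} (hf : f ≠ 0)
    (hD : ∀ s ∈ f.support, LowDegree D s) (hT : f.support.card ≤ T) (hN : 1 ≤ N) (hNM : N ≤ M)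
    (hprod : D ^ (4 * (n * (T - 1))) ≤ ∏ i ∈ Finset.range N, prm i)
    (hmax : ∀ j < M, (redImage D (prm j) f).support.card ≤
      (redImage D (prm j₀) f).support.card) :
    f.support.card < 2 * (isolated f.support fun s => kron D s % prm j₀).card := by
  obtain ⟨j, hj, h⟩ := exists_card_collided_lt (M := D ^ n) (kron D) f.support
    (MvPolynomial.support_nonempty.2 hf)
    (fun s hs t ht => (hD s hs).kron_inj (hD t ht)) (fun s hs => (hD s hs).kron_lt) hT hN
    (by rw [← pow_mul, mul_left_comm]; exact hprod)
  have h1 := card_collided_add_card_isolated f.support fun s => kron D s % prm j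
  have h2 := card_isolated_le D (prm j) f
  have h3 := hmax j (by omega)
  have h4 := two_mul_card_image_le f.support fun s => kron D s % prm j₀
  have h5 := Finset.card_le_card (support_redImage_subset D (prm j₀) f)
  -- With `t` monomials, `h` and `h1` give more than `3t/4` isolated ones for `j`; by `h2`, `h3`,
  -- `h5` more than `3t/4` residues are occupied for `j₀`, and `h4` turns this into more than `t/2`
  -- isolated ones.
  omega

/-- This makes the stopping test sound: if all reduced images vanish, nothing is left. A prime with
fewer than a quarter of collisions has an isolated monomial. -/
theorem exists_redImage_ne_zero {D T N : ℕ} {f : MvPolynomial (Fin n) R} (hf : f ≠ 0)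
    (hD : ∀ s ∈ f.support, LowDegree D s) (hT : f.support.card ≤ T) (hN : 1 ≤ N)
    (hprod : D ^ (4 * (n * (T - 1))) ≤ ∏ i ∈ Finset.range N, prm i) :
    ∃ j < N, (redImage D (prm j) f).support.card ≠ 0 := by
  obtain ⟨j, hj, h⟩ := exists_card_collided_lt (M := D ^ n) (kron D) f.support
    (MvPolynomial.support_nonempty.2 hf)
    (fun s hs t ht => (hD s hs).kron_inj (hD t ht)) (fun s hs => (hD s hs).kron_lt) hT hN
    (by rw [← pow_mul, mul_left_comm]; exact hprod)
  have h1 := card_collided_add_card_isolated f.support fun s => kron D s % prm j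
  have h2 := card_isolated_le D (prm j) f
  exact ⟨j, hj, by omega⟩

/-- The term test: `c` is the nonzero coefficient of `u` in `f` if and only if, for at least `N₂`
of the first `N₁ + N₂ - 1` primes, the reduced image has the coefficient `c` at the image of `u`. -/
theorem termTest_iff [DecidableEq R] {D T N₁ N₂ : ℕ} {f : MvPolynomial (Fin n) R}
    (hD : ∀ s ∈ f.support, LowDegree D s) (hT : f.support.card ≤ T)
    (hN₁ : 1 ≤ N₁) (hprod₁ : D ^ (n * (T - 1)) ≤ ∏ i ∈ Finset.range N₁, prm i)
    (hN₂ : 1 ≤ N₂) (hprod₂ : D ^ (n * T) ≤ ∏ i ∈ Finset.range N₂, prm i)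
    {u : Fin n →₀ ℕ} (hu : LowDegree D u) {c : R} (hc : c ≠ 0) :
    N₂ ≤ ((Finset.range (N₁ + N₂ - 1)).filter fun j =>
      (redImage D (prm j) f).coeff (kron D u % prm j) = c).card ↔ f.coeff u = c := by
  have herase : ∀ s ∈ f.support.erase u, kron D s ≠ kron D u ∧ kron D s < D ^ n := by
    intro s hs
    obtain ⟨h1, h2⟩ := Finset.mem_erase.1 hs
    exact ⟨fun h => h1 ((hD s h2).kron_inj hu h), (hD s h2).kron_lt⟩
  constructor
  · intro h
    by_contra hne
    refine absurd h (not_le.2 ?_)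
    -- The monomial `u` need not occur in `f`, so up to `T` others count, whence the exponent `n *
    -- T` in the second threshold. Without a collision the coefficient seen would be `f.coeff u`,
    -- which is not `c`.
    refine card_collisions_lt (M := D ^ n) (k := T) (kron D) (f.support.erase u) hu.kron_lt herase
      ((Finset.card_le_card (Finset.erase_subset _ _)).trans hT) hN₂ (by rwa [← pow_mul]) _ ?_
    intro j hj
    obtain ⟨_, hj⟩ := Finset.mem_filter.1 hj
    by_contra! hno
    refine hne ?_
    rw [← hj, coeff_redImage_of_forall]
    exact fun v hv hvu => hno v (Finset.mem_erase.2 ⟨hvu, hv⟩)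
  · rintro rfl
    have hu0 : u ∈ f.support := MvPolynomial.mem_support_iff.2 hc
    -- Now `u` is itself one of the at most `T` monomials, so only `T - 1` others can spoil its
    -- coefficient. Fewer than `N₁` failures among `N₁ + N₂ - 1` primes leave at least `N₂`
    -- successes.
    have h1 := card_collisions_lt (M := D ^ n) (k := T - 1) (kron D) (f.support.erase u)
      hu.kron_lt herase (by rw [Finset.card_erase_of_mem hu0]; omega) hN₁ (by rwa [← pow_mul])
      ((Finset.range (N₁ + N₂ - 1)).filter fun j =>
        ¬ (redImage D (prm j) f).coeff (kron D u % prm j) = f.coeff u) (by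
        intro j hj
        obtain ⟨_, hj⟩ := Finset.mem_filter.1 hj
        by_contra! hno
        exact hj (coeff_redImage_of_forall _ _ _ _ fun v hv hvu =>
          hno v (Finset.mem_erase.2 ⟨hvu, hv⟩)))
    have h2 := Finset.card_filter_add_card_filter_not (s := Finset.range (N₁ + N₂ - 1))
      fun j => (redImage D (prm j) f).coeff (kron D u % prm j) = f.coeff u
    rw [Finset.card_range] at h2
    omega

end Images

/-! ## Bounds for the numbers that come up -/

/-- The numbers in the algorithm that are polynomial in the size of the output have at most `m`
bits, all other numbers, except in the computation of the thresholds, have at most `L` bits. -/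
structure Bounds (n T D K L m : ℕ) : Prop where
  n_pos : 0 < n
  T_pos : 0 < T
  len_n : len n ≤ m
  len_nT : len (4 * (n * T)) ≤ m
  len_K : len K ≤ m
  len_D : len D ≤ L
  len_prm : len (2 * prm K) ≤ m
  len_exp : len (2 * (n * D * prm K)) ≤ L
  K_le : K ≤ 4 * (n * T) * L
  prm_le : prm K ≤ 40 * (K * m)

/-- Compares monomials in the parameters: the missing cofactor is named, and `ring` checks that it
completes the smaller monomial to the larger one. -/
theorem le_of_mul_eq {a c : ℕ} (b : ℕ) (hb : 0 < b) (h : a * b = c) : a ≤ c :=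
  h ▸ Nat.le_mul_of_pos_right a hb

namespace Bounds

variable {n T D K L m : ℕ} (b : Bounds n T D K L m)
include b

theorem m_pos : 0 < m := (one_le_len _).trans b.len_K

theorem L_pos : 0 < L := (one_le_len _).trans b.len_D

theorem len_T : len T ≤ m := by
  refine (len_mono ?_).trans b.len_nT
  have := b.n_pos
  nlinarith

theorem len_two_prm {j : ℕ} (hj : j ≤ K) : len (2 * prm j) ≤ m :=
  (len_mono (Nat.mul_le_mul_left 2 (prm_strictMono.monotone hj))).trans b.len_prm

theorem len_of_le_two_prm {j x : ℕ} (hj : j ≤ K) (hx : x ≤ 2 * prm j) : len x ≤ m :=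
  (len_mono hx).trans (b.len_two_prm hj)

theorem len_of_le_exp {j x : ℕ} (hj : j ≤ K) (hx : x ≤ 2 * (n * D * prm j)) : len x ≤ L :=
  (len_mono (hx.trans (Nat.mul_le_mul_left 2 (Nat.mul_le_mul_left _
    (prm_strictMono.monotone hj))))).trans b.len_exp

theorem len_of_le_exp' {j x : ℕ} (hj : j ≤ K) (hx : x ≤ 2 * (D * prm j)) : len x ≤ L := by
  refine b.len_of_le_exp hj (hx.trans ?_)
  rw [mul_assoc n]
  exact Nat.mul_le_mul_left 2 (Nat.le_mul_of_pos_left _ b.n_pos)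

end Bounds

/-! ## Exponents as lists -/

section Exponents

variable {n : ℕ}

theorem dotp_eq_expDot (e : Fin n → ℕ) {es : List ℕ} (h : es.length = n) :
    dotp es (List.ofFn e) = expDot e (expVec n es) := by
  subst h
  have : List.zipWith (· * ·) es (List.ofFn e) =
      List.ofFn fun i : Fin es.length => es.getD i 0 * e i := by
    refine List.ext_getElem (by simp) fun i h1 h2 => ?_
    simp at h1
    simp
  rw [dotp, this, List.sum_ofFn]
  rfl

theorem sum_eq_sum_expVec {es : List ℕ} (h : es.length = n) :
    es.sum = ∑ i, expVec n es i := by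
  subst h
  have : es = List.ofFn fun i : Fin es.length => es.getD i 0 := by
    refine List.ext_getElem (by simp) fun i h1 h2 => ?_
    simp
  conv_lhs => rw [this, List.sum_ofFn]
  rfl

theorem expVec_injOn {es es' : List ℕ} (h : es.length = n) (h' : es'.length = n)
    (heq : expVec n es = expVec n es') : es = es' := by
  refine List.ext_getElem (h.trans h'.symm) fun i h1 h2 => ?_
  have := DFunLike.congr_fun heq ⟨i, by omega⟩
  simpa [expVec, h1, h2] using this

@[simp] theorem expVec_ofFn (s : Fin n →₀ ℕ) : expVec n (List.ofFn s) = s := by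
  ext i
  simp [expVec]

theorem kronExp_le (D : ℕ) {p : ℕ} (hp : 0 < p) (i : Fin n) : kronExp n D p i ≤ p :=
  (Nat.mod_lt _ hp).le

theorem kronExpShift_le (D : ℕ) {p : ℕ} (hp : 0 < p) (k i : Fin n) :
    kronExpShift n D p k i ≤ 2 * p := by
  have := Nat.mod_lt (D ^ (i : ℕ)) hp
  unfold kronExpShift
  split_ifs <;> omega

theorem expDot_kronExpShift_mod (D p : ℕ) (k : Fin n) (s : Fin n →₀ ℕ) :
    expDot (kronExpShift n D p k) s % p = kron D s % p := by
  rw [expDot_kronExpShift, Nat.add_mul_mod_self_right, expDot_kronExp_mod]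

/-- The total degree bounds the sum of the exponents, so the image has degree of order `D * B`
without a factor `n`. The factor `2` covers the shifted substitutions. -/
theorem LowDegree.expDot_le {D B : ℕ} {s : Fin n →₀ ℕ} (h : LowDegree D s) {e : Fin n → ℕ}
    (he : ∀ i, e i ≤ 2 * B) : expDot e s ≤ 2 * (D * B) := by
  refine (KroneckerInterp.expDot_le he s).trans ?_
  calc _ ≤ D * (2 * B) := Nat.mul_le_mul_right _ (le_of_lt h)
    _ = _ := by ring

end Exponents

/-! ## Samples -/

theorem geometric_val (D p n j : ℕ) :
    (geometric (D % p) p n (D ^ j % p)).val = List.ofFn fun i : Fin n => D ^ (j + i) % p := by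
  induction n generalizing j with
  | zero => rfl
  | succ n ih =>
    have h : D ^ j % p * (D % p) % p = D ^ (j + 1) % p := by rw [pow_succ, ← Nat.mul_mod]
    simp only [geometric, bind_val, natMul_val, natMod_val, h, ih, List.ofFn_succ, ret_val]
    simp [add_assoc, add_comm 1]

@[simp] theorem residues_val (n D p : ℕ) :
    (residues n D p).val = List.ofFn (kronExp n D p) := by
  have := geometric_val D p n 0
  simp only [pow_zero, zero_add] at this
  exact this

theorem geometric_within {d p m : ℕ} (hp : 0 < p) (hm : len p ≤ m) (hd : len d ≤ m) (n r : ℕ)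
    (hn : len n ≤ m) (hr : len r ≤ m) :
    (geometric d p n r).Within 0 (n * (m + 3 * m ^ 2) + 1) 0 := by
  induction n generalizing r with
  | zero => exact (tick_ret_within 1 _).mono (by simp) (by simp) le_rfl
  | succ n ih =>
    have hn' : len n ≤ m := (len_mono n.le_succ).trans hn
    have hx : len (r * d) ≤ 2 * m := (len_mul r d).trans (by omega)
    refine Within.mono ((tick_within _).bind ((natMul_within hr hd).bind
      ((natMod_within hx hm).bind ((ih ((r * d) % p) hn' (len_mod_le hp hm)).bind
      (Within.ret _))))) le_rfl ?_ le_rfl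
    have e1 : (n + 1) * (m + 3 * m ^ 2) = n * (m + 3 * m ^ 2) + m + 3 * m ^ 2 := by ring
    have e2 : 2 * m * m = 2 * m ^ 2 := by ring
    rw [e1, e2, ← sq]; omega

theorem residues_within {n D p L m : ℕ} (hn : 0 < n) (hp : 0 < p) (hm : len p ≤ m)
    (hnm : len n ≤ m) (hD : len D ≤ L) :
    (residues n D p).Within 0 (L * m + 7 * (n * m ^ 2)) 0 := by
  have hm1 : 0 < m := (one_le_len _).trans hm
  refine Within.mono ((natMod_within hD hm).bind ((natMod_within len_one.le hm).bind
    (geometric_within hp hm (len_mod_le hp hm) n _ hnm (len_mod_le hp hm)))) le_rfl ?_ le_rfl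
  have h1 : m ≤ n * m ^ 2 := le_of_mul_eq (n * m) (by positivity) (by ring)
  have h2 : 1 ≤ n * m ^ 2 := Nat.succ_le_of_lt (by positivity)
  have h3 : n * (m + 3 * m ^ 2) = n * m + 3 * (n * m ^ 2) := by ring
  have h4 : n * m ≤ n * m ^ 2 := le_of_mul_eq m hm1 (by ring)
  rw [h3]; omega

section Samples

variable {R : Type u} [CommRing R] [DecidableEq R] {n : ℕ}

/-- A sample holds the data for the prime `p` and the polynomial `F`. -/
structure Sample.Valid (D : ℕ) (F : MvPolynomial (Fin n) R) (x : Sample R) (p : ℕ) : Prop where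
  p_eq : x.p = p
  w_eq : x.w = List.ofFn (kronExp n D p)
  poly : Represents x.poly (subst (kronExp n D p) F)
  red : Represents x.red (redImage D p F)

/-- The dictionaries of a sample have received at most `c` terms. -/
structure Sample.Small (L m c : ℕ) (x : Sample R) : Prop where
  poly : x.poly.nodes ≤ 1 + 2 * L * c
  red : x.red.nodes ≤ 1 + 2 * m * c

/-- Only monomials of total degree less than `D` occur in `f`. -/
def LowDegreePoly (D : ℕ) (f : MvPolynomial (Fin n) R) : Prop :=
  ∀ s ∈ f.support, LowDegree D s

theorem lowDegreePoly_of_totalDegree_lt {D : ℕ} {f : MvPolynomial (Fin n) R}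
    (h : f.totalDegree < D) : LowDegreePoly D f := by
  intro s hs
  have := (MvPolynomial.le_totalDegree hs).trans_lt h
  rwa [Finsupp.sum_fintype _ _ (by simp)] at this

/-- With distinct exponents and nonzero coefficients no cancellation can occur in the sum, so the
list shows the support itself. -/
theorem IsUniTerms.toFinset_exponents {l : List (ℕ × R)} {g : Polynomial R} (h : IsUniTerms l g) :
    (l.map Prod.fst).toFinset = g.support := by
  have key : ∀ l : List (ℕ × R), (l.map Prod.fst).Nodup → (∀ t ∈ l, t.2 ≠ 0) →
      (l.map Prod.fst).toFinset = (l.map fun t => Polynomial.monomial t.1 t.2).sum.support := by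
    intro l
    induction l with
    | nil => simp
    | cons a l ih =>
      intro hnd hne
      rw [List.map_cons, List.nodup_cons] at hnd
      have ih' := ih hnd.2 fun t ht => hne t (by simp [ht])
      rw [List.map_cons, List.map_cons, List.sum_cons, List.toFinset_cons]
      ext e
      rw [Polynomial.mem_support_iff, Polynomial.coeff_add, Polynomial.coeff_monomial,
        Finset.mem_insert, ih', Polynomial.mem_support_iff]
      by_cases he : a.1 = e
      · subst he
        have h0 : (l.map fun t => Polynomial.monomial t.1 t.2).sum.coeff a.1 = 0 := by
          rw [← Polynomial.notMem_support_iff, ← ih']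
          simpa using hnd.1
        simp [h0, hne a (by simp)]
      · simp [he, Ne.symm he]
  rw [key l h.nodup h.ne_zero, h.sum_eq]

theorem IsUniTerms.length_eq {l : List (ℕ × R)} {g : Polynomial R} (h : IsUniTerms l g) :
    l.length = g.support.card := by
  rw [← h.toFinset_exponents, List.toFinset_card_of_nodup h.nodup, List.length_map]

theorem IsUniTerms.mem_support {l : List (ℕ × R)} {g : Polynomial R} (h : IsUniTerms l g)
    {x : ℕ × R} (hx : x ∈ l) : x.1 ∈ g.support := by
  rw [← h.toFinset_exponents, List.mem_toFinset]
  exact List.mem_map_of_mem hx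

theorem takeSample_valid {D p : ℕ} {f : MvPolynomial (Fin n) R} {I : List ℕ → List (ℕ × R)}
    (hI : IsInterpolator f I) : (takeSample I n D p).val.Valid D f p := by
  have h := (hI (kronExp n D p)).sum_eq
  simp only [takeSample, bind_val, residues_val, query_val, ret_val]
  refine ⟨rfl, rfl, ?_, ?_⟩
  · have := represents_leaf.addTerms (I (List.ofFn (kronExp n D p)))
    rwa [h, zero_add] at this
  · have := represents_leaf.addTermsMod p (I (List.ofFn (kronExp n D p)))
    rwa [h, zero_add] at this

theorem takeSamples_val (I : List ℕ → List (ℕ × R)) (n D : ℕ) (ps : List ℕ) :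
    (takeSamples I n D ps).val = ps.map fun p => (takeSample I n D p).val := by
  induction ps with
  | nil => rfl
  | cons p ps ih => simp [takeSamples, ih]

theorem query_within (I : List ℕ → List (ℕ × R)) {e : Fin n → ℕ} {m : ℕ}
    (he : ∀ i, len (e i) ≤ m) : (query I (List.ofFn e)).Within 0 (n * m + 1) 1 := by
  refine ⟨le_rfl, ?_, le_rfl⟩
  simp only [query, List.map_ofFn, List.sum_ofFn]
  refine Nat.add_le_add_right ?_ 1
  calc _ ≤ ∑ _ : Fin n, m := Finset.sum_le_sum fun i _ => he i
    _ = n * m := by simp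

section Costs

variable {T D K L m j : ℕ} {f : MvPolynomial (Fin n) R} {I : List ℕ → List (ℕ × R)}

theorem Bounds.len_term (b : Bounds n T D K L m) (hj : j ≤ K) (hD : LowDegreePoly D f)
    (hI : IsInterpolator f I) {e : Fin n → ℕ} (he : ∀ i, e i ≤ 2 * prm j) :
    ∀ x ∈ I (List.ofFn e), len x.1 ≤ L := by
  intro x hx
  obtain ⟨s, hs, hsx⟩ := exists_of_mem_support_subst ((hI e).mem_support hx)
  rw [← hsx]
  exact b.len_of_le_exp' hj ((hD s hs).expDot_le he)

theorem length_terms_le (hT : f.support.card ≤ T) (hI : IsInterpolator f I) (e : Fin n → ℕ) :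
    (I (List.ofFn e)).length ≤ T := by
  rw [(hI e).length_eq]
  exact (card_support_subst_le e f).trans hT

theorem takeSample_within (b : Bounds n T D K L m) (hj : j ≤ K) (hD : LowDegreePoly D f)
    (hT : f.support.card ≤ T) (hI : IsInterpolator f I) :
    (takeSample I n D (prm j)).Within (4 * T) (19 * (n * T * L * m ^ 2)) 1 := by
  have hp := (prm_prime j).pos
  have hpm : len (prm j) ≤ m := b.len_of_le_two_prm hj (by omega)
  have hlen := length_terms_le hT hI (kronExp n D (prm j))
  have hL := b.len_term hj hD hI (e := kronExp n D (prm j)) fun i =>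
    (kronExp_le D hp i).trans (by omega)
  have h1 := residues_within (D := D) b.n_pos hp hpm b.len_n b.len_D
  have h2 := query_within I (e := kronExp n D (prm j)) (m := m) fun i =>
    b.len_of_le_two_prm hj ((kronExp_le D hp i).trans (by omega))
  have h3 := addTerms_within _ Trie.leaf hL
  have h4 := addTermsMod_within hp hpm _ Trie.leaf hL
  rw [← residues_val] at h2 h3 h4
  refine Within.mono (h1.bind (h2.bind (h3.bind (h4.bind (Within.ret _))))) ?_ ?_ le_rfl
  · rw [residues_val]; omega
  · rw [residues_val]
    have hn := b.n_pos
    have hT := b.T_pos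
    have hm := b.m_pos
    have hL := b.L_pos
    set l := (I (List.ofFn (kronExp n D (prm j)))).length
    have g1 : l * (2 * L + 1) ≤ T * (2 * L + 1) := Nat.mul_le_mul_right _ hlen
    have g2 : l * (L * m + 2 * m + 1) ≤ T * (L * m + 2 * m + 1) := Nat.mul_le_mul_right _ hlen
    have e1 : T * (2 * L + 1) = 2 * (T * L) + T := by ring
    have e2 : T * (L * m + 2 * m + 1) = T * L * m + 2 * (T * m) + T := by ring
    have q1 : L * m ≤ n * T * L * m ^ 2 := le_of_mul_eq (n * T * m) (by positivity) (by ring)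
    have q2 : n * m ^ 2 ≤ n * T * L * m ^ 2 := le_of_mul_eq (T * L) (by positivity) (by ring)
    have q3 : n * m ≤ n * T * L * m ^ 2 := le_of_mul_eq (T * L * m) (by positivity) (by ring)
    have q4 : T * L ≤ n * T * L * m ^ 2 := le_of_mul_eq (n * m ^ 2) (by positivity) (by ring)
    have q5 : T ≤ n * T * L * m ^ 2 := le_of_mul_eq (n * L * m ^ 2) (by positivity) (by ring)
    have q6 : T * L * m ≤ n * T * L * m ^ 2 := le_of_mul_eq (n * m) (by positivity) (by ring)
    have q7 : T * m ≤ n * T * L * m ^ 2 := le_of_mul_eq (n * L * m) (by positivity) (by ring)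
    have q8 : 1 ≤ n * T * L * m ^ 2 := Nat.succ_le_of_lt (by positivity)
    omega

theorem takeSample_small (b : Bounds n T D K L m) (hj : j ≤ K) (hD : LowDegreePoly D f)
    (hT : f.support.card ≤ T) (hI : IsInterpolator f I) :
    (takeSample I n D (prm j)).val.Small L m T := by
  have hp := (prm_prime j).pos
  have hpm : len (prm j) ≤ m := b.len_of_le_two_prm hj (by omega)
  have hlen := length_terms_le hT hI (kronExp n D (prm j))
  have hL := b.len_term hj hD hI (e := kronExp n D (prm j)) fun i =>
    (kronExp_le D hp i).trans (by omega)
  simp only [takeSample, bind_val, residues_val, query_val, ret_val]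
  constructor
  · exact (nodes_addTerms _ _ hL).trans (Nat.add_le_add le_rfl (Nat.mul_le_mul_left _ hlen))
  · exact (nodes_addTermsMod hp hpm _ _).trans (Nat.add_le_add le_rfl (Nat.mul_le_mul_left _ hlen))

theorem takeSamples_within (b : Bounds n T D K L m) (hD : LowDegreePoly D f)
    (hT : f.support.card ≤ T) (hI : IsInterpolator f I) (js : List ℕ) (hjs : ∀ j ∈ js, j ≤ K) :
    (takeSamples I n D (js.map prm)).Within (js.length * (4 * T))
      (js.length * (20 * (n * T * L * m ^ 2)) + 1) js.length := by
  induction js with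
  | nil => exact (tick_ret_within 1 _).mono (by simp) (by simp) le_rfl
  | cons j js ih =>
    refine Within.mono ((tick_within 1).bind ((takeSample_within b (hjs j (by simp)) hD hT hI).bind
      ((ih fun x hx => hjs x (by simp [hx])).bind (Within.ret _)))) ?_ ?_ ?_
    · rw [List.length_cons, add_mul]; omega
    · have hn := b.n_pos
      have hT := b.T_pos
      have hm := b.m_pos
      have hL := b.L_pos
      have q8 : 1 ≤ n * T * L * m ^ 2 := Nat.succ_le_of_lt (by positivity)
      rw [List.length_cons, add_mul]; omega
    · rw [List.length_cons]; omega

end Costs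

/-! ### Subroutines without requests, and the requests for samples -/

theorem Run.Within.queries_eq_nil {α : Type v} {x : Run α} {r b : ℕ} (h : x.Within r b 0) :
    x.queries = [] :=
  List.length_eq_zero_iff.1 (Nat.le_zero.1 h.query)

theorem addTerm_queries (t : UPoly R) (e : ℕ) (c : R) : (addTerm t e c).queries = [] :=
  (addTerm_within t c le_rfl).queries_eq_nil

theorem subTerm_queries (t : UPoly R) (e : ℕ) (c : R) : (subTerm t e c).queries = [] :=
  (subTerm_within t c le_rfl).queries_eq_nil

theorem addTerms_queries (l : List (ℕ × R)) (t : UPoly R) : (addTerms l t).queries = [] := by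
  induction l generalizing t with
  | nil => rfl
  | cons a l ih => simp [addTerms, tick, addTerm_queries, ih]

theorem addTermsMod_queries (p : ℕ) (l : List (ℕ × R)) (t : UPoly R) :
    (addTermsMod p l t).queries = [] := by
  induction l generalizing t with
  | nil => rfl
  | cons a l ih => simp [addTermsMod, tick, natMod, addTerm_queries, ih]

theorem geometric_queries (d p n r : ℕ) : (geometric d p n r).queries = [] := by
  induction n generalizing r with
  | zero => rfl
  | succ n ih => simp [geometric, tick, natMul, natMod, ih]

theorem dot_queries (as bs : List ℕ) : (dot as bs).queries = [] := by
  induction as generalizing bs with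
  | nil => cases bs <;> rfl
  | cons a as ih => cases bs <;> simp [dot, tick, natMul, natAdd, ih]

theorem subImage_queries (w : List ℕ) (s : List (List ℕ × R)) (t : UPoly R) :
    (subImage w s t).queries = [] := by
  induction s generalizing t with
  | nil => rfl
  | cons a l ih => simp [subImage, tick, dot_queries, subTerm_queries, ih]

theorem takeSample_queries (I : List ℕ → List (ℕ × R)) (n D p : ℕ) :
    (takeSample I n D p).queries = [List.ofFn (kronExp n D p)] := by
  have h : (residues n D p).queries = [] := by
    simp [residues, natMod, geometric_queries]
  simp only [takeSample, bind_queries, h, addTerms_queries, addTermsMod_queries, residues_val]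
  rfl

theorem takeSamples_asks (I : List ℕ → List (ℕ × R)) (D : ℕ) (ps : List ℕ) (P : List ℕ → Prop)
    (hP : ∀ p ∈ ps, P (List.ofFn (kronExp n D p))) : (takeSamples I n D ps).Asks P := by
  induction ps with
  | nil => simp [takeSamples, Asks, tick]
  | cons p ps ih =>
    refine ((tick_within 1).asks P).bind (Asks.bind ?_ ((ih fun q hq => hP q (by simp [hq])).bind
      (Asks.ret _ _)))
    intro e he
    rw [takeSample_queries, List.mem_singleton] at he
    rw [he]
    exact hP p (by simp)

/-! ### The best sample -/

theorem bestSample_spec (xs : List (Sample R)) :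
    ((bestSample xs).val = none → xs = []) ∧
    (∀ α x, (bestSample xs).val = some (α, x) → x ∈ xs ∧ α = x.red.count.val ∧
      ∀ y ∈ xs, y.red.count.val ≤ α) := by
  induction xs with
  | nil => simp [bestSample]
  | cons x xs ih =>
    simp only [bestSample, bind_val]
    rcases h : (bestSample xs).val with _ | ⟨β, y⟩
    · have := ih.1 h
      subst this
      simp only [ret_val]
      refine ⟨by simp, ?_⟩
      rintro α z hz
      simp only [Option.some.injEq, Prod.mk.injEq] at hz
      obtain ⟨rfl, rfl⟩ := hz
      simp
    · obtain ⟨h1, h2, h3⟩ := ih.2 β y h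
      simp only [bind_val, natLe_val, ret_val, decide_eq_true_eq]
      refine ⟨by split_ifs <;> simp, ?_⟩
      rintro α z hz
      split_ifs at hz with hle
      · simp only [Option.some.injEq, Prod.mk.injEq] at hz
        obtain ⟨rfl, rfl⟩ := hz
        refine ⟨by simp, rfl, ?_⟩
        intro y' hy'
        rcases List.mem_cons.1 hy' with rfl | hy'
        · exact le_rfl
        · exact (h3 y' hy').trans hle
      · simp only [Option.some.injEq, Prod.mk.injEq] at hz
        obtain ⟨rfl, rfl⟩ := hz
        refine ⟨by simp [h1], h2, ?_⟩
        intro y' hy'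
        rcases List.mem_cons.1 hy' with rfl | hy'
        · exact (not_le.1 hle).le
        · exact h3 y' hy'

/-- Counting visits nodes, not terms. At most `2 * T` insertions with keys of `m` bits give at most
`5 * (T * m)` nodes, whatever cancelled since. -/
theorem bestSample_within {T L m c : ℕ} (hT0 : 0 < T) (hm : 0 < m) (hTm : len T ≤ m)
    (hc : c ≤ 2 * T) (xs : List (Sample R)) (hxs : ∀ x ∈ xs, x.Small L m c) :
    (bestSample xs).Within 0 (xs.length * (135 * (T * m ^ 2)) + 1) 0 := by
  induction xs with
  | nil => exact (tick_ret_within 1 _).mono (by simp) (by simp) le_rfl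
  | cons x xs ih =>
    have hnodes : ∀ y ∈ x :: xs, y.red.nodes ≤ 5 * (T * m) := by
      intro y hy
      refine (hxs y hy).red.trans ?_
      have h1 : 2 * m * c ≤ 2 * m * (2 * T) := Nat.mul_le_mul_left _ hc
      have h2 : 1 ≤ T * m := Nat.succ_le_of_lt (by positivity)
      nlinarith
    have hlen : ∀ y ∈ x :: xs, len y.red.nodes ≤ 6 * m := by
      intro y hy
      have h1 := len_mono (hnodes y hy)
      have h2 := len_mul 5 (T * m)
      have h3 := len_mul T m
      have h4 := len_le_self (a := m)
      have h5 : len 5 = 4 := by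
        have : Nat.size 5 = 3 := by
          apply le_antisymm
          · rw [Nat.size_le]; norm_num
          · by_contra! h
            have := Nat.size_le.1 (Nat.le_of_lt_succ h)
            norm_num at this
        rw [len, this]
      have h6 : 2 ≤ m := by
        have := len_mono hT0
        rw [len_one] at this
        omega
      omega
    have hcount := Trie.count_within x.red (hlen x (by simp))
    have hval : ∀ y ∈ x :: xs, len y.red.count.val ≤ 6 * m := fun y hy =>
      (len_mono (by simpa using Trie.entries_length_le y.red)).trans (hlen y hy)
    refine Within.mono ((tick_within 1).bind (hcount.bind ((ih fun y hy => hxs y (by simp [hy])).bind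
      (r' := 0) (b' := 12 * m) (q' := 0) ?_))) le_rfl ?_ le_rfl
    · rcases h : (bestSample xs).val with _ | ⟨β, y⟩
      · exact (Within.ret _).mono le_rfl (Nat.zero_le _) le_rfl
      · obtain ⟨h1, h2, _⟩ := (bestSample_spec xs).2 β y h
        refine Within.mono (Within.bind (natLe_within (h2 ▸ hval y (by simp [h1]))
          (hval x (by simp))) (Within.ret _)) le_rfl ?_ le_rfl
        omega
    · have h1 : x.red.nodes * (3 * (6 * m) + 3) ≤ 5 * (T * m) * (3 * (6 * m) + 3) :=
        Nat.mul_le_mul_right _ (hnodes x (by simp))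
      have h2 : 5 * (T * m) * (3 * (6 * m) + 3) = 90 * (T * m ^ 2) + 15 * (T * m) := by ring
      have q1 : T * m ≤ T * m ^ 2 := le_of_mul_eq m hm (by ring)
      have q2 : m ≤ T * m ^ 2 := le_of_mul_eq (T * m) (by positivity) (by ring)
      have q3 : 1 ≤ T * m ^ 2 := Nat.succ_le_of_lt (by positivity)
      rw [List.length_cons, add_mul]; omega

/-! ### Updating the samples -/

theorem updateSamples_val (s : List (List ℕ × R)) (xs : List (Sample R)) :
    (updateSamples s xs).val = xs.map fun x =>
      ⟨x.p, x.w, (subImage x.w s x.poly).val, (subImageMod x.p x.w s x.red).val⟩ := by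
  induction xs with
  | nil => rfl
  | cons x xs ih => simp [updateSamples, ih]

/-- The polynomial with the given list of terms. -/
noncomputable def termSum (n : ℕ) (s : List (List ℕ × R)) : MvPolynomial (Fin n) R :=
  (s.map fun t => MvPolynomial.monomial (expVec n t.1) t.2).sum

theorem subst_termSum (e : Fin n → ℕ) {s : List (List ℕ × R)} (hs : ∀ t ∈ s, t.1.length = n) :
    subst e (termSum n s) =
      (s.map fun u => Polynomial.monomial (dotp u.1 (List.ofFn e)) u.2).sum := by
  rw [termSum, subst_list_sum, List.map_map]
  congr 1
  refine List.map_congr_left fun t ht => ?_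
  rw [Function.comp_apply, subst_monomial, dotp_eq_expDot e (hs t ht)]

theorem Sample.Valid.update {D p : ℕ} {F : MvPolynomial (Fin n) R} {x : Sample R}
    (h : x.Valid D F p) {s : List (List ℕ × R)} (hs : ∀ t ∈ s, t.1.length = n) :
    Sample.Valid D (F - termSum n s)
      ⟨x.p, x.w, (subImage x.w s x.poly).val, (subImageMod x.p x.w s x.red).val⟩ p := by
  refine ⟨h.p_eq, h.w_eq, ?_, ?_⟩
  · have := h.poly.subImage (List.ofFn (kronExp n D p)) s
    rw [← subst_termSum _ hs, ← subst_sub] at this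
    simpa only [h.w_eq] using this
  · have := h.red.subImageMod p (List.ofFn (kronExp n D p)) s
    rw [← subst_termSum _ hs, redImage, ← map_sub, ← subst_sub] at this
    simpa only [h.w_eq, h.p_eq, redImage] using this

/-- The terms `s` have `n` exponents and total degree less than `D`. -/
def LowDegreeTerms (n D : ℕ) (s : List (List ℕ × R)) : Prop :=
  ∀ t ∈ s, t.1.length = n ∧ LowDegree D (expVec n t.1)

theorem Bounds.imageBounds {T D K L m j : ℕ} (b : Bounds n T D K L m) (hj : j ≤ K)
    {s : List (List ℕ × R)} (hs : LowDegreeTerms n D s) {e : Fin n → ℕ}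
    (he : ∀ i, e i ≤ 2 * prm j) : ImageBounds n L (List.ofFn e) s where
  length_eq := fun u hu => (hs u hu).1
  len_entry := fun u hu x hx => by
    have h1 := List.single_le_sum (fun _ _ => Nat.zero_le _) x hx
    rw [sum_eq_sum_expVec (hs u hu).1] at h1
    exact (len_mono (h1.trans (le_of_lt (hs u hu).2))).trans b.len_D
  len_dotp := fun u hu => by
    rw [dotp_eq_expDot e (hs u hu).1]
    exact b.len_of_le_exp' hj ((hs u hu).2.expDot_le he)

theorem updateSamples_within {T D K L m : ℕ} (b : Bounds n T D K L m)
    {F : MvPolynomial (Fin n) R} {s : List (List ℕ × R)} (hs : LowDegreeTerms n D s)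
    (hsT : s.length ≤ T) {xs : List (Sample R)} {js : List ℕ} (hjs : ∀ j ∈ js, j ≤ K)
    (hxs : List.Forall₂ (fun x j => Sample.Valid D F x (prm j)) xs js) :
    (updateSamples s xs).Within (xs.length * (6 * T))
      (xs.length * (20 * (n * T * L * m)) + 1) 0 := by
  induction hxs with
  | nil => exact (tick_ret_within 1 _).mono (by simp) (by simp) le_rfl
  | @cons x j xs js hx _ ih =>
    have hjK := hjs j (by simp)
    have hp := (prm_prime j).pos
    have hpm : len (prm j) ≤ m := b.len_of_le_two_prm hjK (by omega)
    have hib : ImageBounds n L x.w s := by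
      rw [hx.w_eq]
      exact b.imageBounds hjK hs fun i => (kronExp_le D hp i).trans (by omega)
    have hw : ∀ y ∈ x.w, len y ≤ m := by
      rw [hx.w_eq]
      intro y hy
      obtain ⟨i, rfl⟩ := (List.mem_ofFn' _ _).1 hy
      exact b.len_of_le_two_prm hjK ((kronExp_le D hp i).trans (by omega))
    have h1 := subImage_within b.n_pos b.m_pos hw hib x.poly
    have h2 := subImageMod_within b.n_pos hp hpm hw hib x.red
    rw [← hx.p_eq] at h2
    refine Within.mono ((tick_within 1).bind (h1.bind (h2.bind
      ((ih fun j hj => hjs j (by simp [hj])).bind (Within.ret _))))) ?_ ?_ le_rfl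
    · rw [List.length_cons, add_mul]; omega
    · have hn := b.n_pos
      have hT := b.T_pos
      have hm := b.m_pos
      have hL := b.L_pos
      have g1 : s.length * (8 * (n * L * m)) ≤ T * (8 * (n * L * m)) := Nat.mul_le_mul_right _ hsT
      have g2 : s.length * (9 * (n * L * m)) ≤ T * (9 * (n * L * m)) := Nat.mul_le_mul_right _ hsT
      have e1 : T * (8 * (n * L * m)) = 8 * (n * T * L * m) := by ring
      have e2 : T * (9 * (n * L * m)) = 9 * (n * T * L * m) := by ring
      have q8 : 1 ≤ n * T * L * m := Nat.succ_le_of_lt (by positivity)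
      rw [List.length_cons, add_mul]; omega

theorem Sample.Small.update {T D K L m j c : ℕ} (b : Bounds n T D K L m) (hj : j ≤ K)
    {F : MvPolynomial (Fin n) R} {s : List (List ℕ × R)} (hs : LowDegreeTerms n D s) {x : Sample R}
    (hx : x.Valid D F (prm j)) (h : x.Small L m c) :
    Sample.Small L m (c + s.length)
      ⟨x.p, x.w, (subImage x.w s x.poly).val, (subImageMod x.p x.w s x.red).val⟩ := by
  have hp := (prm_prime j).pos
  have hpm : len (prm j) ≤ m := b.len_of_le_two_prm hj (by omega)
  have hib : ImageBounds n L x.w s := by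
    rw [hx.w_eq]
    exact b.imageBounds hj hs fun i => (kronExp_le D hp i).trans (by omega)
  have h1 := nodes_subImage hib x.poly
  have h2 := nodes_subImageMod hp hpm x.w s x.red
  rw [← hx.p_eq] at h2
  constructor
  · have := h.poly
    rw [mul_add]; simp only; omega
  · have := h.red
    rw [mul_add]; simp only; omega

/-! ### The shifted images -/

@[simp] theorem shiftAt_val (p k : ℕ) (l : List ℕ) :
    (shiftAt p k l).val = l.modify k (· + p) := by
  induction l generalizing k with
  | nil => cases k <;> rfl
  | cons r rs ih => cases k <;> simp [shiftAt, ih]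

theorem shiftAt_kronExp (D p : ℕ) (k : Fin n) :
    (shiftAt p k (List.ofFn (kronExp n D p))).val = List.ofFn (kronExpShift n D p k) := by
  rw [shiftAt_val]
  refine List.ext_getElem (by simp) fun i h1 h2 => ?_
  simp only [List.getElem_modify, List.getElem_ofFn, kronExpShift, kronExp]
  simp only [List.length_ofFn] at h2
  by_cases h : (k : ℕ) = i
  · have : (⟨i, h2⟩ : Fin n) = k := Fin.ext h.symm
    simp [h, this]
  · have : ¬ (⟨i, h2⟩ : Fin n) = k := fun hh => h (congrArg Fin.val hh).symm
    simp [h, this]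

theorem shiftAt_within {p m : ℕ} (hp : len p ≤ m) (l : List ℕ) (hl : ∀ r ∈ l, len r ≤ m) (k : ℕ)
    (hk : len k ≤ m) : (shiftAt p k l).Within 0 (l.length * m + 2 * m + 1) 0 := by
  have hm : 1 ≤ m := (one_le_len _).trans hp
  induction l generalizing k with
  | nil => cases k <;> exact (tick_ret_within 1 _).mono (by simp) (by simp) le_rfl
  | cons r rs ih =>
    cases k with
    | zero =>
      refine Within.mono (Within.bind (natAdd_within (hl r (by simp)) hp) (Within.ret _))
        le_rfl ?_ le_rfl
      omega
    | succ k =>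
      have hk' : len k ≤ m := (len_mono k.le_succ).trans hk
      refine Within.mono ((tick_within _).bind ((ih (fun x hx => hl x (by simp [hx])) k hk').bind
        (Within.ret _))) le_rfl ?_ le_rfl
      rw [List.length_cons, add_mul]; omega

theorem shiftAt_queries (p k : ℕ) (l : List ℕ) : (shiftAt p k l).queries = [] := by
  induction l generalizing k with
  | nil => cases k <;> rfl
  | cons r rs ih => cases k <;> simp [shiftAt, tick, natAdd, ih]

/-- `shiftedImages` counts down the number of remaining indices, so with `j + 1` left the current
index is `n - (j + 1)`; this peels that index off the list. -/
theorem drop_finRange {j : ℕ} (h : j + 1 ≤ n) :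
    (List.finRange n).drop (n - (j + 1)) =
      ⟨n - (j + 1), by omega⟩ :: (List.finRange n).drop (n - j) := by
  rw [List.drop_eq_getElem_cons (by simp; omega)]
  congr 2
  · simp
  · omega

section Shifted

variable {D p : ℕ} {f F : MvPolynomial (Fin n) R} {I : List ℕ → List (ℕ × R)} {x : Sample R}
  {h : List (List ℕ × R)}

/-- The interpolation procedure only knows `f`. Since substitution is additive, subtracting the
image of the known terms `h` gives the image of the remainder `F`. -/
theorem shiftedImages_spec (hI : IsInterpolator f I) (hx : x.Valid D F p)
    (hh : ∀ t ∈ h, t.1.length = n) (hF : F = f - termSum n h) (j : ℕ) (hj : j ≤ n) :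
    List.Forall₂ (fun (g : UPoly R) k => Represents g (subst (kronExpShift n D p k) F))
      (shiftedImages I n x h j).val ((List.finRange n).drop (n - j)) := by
  induction j with
  | zero => simp [shiftedImages]
  | succ j ih =>
    rw [drop_finRange hj]
    have hs := shiftAt_kronExp D p (⟨n - (j + 1), by omega⟩ : Fin n)
    simp only [shiftedImages, bind_val, natSub_val, query_val, hx.p_eq, hx.w_eq, ret_val, hs]
    refine List.Forall₂.cons ?_ (ih (by omega))
    have h1 := represents_leaf.addTerms (I (List.ofFn (kronExpShift n D p ⟨n - (j + 1), by omega⟩)))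
    rw [(hI _).sum_eq, zero_add] at h1
    have h2 := h1.subImage (List.ofFn (kronExpShift n D p ⟨n - (j + 1), by omega⟩)) h
    rwa [← subst_termSum _ hh, ← subst_sub, ← hF] at h2

theorem shiftedImages_asks (hx : x.Valid D F p) (P : List ℕ → Prop)
    (hP : ∀ k, P (List.ofFn (kronExpShift n D p k))) (j : ℕ) (hj : j ≤ n) :
    (shiftedImages I n x h j).Asks P := by
  induction j with
  | zero => simp [shiftedImages, Asks, tick]
  | succ j ih =>
    have ih' := ih (by omega)
    have hs := shiftAt_kronExp D p (⟨n - (j + 1), by omega⟩ : Fin n)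
    intro e he
    simp only [shiftedImages, bind_queries, natSub_val, shiftAt_queries, addTerms_queries,
      subImage_queries, hx.p_eq, hx.w_eq, hs, ret_queries, List.nil_append, List.append_nil,
      List.mem_append] at he
    rcases he with he | he | he
    · simp [natSub] at he
    · simp only [query, List.mem_singleton] at he
      rw [he]; exact hP _
    · exact ih' e he

theorem shiftedImages_within {T K L m i : ℕ} (b : Bounds n T D K L m) (hi : i ≤ K)
    (hD : LowDegreePoly D f) (hT : f.support.card ≤ T) (hI : IsInterpolator f I)
    (hx : x.Valid D F (prm i)) (hh : LowDegreeTerms n D h) (hhT : h.length ≤ T) (j : ℕ)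
    (hj : j ≤ n) :
    (shiftedImages I n x h j).Within (j * (5 * T)) (j * (22 * (n * T * L * m)) + 1) j := by
  induction j with
  | zero => exact (tick_ret_within 1 _).mono (by simp) (by simp) le_rfl
  | succ j ih =>
    have hp := (prm_prime i).pos
    have hpm : len (prm i) ≤ m := b.len_of_le_two_prm hi (by omega)
    set k : Fin n := ⟨n - (j + 1), by omega⟩ with hk
    have hs := shiftAt_kronExp D (prm i) k
    have hle : ∀ i', kronExpShift n D (prm i) k i' ≤ 2 * prm i := kronExpShift_le D hp k
    have hle' : ∀ y ∈ List.ofFn (kronExp n D (prm i)), len y ≤ m := by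
      intro y hy
      obtain ⟨i', rfl⟩ := (List.mem_ofFn' _ _).1 hy
      exact b.len_of_le_two_prm hi ((kronExp_le D hp i').trans (by omega))
    have hw : ∀ y ∈ List.ofFn (kronExpShift n D (prm i) k), len y ≤ m := by
      intro y hy
      obtain ⟨i', rfl⟩ := (List.mem_ofFn' _ _).1 hy
      exact b.len_of_le_two_prm hi (hle i')
    have hlen := length_terms_le hT hI (kronExpShift n D (prm i) k)
    have a1 : (natSub n (j + 1)).Within 0 (m + m) 0 :=
      natSub_within b.len_n ((len_mono hj).trans b.len_n)
    have a2 : (shiftAt x.p (natSub n (j + 1)).val x.w).Within 0 (n * m + 2 * m + 1) 0 := by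
      rw [hx.p_eq, hx.w_eq]
      simpa using shiftAt_within hpm _ hle' (n - (j + 1)) ((len_mono (by omega)).trans b.len_n)
    have hv : (shiftAt x.p (natSub n (j + 1)).val x.w).val =
        List.ofFn (kronExpShift n D (prm i) k) := by
      rw [hx.p_eq, hx.w_eq]; exact hs
    have a3 := query_within I (e := kronExpShift n D (prm i) k) (m := m)
      fun i' => b.len_of_le_two_prm hi (hle i')
    have a4 := addTerms_within _ Trie.leaf (b.len_term hi hD hI hle)
    have a5 := subImage_within b.n_pos b.m_pos hw (b.imageBounds hi hh hle)
      (addTerms (I (List.ofFn (kronExpShift n D (prm i) k))) Trie.leaf).val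
    rw [← hv] at a3 a4 a5
    refine Within.mono (a1.bind (a2.bind (a3.bind (a4.bind (a5.bind
      ((ih (by omega)).bind (Within.ret _))))))) ?_ ?_ ?_
    · rw [hv, add_mul]; omega
    · have hn := b.n_pos
      have hT0 := b.T_pos
      have hm := b.m_pos
      have hL := b.L_pos
      rw [hv, add_mul]
      set l := (I (List.ofFn (kronExpShift n D (prm i) k))).length
      have g1 : l * (2 * L + 1) ≤ T * (2 * L + 1) := Nat.mul_le_mul_right _ hlen
      have g2 : h.length * (8 * (n * L * m)) ≤ T * (8 * (n * L * m)) := Nat.mul_le_mul_right _ hhT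
      have e1 : T * (2 * L + 1) = 2 * (T * L) + T := by ring
      have e2 : T * (8 * (n * L * m)) = 8 * (n * T * L * m) := by ring
      have q1 : m ≤ n * T * L * m := le_of_mul_eq (n * T * L) (by positivity) (by ring)
      have q2 : n * m ≤ n * T * L * m := le_of_mul_eq (T * L) (by positivity) (by ring)
      have q3 : T * L ≤ n * T * L * m := le_of_mul_eq (n * m) (by positivity) (by ring)
      have q4 : T ≤ n * T * L * m := le_of_mul_eq (n * L * m) (by positivity) (by ring)
      have q5 : 1 ≤ n * T * L * m := Nat.succ_le_of_lt (by positivity)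
      omega
    · omega

theorem shiftedImages_nodes {T K L m i : ℕ} (b : Bounds n T D K L m) (hi : i ≤ K)
    (hD : LowDegreePoly D f) (hT : f.support.card ≤ T) (hI : IsInterpolator f I)
    (hx : x.Valid D F (prm i)) (hh : LowDegreeTerms n D h) (hhT : h.length ≤ T) (j : ℕ)
    (hj : j ≤ n) : ∀ g ∈ (shiftedImages I n x h j).val, g.nodes ≤ 5 * (T * L) := by
  induction j with
  | zero => simp [shiftedImages]
  | succ j ih =>
    have hp := (prm_prime i).pos
    set k : Fin n := ⟨n - (j + 1), by omega⟩ with hk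
    have hs : (shiftAt (prm i) (n - (j + 1)) (List.ofFn (kronExp n D (prm i)))).val =
      List.ofFn (kronExpShift n D (prm i) k) := shiftAt_kronExp D (prm i) k
    have hle : ∀ i', kronExpShift n D (prm i) k i' ≤ 2 * prm i := kronExpShift_le D hp k
    simp only [shiftedImages, bind_val, natSub_val, query_val, hx.p_eq, hx.w_eq, ret_val, hs]
    intro g hg
    rcases List.mem_cons.1 hg with rfl | hg
    · have h1 := nodes_addTerms _ Trie.leaf (b.len_term hi hD hI hle)
      have h2 := nodes_subImage (b.imageBounds hi hh hle)
        (addTerms (I (List.ofFn (kronExpShift n D (prm i) k))) Trie.leaf).val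
      have h3 := Nat.mul_le_mul_left (2 * L) (length_terms_le hT hI (kronExpShift n D (prm i) k))
      have h4 := Nat.mul_le_mul_left (2 * L) hhT
      have h5 : 2 * L * T = 2 * (T * L) := by ring
      have h6 : 1 ≤ T * L := Nat.mul_pos b.T_pos b.L_pos
      have h7 : (Trie.leaf : UPoly R).nodes = 1 := rfl
      omega
    · exact ih (by omega) g hg

end Shifted

end Samples

section Candidates

variable {R : Type u} [CommRing R] [DecidableEq R] {n : ℕ}

/-! ## Blocks -/

/-- The part of `g` with exponents congruent to `d` modulo `p` is the single term `a x ^ e`. -/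
structure Lone (p : ℕ) (g : Polynomial R) (d e : ℕ) (a : R) : Prop where
  mod_eq : e % p = d
  coeff_eq : g.coeff e = a
  ne_zero : a ≠ 0
  unique : ∀ e', g.coeff e' ≠ 0 → e' % p = d → e' = e

theorem Lone.mem_support {p : ℕ} {g : Polynomial R} {d e : ℕ} {a : R} (h : Lone p g d e a) :
    e ∈ g.support := by
  rw [Polynomial.mem_support_iff, h.coeff_eq]; exact h.ne_zero

/-- An isolated monomial is alone in its block. -/
theorem lone_of_isolated {D p : ℕ} {F : MvPolynomial (Fin n) R} {s : Fin n →₀ ℕ}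
    (hs : s ∈ isolated F.support fun s => kron D s % p) {e : Fin n → ℕ}
    (he : ∀ v, expDot e v % p = kron D v % p) :
    Lone p (subst e F) (kron D s % p) (expDot e s) (F.coeff s) := by
  obtain ⟨h1, h2⟩ := mem_isolated_iff.1 hs
  have key : ∀ v ∈ F.support, expDot e v % p = kron D s % p → v = s := by
    intro v hv hvs
    by_contra hne
    exact h2 v hv hne (by rw [← he, hvs])
  refine ⟨he s, ?_, MvPolynomial.mem_support_iff.1 h1, ?_⟩
  · rw [coeff_subst]
    refine Finset.sum_eq_single_of_mem s (Finset.mem_filter.2 ⟨h1, rfl⟩) ?_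
    intro v hv hne
    obtain ⟨hv, hvs⟩ := Finset.mem_filter.1 hv
    exact absurd (key v hv (by rw [hvs, he])) hne
  · intro e' he' hmod
    obtain ⟨v, hv, rfl⟩ := exists_of_mem_support_subst (Polynomial.mem_support_iff.2 he')
    rw [key v hv hmod]

/-- The effect of one more term on the entry of a block. -/
def blockStep (o : Option ((ℕ × R) × Bool)) (t : ℕ × R) : Option ((ℕ × R) × Bool) :=
  match o with
  | none => some (t, true)
  | some (t', _) => some (t', false)

theorem foldl_blockStep_some (t : ℕ × R) (b : Bool) (l : List (ℕ × R)) :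
    l.foldl blockStep (some (t, b)) = some (t, b && l.isEmpty) := by
  induction l generalizing b with
  | nil => simp
  | cons a l ih => simp [blockStep, ih]

/-- The first term is kept forever, and its flag survives only if no second term arrives; so the
flag detects blocks of exactly one term. -/
theorem foldl_blockStep_eq_iff (l : List (ℕ × R)) (t : ℕ × R) :
    l.foldl blockStep none = some (t, true) ↔ l = [t] := by
  cases l with
  | nil => simp
  | cons a l =>
    simp only [List.foldl_cons, blockStep, foldl_blockStep_some]
    simp

theorem get_fillBlocks (p : ℕ) (l : List (ℕ × R)) (B : Trie ((ℕ × R) × Bool)) (d : ℕ) :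
    (fillBlocks p l B).val.get d.bits =
      (l.filter fun t => t.1 % p = d).foldl blockStep (B.get d.bits) := by
  induction l generalizing B with
  | nil => rfl
  | cons t l ih =>
    obtain ⟨e, c⟩ := t
    simp only [fillBlocks, bind_val, natMod_val, natBits_val, ih, Trie.get_alter]
    by_cases h : e % p = d
    · subst h
      simp only [if_true, List.filter_cons, decide_true, List.foldl_cons]
      congr 1
      cases B.get (e % p).bits <;> rfl
    · have : ¬ d.bits = (e % p).bits := fun hh => h (bits_injective hh).symm
      simp [this, h]

/-- The dictionary `B` allows to find the blocks of `g` that are single terms. -/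
def HasBlocks (p : ℕ) (B : Trie ((ℕ × R) × Bool)) (g : Polynomial R) : Prop :=
  ∀ d e a, B.get d.bits = some ((e, a), true) ↔ Lone p g d e a

theorem Represents.hasBlocks {t : UPoly R} {g : Polynomial R} (h : Represents t g) (p : ℕ) :
    HasBlocks p (blocks p t).val g := by
  intro d e a
  obtain ⟨h1, h2⟩ := h.isUniTerms
  rw [blocks, bind_val, get_fillBlocks, Trie.get_leaf, foldl_blockStep_eq_iff]
  set l := (t.values []).val
  have hmem : ∀ e' c, (e', c) ∈ l.filter (fun t => decide (t.1 % p = d)) ↔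
      (c ≠ 0 ∧ g.coeff e' = c) ∧ e' % p = d := by
    intro e' c
    rw [List.mem_filter, h2, decide_eq_true_eq]
  constructor
  · intro hl
    rw [hl] at hmem
    obtain ⟨⟨g1, g2⟩, g3⟩ := (hmem e a).1 (by simp)
    refine ⟨g3, g2, g1, fun e' he' hd => ?_⟩
    have := (hmem e' _).2 ⟨⟨he', rfl⟩, hd⟩
    simp only [List.mem_singleton, Prod.mk.injEq] at this
    exact this.1
  · intro hl
    have hnd : (l.filter fun t => decide (t.1 % p = d)).Nodup :=
      (List.Nodup.of_map _ h1).filter _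
    have hall : ∀ x ∈ l.filter (fun t => decide (t.1 % p = d)), x = (e, a) := by
      rintro ⟨e', c⟩ hx
      obtain ⟨⟨g1, g2⟩, g3⟩ := (hmem e' c).1 hx
      have := hl.unique e' (by rw [g2]; exact g1) g3
      subst this
      rw [← g2, hl.coeff_eq]
    have hin : (e, a) ∈ l.filter (fun t => decide (t.1 % p = d)) :=
      (hmem e a).2 ⟨⟨hl.ne_zero, hl.coeff_eq⟩, hl.mod_eq⟩
    generalize l.filter (fun t => decide (t.1 % p = d)) = l' at hnd hall hin
    match l', hnd, hall, hin with
    | [x], _, hall, _ => rw [hall x (by simp)]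
    | x :: y :: _, hnd, hall, _ =>
      have h3 := hall x (by simp)
      have h4 := hall y (by simp)
      rw [h3, h4] at hnd
      simp at hnd

theorem fillBlocks_within {p m L : ℕ} (hp : 0 < p) (hm : len p ≤ m) (l : List (ℕ × R))
    (hl : ∀ x ∈ l, len x.1 ≤ L) (B : Trie ((ℕ × R) × Bool)) :
    (fillBlocks p l B).Within 0 (l.length * (4 * (L * m)) + 1) 0 := by
  induction l generalizing B with
  | nil => exact (tick_ret_within 1 _).mono (by simp) (by simp) le_rfl
  | cons t l ih =>
    obtain ⟨e, c⟩ := t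
    have hr : len (e % p) ≤ m := len_mod_le hp hm
    have hm1 : 1 ≤ m := (one_le_len _).trans hm
    have hL1 : 1 ≤ L := (one_le_len _).trans (hl _ (List.mem_cons_self))
    refine Within.mono ((tick_within 1).bind ((natMod_within (hl _ (List.mem_cons_self)) hm).bind
      ((natBits_within hr).bind ((Trie.alter_within (r := 0) (b := 0) ?_ B _).bind
      (ih (fun x hx => hl x (by simp [hx])) _))))) le_rfl ?_ le_rfl
    · rintro (_ | ⟨_, _⟩) <;> exact Within.ret _
    · have h1 := bits_length (e % p)
      have h2 : 1 ≤ L * m := Nat.mul_pos hL1 hm1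
      have h3 : m ≤ L * m := Nat.le_mul_of_pos_left m hL1
      simp only [natBits_val, List.length_cons, add_mul]
      omega

theorem blocks_within {p m L T : ℕ} (hp : 0 < p) (hm : len p ≤ m) (hL : 0 < L)
    {t : UPoly R} {g : Polynomial R}
    (h : Represents t g) (hT : g.support.card ≤ T) (hT0 : 0 < T) (hg : ∀ e ∈ g.support, len e ≤ L)
    (hn : t.nodes ≤ 5 * (T * L)) : (blocks p t).Within 0 (10 * (T * L * m)) 0 := by
  have hmem : ∀ x ∈ (t.values []).val, len x.1 ≤ L := by
    rintro ⟨e, c⟩ hx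
    have := (h.isUniTerms.2 e c).1 hx
    refine hg e (Polynomial.mem_support_iff.2 ?_)
    rw [this.2]; exact this.1
  have hm1 : 0 < m := (one_le_len _).trans hm
  refine Within.mono ((Trie.values_within t []).bind
    (fillBlocks_within hp hm _ hmem Trie.leaf)) le_rfl ?_ le_rfl
  rw [h.values_length]
  have h1 : g.support.card * (4 * (L * m)) ≤ T * (4 * (L * m)) := Nat.mul_le_mul_right _ hT
  have h2 : T * (4 * (L * m)) = 4 * (T * L * m) := by ring
  have h3 : T * L ≤ T * L * m := Nat.le_mul_of_pos_right _ hm1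
  have h4 : 1 ≤ T * L * m := Nat.succ_le_of_lt (by positivity)
  omega

theorem blocksList_val (p : ℕ) (ts : List (UPoly R)) :
    (blocksList p ts).val = ts.map fun t => (blocks p t).val := by
  induction ts with
  | nil => rfl
  | cons t ts ih => simp [blocksList, ih]

theorem blocksList_within {p B : ℕ} (ts : List (UPoly R))
    (h : ∀ t ∈ ts, (blocks p t).Within 0 B 0) :
    (blocksList p ts).Within 0 (ts.length * (B + 1) + 1) 0 := by
  induction ts with
  | nil => exact (tick_ret_within 1 _).mono (by simp) (by simp) le_rfl
  | cons t ts ih =>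
    refine Within.mono ((tick_within 1).bind ((h t (by simp)).bind
      ((ih fun x hx => h x (by simp [hx])).bind (Within.ret _)))) le_rfl ?_ le_rfl
    rw [List.length_cons, add_mul]; omega

/-! ## Candidates -/

theorem singleExponent_val {p : ℕ} {B : Trie ((ℕ × R) × Bool)} {g : Polynomial R}
    (h : HasBlocks p B g) (d e : ℕ) (a : R) :
    (singleExponent B d a).val = some e ↔ Lone p g d e a := by
  rw [← h]
  simp only [singleExponent, bind_val, natBits_val, Trie.find_val]
  rcases B.get d.bits with _ | ⟨⟨e', c⟩, _ | _⟩
  · simp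
  · simp
  · simp only [bind_val, ringEq_val, decide_eq_true_eq, ret_val]
    split_ifs with hc
    · simp [hc]
    · simp [hc]

theorem singleExponent_within (B : Trie ((ℕ × R) × Bool)) {d m : ℕ} (hd : len d ≤ m) (a : R) :
    (singleExponent B d a).Within 1 (2 * m) 0 := by
  refine Within.mono ((natBits_within hd).bind ((Trie.find_within _ _).bind
    (r' := 1) (b' := 0) (q' := 0) ?_)) (by simp) ?_ le_rfl
  · rcases (B.find (natBits d).val).val with _ | ⟨⟨e', c⟩, _ | _⟩
    · exact (Within.ret _).mono (Nat.zero_le _) le_rfl le_rfl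
    · exact (Within.ret _).mono (Nat.zero_le _) le_rfl le_rfl
    · exact Within.mono (Within.bind (ringEq_within _ _) (Within.ret _)) le_rfl le_rfl le_rfl
  · have := bits_length d
    simp only [natBits_val]; omega

/-- A lone exponent in a block is unique, so `β` is determined by `B` and `d`. The order and
divisibility tests succeed exactly if it has the form `γ + e * p`, and then `e` is unique too. -/
theorem recoverExponents_val {p γ d : ℕ} (hp : 0 < p) {a : R} {Bs : List (Trie ((ℕ × R) × Bool))}
    {gs : List (Polynomial R)} (h : List.Forall₂ (HasBlocks p) Bs gs) (es : List ℕ) :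
    (recoverExponents p γ d a Bs).val = some es ↔
      List.Forall₂ (fun g e => Lone p g d (γ + e * p) a) gs es := by
  induction h generalizing es with
  | nil => cases es <;> simp [recoverExponents]
  | @cons B g Bs gs hB _ ih =>
    simp only [recoverExponents, bind_val]
    rcases hs : (singleExponent B d a).val with _ | β
    · simp only [ret_val, reduceCtorEq, false_iff]
      intro hf
      cases hf with
      | cons h1 _ => rw [(singleExponent_val hB d _ a).2 h1] at hs; cases hs
    · have hβ := (singleExponent_val hB d β a).1 hs
      have huniq : ∀ β', Lone p g d β' a → β' = β := fun β' h' =>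
        hβ.unique β' (Polynomial.mem_support_iff.1 h'.mem_support) h'.mod_eq
      simp only [bind_val, natLe_val, decide_eq_true_eq]
      split_ifs with hle
      · simp only [bind_val, natSub_val, natMod_val, natEq_val, decide_eq_true_eq]
        split_ifs with hz
        · have hβe : γ + (β - γ) / p * p = β := by
            rw [Nat.div_mul_cancel (Nat.dvd_of_mod_eq_zero hz)]; omega
          simp only [bind_val, natDiv_val]
          rcases ho : (recoverExponents p γ d a Bs).val with _ | es'
          · simp only [ret_val, reduceCtorEq, false_iff]
            intro hf
            cases hf with
            | cons _ h2 => rw [(ih _).2 h2] at ho; cases ho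
          · simp only [ret_val, Option.some.injEq]
            constructor
            · rintro rfl
              refine List.Forall₂.cons (by rw [hβe]; exact hβ) ((ih es').1 ho)
            · intro hf
              cases hf with
              | @cons _ e _ es'' h1 h2 =>
                have h3 := (ih _).2 h2
                rw [ho] at h3
                injection h3 with h3
                rw [h3]
                congr 1
                have h4 := huniq _ h1
                rw [← h4, Nat.add_sub_cancel_left, Nat.mul_div_cancel _ hp]
        · simp only [ret_val, reduceCtorEq, false_iff]
          intro hf
          cases hf with
          | @cons _ e _ es'' h1 h2 =>
            have h4 := huniq _ h1
            rw [← h4, Nat.add_sub_cancel_left, Nat.mul_mod_left] at hz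
            exact hz rfl
      · simp only [ret_val, reduceCtorEq, false_iff]
        intro hf
        cases hf with
        | cons h1 _ =>
          have := huniq _ h1
          omega

theorem recoverExponents_within {p γ d m L : ℕ} (hp : 0 < p) (hpm : len p ≤ m) (hd : len d ≤ m)
    (hγ : len γ ≤ L) {a : R} {Bs : List (Trie ((ℕ × R) × Bool))} {gs : List (Polynomial R)}
    (h : List.Forall₂ (HasBlocks p) Bs gs) (hgs : ∀ g ∈ gs, ∀ e ∈ g.support, len e ≤ L) :
    (recoverExponents p γ d a Bs).Within Bs.length (Bs.length * (12 * (L * m)) + 1) 0 := by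
  have hm1 : 1 ≤ m := (one_le_len _).trans hpm
  have hL1 : 1 ≤ L := (one_le_len _).trans hγ
  induction h with
  | nil => exact (tick_ret_within 1 _).mono (by simp) (by simp) le_rfl
  | @cons B g Bs gs hB _ ih =>
    have ih' := ih fun g hg => hgs g (by simp [hg])
    refine Within.mono ((tick_within 1).bind ((singleExponent_within B hd a).bind
      (r' := Bs.length) (q' := 0)
      (b' := 4 * L + 2 * (L * m) + (m + 1) + (Bs.length * (12 * (L * m)) + 1)) ?_)) ?_ ?_ le_rfl
    · rcases hs : (singleExponent B d a).val with _ | β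
      · exact (Within.ret _).mono (Nat.zero_le _) (Nat.zero_le _) le_rfl
      · have hβ : len β ≤ L :=
          hgs g (by simp) β ((singleExponent_val hB d β a).1 hs).mem_support
        have hδ : len (β - γ) ≤ L := (len_mono (Nat.sub_le _ _)).trans hβ
        have inner : ∀ e, ((recoverExponents p γ d a Bs).bind fun o' =>
            match o' with
            | none => ret none
            | some es => ret (some (e :: es))).Within Bs.length
              (Bs.length * (12 * (L * m)) + 1) 0 := by
          intro e
          refine Within.mono (ih'.bind (r' := 0) (b' := 0) (q' := 0) ?_) le_rfl le_rfl le_rfl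
          cases (recoverExponents p γ d a Bs).val <;> exact Within.ret _
        have c3 : ∀ z : Bool, (if z = true then (natDiv (β - γ) p).bind fun e =>
            (recoverExponents p γ d a Bs).bind fun o' =>
            match o' with
            | none => ret none
            | some es => ret (some (e :: es))
            else ret none).Within Bs.length (L * m + (Bs.length * (12 * (L * m)) + 1)) 0 := by
          intro z
          refine Within.ite (fun _ => ?_) fun _ => (Within.ret _).mono (Nat.zero_le _)
            (Nat.zero_le _) le_rfl
          exact Within.mono ((natDiv_within hδ hpm).bind (inner _)) (by simp) le_rfl le_rfl
        have c4 : ∀ z : Bool, (if z = true then (natSub β γ).bind fun δ =>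
            (natMod δ p).bind fun r =>
            (natEq r 0).bind fun z =>
            if z = true then (natDiv δ p).bind fun e =>
            (recoverExponents p γ d a Bs).bind fun o' =>
            match o' with
            | none => ret none
            | some es => ret (some (e :: es))
            else ret none
            else ret none).Within Bs.length
              (2 * L + 2 * (L * m) + (m + 1) + (Bs.length * (12 * (L * m)) + 1)) 0 := by
          intro z
          refine Within.ite (fun _ => ?_) fun _ => (Within.ret _).mono (Nat.zero_le _)
            (Nat.zero_le _) le_rfl
          refine Within.mono ((natSub_within hβ hγ).bind ((natMod_within hδ hpm).bind
            ((natEq_within (len_mod_le hp hpm) len_zero.le).bind (c3 _)))) (by simp) ?_ le_rfl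
          omega
        refine Within.mono (Within.bind (natLe_within hγ hβ) (c4 _)) (by simp) ?_ le_rfl
        omega
    · rw [List.length_cons]; omega
    · have h1 : 1 ≤ L * m := Nat.mul_pos hL1 hm1
      have h2 : m ≤ L * m := Nat.le_mul_of_pos_left m hL1
      have h3 : L ≤ L * m := Nat.le_mul_of_pos_right L hm1
      rw [List.length_cons, add_mul]; omega

section Candidate

variable {D p : ℕ} {w : List ℕ} {B : Trie ((ℕ × R) × Bool)} {g : Polynomial R}
  {Bs : List (Trie ((ℕ × R) × Bool))} {gs : List (Polynomial R)}

/-- The intermediate `γ` disappears: the check against the scalar product forces it to equal `dotp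
u.1 w`, and uniqueness in the block gives the converse. -/
theorem candidate_val (hp : 0 < p) (hB : HasBlocks p B g)
    (hBs : List.Forall₂ (HasBlocks p) Bs gs) (d : ℕ) (a : R) (u : List ℕ × R) :
    (candidate D p w B Bs d a).val = some u ↔
      Lone p g d (dotp u.1 w) a ∧
      List.Forall₂ (fun g e => Lone p g d (dotp u.1 w + e * p) a) gs u.1 ∧ u.1.sum < D ∧
      u.2 = a := by
  obtain ⟨us, c⟩ := u
  simp only [candidate, bind_val]
  rcases hs : (singleExponent B d a).val with _ | γ
  · simp only [ret_val, reduceCtorEq, false_iff]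
    rintro ⟨h1, _⟩
    rw [(singleExponent_val hB d _ a).2 h1] at hs
    cases hs
  · have hγ := (singleExponent_val hB d γ a).1 hs
    simp only [bind_val]
    rcases ho : (recoverExponents p γ d a Bs).val with _ | es
    · simp only [ret_val, reduceCtorEq, false_iff]
      rintro ⟨h1, h2, _⟩
      rw [hγ.unique _ (Polynomial.mem_support_iff.1 h1.mem_support) h1.mod_eq] at h2
      rw [(recoverExponents_val hp hBs _).2 h2] at ho
      cases ho
    · have hes := (recoverExponents_val hp hBs es).1 ho
      simp only [bind_val, dot_val, natEq_val, decide_eq_true_eq]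
      constructor
      · intro h
        split_ifs at h with h1
        · simp only [bind_val, sumList_val, natLt_val, decide_eq_true_eq, ret_val] at h
          split_ifs at h with h2
          · simp only [Option.some.injEq, Prod.mk.injEq] at h
            obtain ⟨rfl, rfl⟩ := h
            simp only
            rw [h1]
            exact ⟨hγ, hes, h2, trivial⟩
        · simp at h
      · rintro ⟨h1, h2, h3, h4⟩
        have h5 := hγ.unique _ (Polynomial.mem_support_iff.1 h1.mem_support) h1.mod_eq
        rw [h5] at h2
        have h6 := (recoverExponents_val hp hBs _).2 h2
        rw [ho] at h6
        injection h6 with h6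
        subst h6
        simp [h5, h3, h4]

theorem candidates_val (l : List (ℕ × R)) :
    (candidates D p w B Bs l).val = l.filterMap fun t => (candidate D p w B Bs t.1 t.2).val := by
  induction l with
  | nil => rfl
  | cons t l ih =>
    obtain ⟨d, a⟩ := t
    simp only [candidates, bind_val, ih, List.filterMap_cons]
    rcases (candidate D p w B Bs d a).val with _ | u <;> simp

/-- The scalar product and the sum are computed before the degree test. The sizes of recovered
exponents can therefore only rest on `e * p ≤ β` for an exponent `β` that occurs; `hsum` expresses
this. -/
theorem candidate_within {m L : ℕ} (hn : 0 < n) (hp : 0 < p) (hpm : len p ≤ m)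
    (hB : HasBlocks p B g) (hBs : List.Forall₂ (HasBlocks p) Bs gs) (hlen : Bs.length = n)
    (hw : ∀ x ∈ w, len x ≤ m) (hwlen : w.length = n) (hg : ∀ e ∈ g.support, len e ≤ L)
    (hgs : ∀ g ∈ gs, ∀ e ∈ g.support, len e ≤ L) (hD : len D ≤ L)
    (hsum : ∀ es : List ℕ, es.length = n → (∀ e ∈ es, ∃ g ∈ gs, ∃ β ∈ g.support, e * p ≤ β) →
      len es.sum ≤ L ∧ len (dotp es w) ≤ L) {d : ℕ} (hd : len d ≤ m) (a : R) :
    (candidate D p w B Bs d a).Within (2 * n) (30 * (n * L * m)) 0 := by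
  have hm1 : 0 < m := (one_le_len _).trans hpm
  have hL1 : 0 < L := (one_le_len _).trans hD
  refine Within.mono ((singleExponent_within B hd a).bind
    (r' := n) (b' := n * (12 * (L * m)) + 1 + (n * (4 * L * m) + 1 + (2 * L + (n * (2 * L + 1) + 1
      + 2 * L)))) (q' := 0) ?_) ?_ ?_ le_rfl
  · rcases hs : (singleExponent B d a).val with _ | γ
    · exact (Within.ret _).mono (Nat.zero_le _) (Nat.zero_le _) le_rfl
    · have hγ := (singleExponent_val hB d γ a).1 hs
      have hγL := hg γ hγ.mem_support
      have h1 := recoverExponents_within (a := a) hp hpm hd hγL hBs hgs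
      rw [hlen] at h1
      refine Within.mono (Within.bind h1 (r' := 0) (b' := n * (4 * L * m) + 1 +
        (2 * L + (n * (2 * L + 1) + 1 + 2 * L))) (q' := 0) ?_) le_rfl le_rfl le_rfl
      rcases ho : (recoverExponents p γ d a Bs).val with _ | es
      · exact (Within.ret _).mono (Nat.zero_le _) (Nat.zero_le _) le_rfl
      · have hes := (recoverExponents_val hp hBs es).1 ho
        have heslen : es.length = n := by
          rw [← hes.length_eq, ← hBs.length_eq, hlen]
        have hmem : ∀ e ∈ es, ∃ g ∈ gs, ∃ β ∈ g.support, e * p ≤ β := by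
          clear ho h1 hlen hBs heslen hgs hsum
          induction hes with
          | nil => simp
          | @cons g e gs es hge _ ih =>
            intro e' he'
            rcases List.mem_cons.1 he' with rfl | he'
            · exact ⟨g, by simp, _, hge.mem_support, by omega⟩
            · obtain ⟨g', hg', h⟩ := ih e' he'
              exact ⟨g', by simp [hg'], h⟩
        obtain ⟨h2, h3⟩ := hsum es heslen hmem
        have hent : ∀ e ∈ es, len e ≤ L := fun e he =>
          (len_mono (List.single_le_sum (fun _ _ => Nat.zero_le _) e he)).trans h2
        have h4 := dot_within es w hent hw h3
        rw [heslen] at h4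
        have h5 := sumList_within es h2
        rw [heslen] at h5
        refine Within.mono (Within.bind h4 (Within.bind (natEq_within (l := L) (m := L)
          (by rw [dot_val]; exact h3) hγL)
          (Within.ite (fun _ => Within.bind h5 (Within.bind (natLt_within (by simpa using h2) hD)
          (Within.ret _))) fun _ => (Within.ret _).mono (Nat.zero_le _) (Nat.zero_le _) le_rfl)))
          le_rfl ?_ le_rfl
        omega
  · omega
  · obtain ⟨h1, h2, h3, h4, h5, h6, h7⟩ := le_mul_mul hn hL1 hm1
    have e1 : n * (12 * (L * m)) = 12 * (n * L * m) := by ring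
    have e2 : n * (4 * L * m) = 4 * (n * L * m) := by ring
    have e3 : n * (2 * L + 1) = 2 * (n * L) + n := by ring
    omega

theorem candidates_within {r b : ℕ} (l : List (ℕ × R))
    (h : ∀ t ∈ l, (candidate D p w B Bs t.1 t.2).Within r b 0) :
    (candidates D p w B Bs l).Within (l.length * r) (l.length * (b + 1) + 1) 0 := by
  induction l with
  | nil => exact (tick_ret_within 1 _).mono (by simp) (by simp) le_rfl
  | cons t l ih =>
    refine Within.mono ((tick_within 1).bind ((h t (by simp)).bind
      ((ih fun x hx => h x (by simp [hx])).bind (r' := 0) (b' := 0) (q' := 0) ?_))) ?_ ?_ le_rfl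
    · cases (candidate D p w B Bs t.1 t.2).val <;> exact Within.ret _
    · rw [List.length_cons, add_mul]; omega
    · rw [List.length_cons, add_mul]; omega

end Candidate

section TsTerms

variable {D p : ℕ} {F : MvPolynomial (Fin n) R} {x : Sample R} {gs : List (UPoly R)}

/-- The subroutine `TSTerms` returns terms of degree less than `D`, with distinct exponents, and
finds all isolated terms. -/
theorem tsTerms_spec (hp : 0 < p) (hx : x.Valid D F p)
    (hgs : List.Forall₂ (fun (g : UPoly R) k => Represents g (subst (kronExpShift n D p k) F)) gs
      (List.finRange n)) (hF : LowDegreePoly D F) :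
    LowDegreeTerms n D (tsTerms D x gs).val ∧ (∀ u ∈ (tsTerms D x gs).val, u.2 ≠ 0) ∧
    ((tsTerms D x gs).val.map Prod.fst).Nodup ∧
    ∀ s ∈ isolated F.support (fun s => kron D s % p),
      (List.ofFn s, F.coeff s) ∈ (tsTerms D x gs).val := by
  have hB : HasBlocks p (blocks p x.poly).val (subst (kronExp n D p) F) := hx.poly.hasBlocks p
  have hBs : List.Forall₂ (HasBlocks p) (blocksList p gs).val
      ((List.finRange n).map fun k => subst (kronExpShift n D p k) F) := by
    rw [blocksList_val, List.forall₂_map_left_iff, List.forall₂_map_right_iff]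
    exact hgs.imp fun g k h => h.hasBlocks p
  obtain ⟨hnd, hmem⟩ := hx.red.isUniTerms
  have hval : (tsTerms D x gs).val = ((x.red.values []).val).filterMap fun t =>
      (candidate D p x.w (blocks p x.poly).val (blocksList p gs).val t.1 t.2).val := by
    simp only [tsTerms, bind_val, candidates_val, hx.p_eq]
  have hiff := fun (d : ℕ) (a : R) (u : List ℕ × R) =>
    candidate_val (D := D) (w := x.w) hp hB hBs d a u
  have hlen : ∀ {d a} {u : List ℕ × R}, (candidate D p x.w (blocks p x.poly).val
      (blocksList p gs).val d a).val = some u → u.1.length = n := by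
    intro d a u h
    have := ((hiff d a u).1 h).2.1.length_eq
    simpa using this.symm
  rw [hval]
  refine ⟨?_, ?_, ?_, ?_⟩
  · intro u hu
    obtain ⟨⟨d, a⟩, _, h⟩ := List.mem_filterMap.1 hu
    refine ⟨hlen h, ?_⟩
    rw [LowDegree, ← sum_eq_sum_expVec (hlen h)]
    exact ((hiff d a u).1 h).2.2.1
  · intro u hu
    obtain ⟨⟨d, a⟩, _, h⟩ := List.mem_filterMap.1 hu
    obtain ⟨h1, _, _, h2⟩ := (hiff d a u).1 h
    rw [h2]; exact h1.ne_zero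
  -- A candidate remembers its residue `d` through its scalar product modulo `p`, and every residue
  -- is tried only once; so no exponent vector appears twice.
  · have hd : ∀ {d a} {u : List ℕ × R}, (candidate D p x.w (blocks p x.poly).val
        (blocksList p gs).val d a).val = some u → dotp u.1 x.w % p = d := fun h =>
      ((hiff _ _ _).1 h).1.mod_eq
    revert hnd
    clear hval hmem
    induction (x.red.values []).val with
    | nil => simp
    | cons t l ih =>
      intro hnd
      rw [List.map_cons, List.nodup_cons] at hnd
      have ih' := ih hnd.2
      rw [List.filterMap_cons]
      rcases hc : (candidate D p x.w (blocks p x.poly).val (blocksList p gs).val t.1 t.2).val with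
        _ | u
      · simpa using ih'
      · simp only [List.map_cons, List.nodup_cons]
        refine ⟨?_, ih'⟩
        intro hu
        obtain ⟨u', hu', he⟩ := List.mem_map.1 hu
        obtain ⟨t', ht', h'⟩ := List.mem_filterMap.1 hu'
        refine hnd.1 ?_
        rw [← hd hc, ← he, hd h']
        exact List.mem_map_of_mem ht'
  · intro s hs
    obtain ⟨h1, h2⟩ := mem_isolated_iff.1 hs
    have hdot : dotp (List.ofFn s) x.w = expDot (kronExp n D p) s := by
      rw [hx.w_eq, dotp_eq_expDot _ (by simp), expVec_ofFn]
    refine List.mem_filterMap.2 ⟨(kron D s % p, F.coeff s), ?_, ?_⟩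
    · rw [hmem]
      exact ⟨MvPolynomial.mem_support_iff.1 h1, coeff_redImage_of_forall D p F s h2⟩
    · rw [hiff]
      simp only
      rw [hdot]
      refine ⟨lone_of_isolated hs fun v => expDot_kronExp_mod D p v, ?_, ?_, trivial⟩
      -- The shift moves the lone exponent by `s k * p`, so the recovered list of quotients is
      -- `List.ofFn s`.
      · rw [List.ofFn_eq_map, List.forall₂_map_left_iff, List.forall₂_map_right_iff,
          List.forall₂_same]
        intro k _
        rw [← expDot_kronExpShift]
        exact lone_of_isolated hs fun v => expDot_kronExpShift_mod D p k v
      · have := hF s h1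
        rwa [List.sum_ofFn]

theorem tsTerms_within {T K L m j c : ℕ} (b : Bounds n T D K L m) (hj : j ≤ K)
    (hx : x.Valid D F (prm j))
    (hgs : List.Forall₂ (fun (g : UPoly R) k => Represents g (subst (kronExpShift n D (prm j) k) F))
      gs (List.finRange n)) (hF : LowDegreePoly D F) (hT : F.support.card ≤ T)
    (hc : c ≤ 2 * T) (hsmall : x.Small L m c) (hnodes : ∀ g ∈ gs, g.nodes ≤ 5 * (T * L)) :
    (tsTerms D x gs).Within (2 * (n * T)) (60 * (n * T * L * m)) 0 := by
  set p := prm j with hpdef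
  have hp : 0 < p := (prm_prime j).pos
  have hpm : len p ≤ m := b.len_of_le_two_prm hj (by omega)
  have hn := b.n_pos
  have hT0 := b.T_pos
  have hm := b.m_pos
  have hL := b.L_pos
  have hB : HasBlocks p (blocks p x.poly).val (subst (kronExp n D p) F) := hx.poly.hasBlocks p
  have hBs : List.Forall₂ (HasBlocks p) (blocksList p gs).val
      ((List.finRange n).map fun k => subst (kronExpShift n D p k) F) := by
    rw [blocksList_val, List.forall₂_map_left_iff, List.forall₂_map_right_iff]
    exact hgs.imp fun g k h => h.hasBlocks p
  have hexp : ∀ e : Fin n → ℕ, (∀ i, e i ≤ 2 * p) → ∀ β ∈ (subst e F).support,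
      β ≤ 2 * (D * p) := by
    intro e he β hβ
    obtain ⟨s, hs, rfl⟩ := exists_of_mem_support_subst hβ
    exact (hF s hs).expDot_le he
  have hexpL : ∀ e : Fin n → ℕ, (∀ i, e i ≤ 2 * p) → ∀ β ∈ (subst e F).support, len β ≤ L :=
    fun e he β hβ => b.len_of_le_exp' hj (hexp e he β hβ)
  have hk : ∀ i, kronExp n D p i ≤ 2 * p := fun i => (kronExp_le D hp i).trans (by omega)
  have hgslen : gs.length = n := by simpa using hgs.length_eq
  have h1 : (blocks p x.poly).Within 0 (10 * (T * L * m)) 0 := by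
    refine blocks_within hp hpm hL hx.poly ((card_support_subst_le _ _).trans hT) hT0
      (hexpL _ hk) (hsmall.poly.trans ?_)
    have h1 : 2 * L * c ≤ 2 * L * (2 * T) := Nat.mul_le_mul_left _ hc
    have h2 : 1 ≤ T * L := Nat.mul_pos hT0 hL
    have h3 : 2 * L * (2 * T) = 4 * (T * L) := by ring
    omega
  have h2 : (blocksList p gs).Within 0 (n * (10 * (T * L * m) + 1) + 1) 0 := by
    rw [← hgslen]
    refine blocksList_within gs fun t ht => ?_
    obtain ⟨k, _, hk⟩ : ∃ k ∈ List.finRange n, Represents t (subst (kronExpShift n D p k) F) := by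
      clear hnodes hBs hgslen
      generalize List.finRange n = ks at hgs ⊢
      induction hgs with
      | nil => simp at ht
      | @cons g k gs ks h _ ih =>
        rcases List.mem_cons.1 ht with rfl | ht
        · exact ⟨k, by simp, h⟩
        · obtain ⟨k', h', h''⟩ := ih ht
          exact ⟨k', by simp [h'], h''⟩
    exact blocks_within hp hpm hL hk ((card_support_subst_le _ _).trans hT) hT0
      (hexpL _ (kronExpShift_le D hp k)) (hnodes t ht)
  have h3 : (x.red.values []).Within 0 (5 * (T * m)) 0 := by
    refine (Trie.values_within _ _).mono le_rfl (hsmall.red.trans ?_) le_rfl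
    have h1 : 2 * m * c ≤ 2 * m * (2 * T) := Nat.mul_le_mul_left _ hc
    have h2 : 1 ≤ T * m := Nat.mul_pos hT0 hm
    have h3 : 2 * m * (2 * T) = 4 * (T * m) := by ring
    omega
  have h4 : ∀ t ∈ (x.red.values []).val, (candidate D p x.w (blocks p x.poly).val
      (blocksList p gs).val t.1 t.2).Within (2 * n) (30 * (n * L * m)) 0 := by
    rintro ⟨d, a⟩ ht
    refine candidate_within hn hp hpm hB hBs ?_ ?_ ?_ (hexpL _ hk) ?_ b.len_D ?_ ?_ a
    · rw [blocksList_val, List.length_map, hgslen]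
    · rw [hx.w_eq]
      intro y hy
      obtain ⟨i, rfl⟩ := (List.mem_ofFn' _ _).1 hy
      exact b.len_of_le_two_prm hj (hk i)
    · rw [hx.w_eq, List.length_ofFn]
    · intro g hg
      obtain ⟨k, _, rfl⟩ := List.mem_map.1 hg
      exact hexpL _ (kronExpShift_le D hp k)
    · intro es hes hesβ
      -- All exponents in the shifted images are at most `2 * (D * p)`; dividing by `p` leaves `2 *
      -- D`. Summing over `n` variables leads to the bound `2 * (n * D * p)` behind
      -- `Bounds.len_exp`.
      have hle : ∀ e ∈ es, e ≤ 2 * D := by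
        intro e he
        obtain ⟨g, hg, β, hβ, hle⟩ := hesβ e he
        obtain ⟨k, _, rfl⟩ := List.mem_map.1 hg
        have h5 := hle.trans (hexp _ (kronExpShift_le D hp k) β hβ)
        refine Nat.le_of_mul_le_mul_right (c := p) ?_ hp
        rw [mul_assoc]; exact h5
      have hsum : es.sum ≤ n * (2 * D) := by
        have := List.sum_le_card_nsmul es (2 * D) hle
        rwa [hes, smul_eq_mul] at this
      have hdot : dotp es x.w ≤ n * (2 * D) * p := by
        rw [hx.w_eq, dotp_eq_expDot _ hes]
        refine (expDot_le (fun i => kronExp_le D hp i) _).trans (Nat.mul_le_mul_right _ ?_)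
        rwa [← sum_eq_sum_expVec hes]
      have e1 : n * (2 * D) * p = 2 * (n * D * p) := by ring
      refine ⟨b.len_of_le_exp hj ?_, b.len_of_le_exp hj (hdot.trans e1.le)⟩
      exact (hsum.trans (Nat.le_mul_of_pos_right _ hp)).trans e1.le
    · have := (hx.red.isUniTerms.2 d a).1 ht
      obtain ⟨s, _, hs⟩ := exists_of_mem_support_foldMod (d := d) (p := p) (e := kronExp n D p)
        (f := F) (Polynomial.mem_support_iff.2 (by
          rw [← redImage, this.2]; exact this.1))
      simp only
      rw [← hs]
      exact len_mod_le hp hpm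
  have h5 := candidates_within (D := D) (p := p) (w := x.w) (x.red.values []).val h4
  have h6 : ((x.red.values []).val).length ≤ T := by
    rw [hx.red.values_length]
    exact (card_support_redImage_le D p F).trans hT
  rw [← hx.p_eq] at h1 h2 h5
  refine Within.mono (h1.bind (h2.bind (h3.bind h5))) ?_ ?_ le_rfl
  · have := Nat.mul_le_mul_right (2 * n) h6
    have e1 : T * (2 * n) = 2 * (n * T) := by ring
    omega
  · have g1 := Nat.mul_le_mul_right (30 * (n * L * m) + 1) h6
    have e1 : T * (30 * (n * L * m) + 1) = 30 * (n * T * L * m) + T := by ring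
    have e2 : n * (10 * (T * L * m) + 1) = 10 * (n * T * L * m) + n := by ring
    have q1 : T * L * m ≤ n * T * L * m := le_of_mul_eq n hn (by ring)
    have q2 : n ≤ n * T * L * m := le_of_mul_eq (T * L * m) (by positivity) (by ring)
    have q3 : T * m ≤ n * T * L * m := le_of_mul_eq (n * L) (by positivity) (by ring)
    have q4 : T ≤ n * T * L * m := le_of_mul_eq (n * L * m) (by positivity) (by ring)
    have q5 : 1 ≤ n * T * L * m := Nat.succ_le_of_lt (by positivity)
    omega

end TsTerms

/-! ## The term test -/

section TermTest

variable {D : ℕ} {F : MvPolynomial (Fin n) R}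

/-- Subtracting a nonzero `c` alters a single coefficient and lowers the number of terms only if
that coefficient is `c` itself. The count thus becomes the number of primes occurring in
`termTest_iff`. -/
theorem loweredCount_val {u : List ℕ × R} (hlen : u.1.length = n) (hu : u.2 ≠ 0)
    {xs : List (Sample R)} {js : List ℕ}
    (hxs : List.Forall₂ (fun x j => Sample.Valid D F x (prm j)) xs js) :
    (loweredCount u xs).val = js.countP fun j =>
      (redImage D (prm j) F).coeff (kron D (expVec n u.1) % prm j) = u.2 := by
  induction hxs with
  | nil => rfl
  | @cons x j xs js hx _ ih =>
    have h1 : dotp u.1 x.w % x.p = kron D (expVec n u.1) % prm j := by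
      rw [hx.w_eq, hx.p_eq, dotp_eq_expDot _ hlen, expDot_kronExp_mod]
    simp only [loweredCount, bind_val, dot_val, natMod_val, h1, hx.red.coeffAt_val, ringSub_val,
      ringIsZero_val, ih, List.countP_cons]
    by_cases h2 : (redImage D (prm j) F).coeff (kron D (expVec n u.1) % prm j) = u.2
    · simp [h2, hu]
    · simp [h2, sub_eq_zero]

theorem loweredCount_within {T K L m : ℕ} (b : Bounds n T D K L m) {u : List ℕ × R}
    (hu : LowDegreeTerms n D [u]) {xs : List (Sample R)} {js : List ℕ} (hjs : ∀ j ∈ js, j ≤ K)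
    (hxs : List.Forall₂ (fun x j => Sample.Valid D F x (prm j)) xs js) (hK : xs.length ≤ K) :
    (loweredCount u xs).Within (xs.length * 3) (xs.length * (12 * (n * L * m)) + 1) 0 := by
  induction hxs with
  | nil => exact (tick_ret_within 1 _).mono (by simp) (by simp) le_rfl
  | @cons x j xs js hx _ ih =>
    rw [List.length_cons] at hK
    have hj := hjs j (by simp)
    have hp := (prm_prime j).pos
    have hpm : len (prm j) ≤ m := b.len_of_le_two_prm hj (by omega)
    have hk : ∀ i, kronExp n D (prm j) i ≤ 2 * prm j := fun i =>
      (kronExp_le D hp i).trans (by omega)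
    have hw : ∀ y ∈ x.w, len y ≤ m := by
      rw [hx.w_eq]
      intro y hy
      obtain ⟨i, rfl⟩ := (List.mem_ofFn' _ _).1 hy
      exact b.len_of_le_two_prm hj (hk i)
    have hib : ImageBounds n L x.w [u] := by
      rw [hx.w_eq]
      exact b.imageBounds hj hu hk
    have h1 := hib.dot_within b.n_pos b.m_pos hw (List.mem_singleton.2 rfl)
    have h2 : len (dot u.1 x.w).val ≤ L := by
      rw [dot_val]; exact hib.len_dotp u (by simp)
    have hcount : len (loweredCount u xs).val ≤ m := by
      have : ∀ ys : List (Sample R), (loweredCount u ys).val ≤ ys.length := by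
        intro ys
        induction ys with
        | nil => simp [loweredCount]
        | cons y ys ih =>
          simp only [loweredCount, bind_val, List.length_cons]
          split_ifs
          · simpa using ih
          · simp only [ret_val]; omega
      exact (len_mono ((this xs).trans (by omega))).trans b.len_K
    have hpm' : len x.p ≤ m := by rw [hx.p_eq]; exact hpm
    have hp' : 0 < x.p := by rw [hx.p_eq]; exact hp
    refine Within.mono ((tick_within 1).bind (h1.bind ((natMod_within h2 hpm').bind
      ((coeffAt_within x.red (len_mod_le hp' hpm')).bind ((ringSub_within _ _).bind
      ((ringIsZero_within _).bind ((ringIsZero_within _).bind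
      ((ih (fun j hj => hjs j (by simp [hj])) (by omega)).bind
      (Within.ite (fun _ => natAdd_within hcount len_one.le) fun _ =>
        (Within.ret _).mono le_rfl (Nat.zero_le _) le_rfl))))))))) ?_ ?_ le_rfl
    · rw [List.length_cons, add_mul]; omega
    · obtain ⟨h1, h2, h3, h4, h5, h6, h7⟩ := le_mul_mul b.n_pos b.L_pos b.m_pos
      rw [List.length_cons, add_mul]; omega

theorem selectTerms_val (N₂ : ℕ) (xs : List (Sample R)) (us : List (List ℕ × R)) :
    (selectTerms N₂ xs us).val = us.filter fun u => N₂ ≤ (loweredCount u xs).val := by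
  induction us with
  | nil => rfl
  | cons u us ih => simp [selectTerms, ih, List.filter_cons]

theorem selectTerms_within {T K L m N₂ : ℕ} (b : Bounds n T D K L m) (hN₂ : N₂ ≤ K)
    {us : List (List ℕ × R)} (hus : LowDegreeTerms n D us) {xs : List (Sample R)} {js : List ℕ}
    (hjs : ∀ j ∈ js, j ≤ K)
    (hxs : List.Forall₂ (fun x j => Sample.Valid D F x (prm j)) xs js) (hK : xs.length ≤ K)
    (hK0 : 0 < K) :
    (selectTerms N₂ xs us).Within (us.length * (3 * K))
      (us.length * (16 * (K * (n * L * m))) + 1) 0 := by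
  induction us with
  | nil => exact (tick_ret_within 1 _).mono (by simp) (by simp) le_rfl
  | cons u us ih =>
    have h1 := loweredCount_within b (u := u) (fun t ht => hus t (by
      rw [List.mem_singleton] at ht; simp [ht])) hjs hxs hK
    have hcount : len (loweredCount u xs).val ≤ m := by
      have : ∀ ys : List (Sample R), (loweredCount u ys).val ≤ ys.length := by
        intro ys
        induction ys with
        | nil => simp [loweredCount]
        | cons y ys ih =>
          simp only [loweredCount, bind_val, List.length_cons]
          split_ifs
          · simpa using ih
          · simp only [ret_val]; omega
      exact (len_mono ((this xs).trans (by omega))).trans b.len_K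
    refine Within.mono ((tick_within 1).bind (h1.bind ((natLe_within
      ((len_mono hN₂).trans b.len_K) hcount).bind ((ih fun t ht => hus t (by simp [ht])).bind
      (Within.ret _))))) ?_ ?_ le_rfl
    · rw [List.length_cons, add_mul]; omega
    · obtain ⟨h1, h2, h3, h4, h5, h6, h7⟩ := le_mul_mul b.n_pos b.L_pos b.m_pos
      have h8 : n * L * m ≤ K * (n * L * m) := Nat.le_mul_of_pos_left _ hK0
      have h9 : xs.length * (12 * (n * L * m)) ≤ 12 * (K * (n * L * m)) := by
        have := Nat.mul_le_mul_right (12 * (n * L * m)) hK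
        have e : K * (12 * (n * L * m)) = 12 * (K * (n * L * m)) := by ring
        omega
      rw [List.length_cons, add_mul]; omega

end TermTest

end Candidates

section MainLoop

variable {R : Type u} [CommRing R] [DecidableEq R] {n : ℕ}

/-! ## Splitting off terms -/

theorem coeff_termSum_of_forall_ne {s : List (List ℕ × R)} {v : Fin n →₀ ℕ}
    (h : ∀ u ∈ s, expVec n u.1 ≠ v) : (termSum n s).coeff v = 0 := by
  induction s with
  | nil => simp [termSum]
  | cons a s ih =>
    rw [termSum, List.map_cons, List.sum_cons, MvPolynomial.coeff_add, MvPolynomial.coeff_monomial,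
      if_neg (h a (by simp)), zero_add]
    exact ih fun u hu => h u (by simp [hu])

theorem coeff_termSum_of_mem {s : List (List ℕ × R)} (hlen : ∀ u ∈ s, u.1.length = n)
    (hnd : (s.map Prod.fst).Nodup) {u : List ℕ × R} (hu : u ∈ s) :
    (termSum n s).coeff (expVec n u.1) = u.2 := by
  induction s with
  | nil => simp at hu
  | cons a s ih =>
    rw [List.map_cons, List.nodup_cons] at hnd
    rw [termSum, List.map_cons, List.sum_cons, MvPolynomial.coeff_add, MvPolynomial.coeff_monomial]
    have hne : ∀ w ∈ s, expVec n w.1 ≠ expVec n a.1 := fun w hw he =>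
      hnd.1 (List.mem_map.2 ⟨w, hw, expVec_injOn (hlen w (by simp [hw])) (hlen a (by simp)) he⟩)
    rcases List.mem_cons.1 hu with rfl | hu
    · rw [if_pos rfl]
      have := coeff_termSum_of_forall_ne hne
      rw [termSum] at this
      rw [this, add_zero]
    · rw [if_neg (hne u hu).symm, zero_add]
      exact ih (fun u hu => hlen u (by simp [hu])) hnd.2 hu

/-- The terms `h` of `f` have been found, and `F` is what remains. -/
structure Progress (D : ℕ) (f F : MvPolynomial (Fin n) R) (h : List (List ℕ × R)) : Prop where
  eq : F = f - termSum n h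
  low : LowDegreeTerms n D h
  ne_zero : ∀ t ∈ h, t.2 ≠ 0
  nodup : (h.map Prod.fst).Nodup
  coeff_eq_zero : ∀ t ∈ h, F.coeff (expVec n t.1) = 0
  lowDegree : LowDegreePoly D F
  card : F.support.card + h.length = f.support.card

theorem Progress.start {D : ℕ} {f : MvPolynomial (Fin n) R} (hf : LowDegreePoly D f) :
    Progress D f f [] :=
  ⟨by simp [termSum], by simp [LowDegreeTerms], by simp, by simp, by simp, hf, by simp⟩

theorem Progress.isMvTerms {D : ℕ} {f : MvPolynomial (Fin n) R} {h : List (List ℕ × R)}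
    (hp : Progress D f 0 h) : IsMvTerms h f where
  nodup := hp.nodup
  length_eq := fun t ht => (hp.low t ht).1
  ne_zero := hp.ne_zero
  sum_eq := (sub_eq_zero.1 hp.eq.symm).symm

/-- Because the new terms have distinct exponents and their exact coefficients in `F`, subtraction
deletes precisely their monomials and changes no other coefficient. Found monomials have coefficient
zero in the remainder, so they cannot be found again. -/
theorem Progress.step {D : ℕ} {f F : MvPolynomial (Fin n) R} {h : List (List ℕ × R)}
    (hp : Progress D f F h) {s : List (List ℕ × R)} (hlow : LowDegreeTerms n D s)
    (hne : ∀ t ∈ s, t.2 ≠ 0) (hnd : (s.map Prod.fst).Nodup)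
    (hcoeff : ∀ t ∈ s, F.coeff (expVec n t.1) = t.2) :
    Progress D f (F - termSum n s) (s ++ h) ∧
      (F - termSum n s).support.card + s.length = F.support.card := by
  have hlen : ∀ u ∈ s, u.1.length = n := fun u hu => (hlow u hu).1
  have hsupp : (F - termSum n s).support =
      F.support \ (s.map fun t => expVec n t.1).toFinset := by
    ext v
    rw [MvPolynomial.mem_support_iff, Finset.mem_sdiff, MvPolynomial.mem_support_iff,
      MvPolynomial.coeff_sub, List.mem_toFinset]
    by_cases hv : v ∈ s.map fun t => expVec n t.1
    · obtain ⟨t, ht, rfl⟩ := List.mem_map.1 hv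
      simp [coeff_termSum_of_mem hlen hnd ht, hcoeff t ht, hv]
    · rw [coeff_termSum_of_forall_ne (s := s) fun u hu he => hv (List.mem_map.2 ⟨u, hu, he⟩)]
      simp only [sub_zero]
      tauto
  have hsub : (s.map fun t => expVec n t.1).toFinset ⊆ F.support := by
    intro v hv
    obtain ⟨t, ht, rfl⟩ := List.mem_map.1 (List.mem_toFinset.1 hv)
    rw [MvPolynomial.mem_support_iff, hcoeff t ht]
    exact hne t ht
  have hcard : (s.map fun t => expVec n t.1).toFinset.card = s.length := by
    rw [List.toFinset_card_of_nodup, List.length_map]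
    have : s.map (fun t => expVec n t.1) = (s.map Prod.fst).map (expVec n) := by
      simp [Function.comp_def]
    rw [this]
    refine List.Nodup.map_on ?_ hnd
    intro x hx y hy he
    obtain ⟨t, ht, rfl⟩ := List.mem_map.1 hx
    obtain ⟨t', ht', rfl⟩ := List.mem_map.1 hy
    exact expVec_injOn (hlen t ht) (hlen t' ht') he
  have hcardF : (F - termSum n s).support.card + s.length = F.support.card := by
    rw [hsupp, Finset.card_sdiff_of_subset hsub, hcard]
    have := Finset.card_le_card hsub
    omega
  refine ⟨⟨?_, ?_, ?_, ?_, ?_, ?_, ?_⟩, hcardF⟩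
  · rw [hp.eq, sub_sub]
    congr 1
    simp only [termSum, List.map_append, List.sum_append]
    exact add_comm _ _
  · intro t ht
    rcases List.mem_append.1 ht with ht | ht
    exacts [hlow t ht, hp.low t ht]
  · intro t ht
    rcases List.mem_append.1 ht with ht | ht
    exacts [hne t ht, hp.ne_zero t ht]
  · rw [List.map_append]
    refine List.Nodup.append hnd hp.nodup ?_
    intro x hx hx'
    obtain ⟨t, ht, rfl⟩ := List.mem_map.1 hx
    obtain ⟨t', ht', he⟩ := List.mem_map.1 hx'
    have h1 := hp.coeff_eq_zero t' ht'
    rw [he, hcoeff t ht] at h1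
    exact hne t ht h1
  · intro t ht
    rw [← MvPolynomial.notMem_support_iff, hsupp, Finset.mem_sdiff, List.mem_toFinset]
    rcases List.mem_append.1 ht with ht | ht
    · exact fun hh => hh.2 (List.mem_map.2 ⟨t, ht, rfl⟩)
    · exact fun hh => MvPolynomial.mem_support_iff.1 hh.1 (hp.coeff_eq_zero t ht)
  · intro v hv
    rw [hsupp] at hv
    exact hp.lowDegree v (Finset.mem_sdiff.1 hv).1
  · rw [List.length_append]
    have := hp.card
    omega

/-! ## One round -/

/-- The samples `xs` belong to the polynomial `F` and the first `M` primes. -/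
def SamplesFor (D : ℕ) (F : MvPolynomial (Fin n) R) (xs : List (Sample R)) (M : ℕ) : Prop :=
  List.Forall₂ (fun x j => Sample.Valid D F x (prm j)) xs (List.range M)

theorem SamplesFor.take {D M M' : ℕ} {F : MvPolynomial (Fin n) R} {xs : List (Sample R)}
    (h : SamplesFor D F xs M) (hM : M' ≤ M) : SamplesFor D F (xs.take M') M' := by
  have := List.forall₂_take M' h
  rwa [List.take_range, min_eq_left hM] at this

theorem SamplesFor.length_eq {D M : ℕ} {F : MvPolynomial (Fin n) R} {xs : List (Sample R)}
    (h : SamplesFor D F xs M) : xs.length = M := by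
  simpa using List.Forall₂.length_eq h

theorem SamplesFor.exists_valid {D M : ℕ} {F : MvPolynomial (Fin n) R} {xs : List (Sample R)}
    (h : SamplesFor D F xs M) {x : Sample R} (hx : x ∈ xs) :
    ∃ j < M, Sample.Valid D F x (prm j) := by
  obtain ⟨i, hi, rfl⟩ := List.mem_iff_getElem.1 hx
  have := (List.forall₂_iff_get.1 h).2 i hi (by rwa [List.length_range, ← h.length_eq])
  exact ⟨i, by rwa [← h.length_eq], by simpa using this⟩

theorem SamplesFor.exists_sample {D M : ℕ} {F : MvPolynomial (Fin n) R} {xs : List (Sample R)}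
    (h : SamplesFor D F xs M) {j : ℕ} (hj : j < M) :
    ∃ x ∈ xs, Sample.Valid D F x (prm j) := by
  have hj' : j < xs.length := by rwa [h.length_eq]
  have := (List.forall₂_iff_get.1 h).2 j hj' (by rwa [List.length_range])
  exact ⟨xs[j], List.getElem_mem _, by simpa using this⟩

theorem SamplesFor.update {D M : ℕ} {F : MvPolynomial (Fin n) R} {xs : List (Sample R)}
    (h : SamplesFor D F xs M) {s : List (List ℕ × R)} (hs : LowDegreeTerms n D s) :
    SamplesFor D (F - termSum n s) (updateSamples s xs).val M := by
  rw [SamplesFor, updateSamples_val, List.forall₂_map_left_iff]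
  exact List.Forall₂.imp (fun x j hx => hx.update fun t ht => (hs t ht).1) h

/-- Each term of the reduced image yields at most one candidate. -/
theorem tsTerms_length_le {D p : ℕ} {F : MvPolynomial (Fin n) R} {x : Sample R}
    (hx : x.Valid D F p) (gs : List (UPoly R)) :
    (tsTerms D x gs).val.length ≤ F.support.card := by
  simp only [tsTerms, bind_val, candidates_val]
  refine (List.length_filterMap_le _ _).trans ?_
  rw [hx.red.values_length]
  exact card_support_redImage_le D p F

/-- The terms found in one round. -/
def roundTerms (I : List ℕ → List (ℕ × R)) (n D N₁ N₂ : ℕ) (xs : List (Sample R))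
    (h : List (List ℕ × R)) (x : Sample R) : List (List ℕ × R) :=
  (selectTerms N₂ (xs.take (N₁ + N₂ - 1))
    (tsTerms D x (shiftedImages I n x h n).val).val).val

/-- What is done in a round if the chosen sample is not zero. -/
def loopBody (I : List ℕ → List (ℕ × R)) (n D : ℕ) (primes : List ℕ) (rounds T N₁ N₂ : ℕ)
    (xs : List (Sample R)) (h : List (List ℕ × R)) (x : Sample R) :
    Run (Option (List (List ℕ × R))) :=
  (shiftedImages I n x h n).bind fun gs =>
  (tsTerms D x gs).bind fun us =>
  (natAdd N₁ N₂).bind fun a =>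
  (natSub a 1).bind fun a' =>
  (takeList a' xs).bind fun ys =>
  (selectTerms N₂ ys us).bind fun s =>
  (appendList s h).bind fun h' =>
  (lengthList s).bind fun m =>
  (natSub T m).bind fun T' =>
  (thresholds n T' D primes).bind fun N =>
  (sampleCount N.1 N.2.1 N.2.2).bind fun M =>
  (takeList M xs).bind fun zs =>
  (updateSamples s zs).bind fun xs' =>
  mainLoop I n D primes rounds T' N.1 N.2.1 xs' h'

/-- What is done in a round after the choice of a sample. -/
def loopTail (I : List ℕ → List (ℕ × R)) (n D : ℕ) (primes : List ℕ) (rounds T N₁ N₂ : ℕ)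
    (xs : List (Sample R)) (h : List (List ℕ × R)) (o : Option (ℕ × Sample R)) :
    Run (Option (List (List ℕ × R))) :=
  match o with
  | none => ret (some h)
  | some (α, x) =>
    (natEq α 0).bind fun finished =>
    if finished then ret (some h) else loopBody I n D primes rounds T N₁ N₂ xs h x

theorem mainLoop_succ (I : List ℕ → List (ℕ × R)) (n D : ℕ) (primes : List ℕ)
    (rounds T N₁ N₂ : ℕ) (xs : List (Sample R)) (h : List (List ℕ × R)) :
    mainLoop I n D primes (rounds + 1) T N₁ N₂ xs h =
      (bestSample xs).bind (loopTail I n D primes rounds T N₁ N₂ xs h) := rfl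

/-- The state at the beginning of a round. -/
structure LoopState (D T₀ : ℕ) (f : MvPolynomial (Fin n) R) (T : ℕ) (N : ℕ × ℕ × ℕ)
    (xs : List (Sample R)) (h : List (List ℕ × R)) (F : MvPolynomial (Fin n) R) : Prop where
  progress : Progress D f F h
  card_le : F.support.card ≤ T
  le : T ≤ T₀
  thresholds_eq : thresholdNums n T D (prmList (budget n T₀ D)) = N
  samples : SamplesFor D F xs (numSamples N)

section Round

variable {D T₀ T : ℕ} {f F : MvPolynomial (Fin n) R} {I : List ℕ → List (ℕ × R)}
  {N : ℕ × ℕ × ℕ} {xs : List (Sample R)} {h : List (List ℕ × R)}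

/-- `tsTerms_spec` supplies all isolated terms among the candidates, and `termTest_iff` keeps
exactly the candidates with the right coefficient in `F`. Isolated terms pass, so their number
bounds the gain from below. -/
theorem LoopState.roundTerms_spec (st : LoopState D T₀ f T N xs h F) (hD : 1 ≤ D)
    (hI : IsInterpolator f I) {x : Sample R} {j : ℕ} (hx : x.Valid D F (prm j)) :
    LowDegreeTerms n D (roundTerms I n D N.1 N.2.1 xs h x) ∧
    (∀ u ∈ roundTerms I n D N.1 N.2.1 xs h x, u.2 ≠ 0) ∧
    ((roundTerms I n D N.1 N.2.1 xs h x).map Prod.fst).Nodup ∧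
    (∀ u ∈ roundTerms I n D N.1 N.2.1 xs h x, F.coeff (expVec n u.1) = u.2) ∧
    (isolated F.support fun s => kron D s % prm j).card ≤
      (roundTerms I n D N.1 N.2.1 xs h x).length := by
  have hp := (prm_prime j).pos
  have hgs := shiftedImages_spec hI hx (fun t ht => (st.progress.low t ht).1) st.progress.eq n le_rfl
  rw [Nat.sub_self, List.drop_zero] at hgs
  obtain ⟨h1, h2, h3, h4⟩ := tsTerms_spec hp hx hgs st.progress.lowDegree
  obtain ⟨⟨a1, a2⟩, ⟨b1, b2⟩, _⟩ := thresholdNums_spec hD st.le st.thresholds_eq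
  have hM : N.1 + N.2.1 - 1 ≤ numSamples N := le_max_left _ _
  set us := (tsTerms D x (shiftedImages I n x h n).val).val
  have htest : ∀ u ∈ us, (N.2.1 ≤ (loweredCount u (xs.take (N.1 + N.2.1 - 1))).val ↔
      F.coeff (expVec n u.1) = u.2) := by
    intro u hu
    rw [← termTest_iff st.progress.lowDegree st.card_le a1 a2 b1 b2 (h1 u hu).2 (h2 u hu),
      loweredCount_val (h1 u hu).1 (h2 u hu) (st.samples.take hM)]
    -- Both sides compare `N₂` with the same number, once as the cardinality of a filtered range and
    -- once as a count along a list.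
    rw [iff_iff_eq]
    congr 1
    simp [Finset.card, Finset.filter, Finset.range, Multiset.range, List.countP_eq_length_filter]
  have hsel : roundTerms I n D N.1 N.2.1 xs h x =
      us.filter fun u => N.2.1 ≤ (loweredCount u (xs.take (N.1 + N.2.1 - 1))).val :=
    selectTerms_val _ _ _
  have hmem : ∀ u ∈ roundTerms I n D N.1 N.2.1 xs h x, u ∈ us ∧ F.coeff (expVec n u.1) = u.2 := by
    intro u hu
    rw [hsel, List.mem_filter, decide_eq_true_eq] at hu
    exact ⟨hu.1, (htest u hu.1).1 hu.2⟩
  refine ⟨fun u hu => h1 u (hmem u hu).1, fun u hu => h2 u (hmem u hu).1, ?_,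
    fun u hu => (hmem u hu).2, ?_⟩
  · rw [hsel]
    exact h3.sublist (List.filter_sublist.map _)
  · have hsub : ((isolated F.support fun s => kron D s % prm j).image
        fun s : Fin n →₀ ℕ => (List.ofFn (s : Fin n → ℕ), F.coeff s)) ⊆ (roundTerms I n D N.1 N.2.1 xs h x).toFinset := by
      intro u hu
      obtain ⟨s, hs, rfl⟩ := Finset.mem_image.1 hu
      rw [List.mem_toFinset, hsel, List.mem_filter, decide_eq_true_eq]
      refine ⟨h4 s hs, (htest _ (h4 s hs)).2 ?_⟩
      simp
    have hcard := Finset.card_le_card hsub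
    rw [Finset.card_image_of_injective] at hcard
    · exact hcard.trans (List.toFinset_card_le _)
    · intro s t hst
      have := congrArg (fun u => expVec n u.1) hst
      simpa using this

/-- The state after a round. -/
theorem LoopState.next (st : LoopState D T₀ f T N xs h F) (hD : 1 ≤ D)
    (hI : IsInterpolator f I) {x : Sample R} {j : ℕ} (hx : x.Valid D F (prm j))
    {s : List (List ℕ × R)} (hs : s = roundTerms I n D N.1 N.2.1 xs h x) {N' : ℕ × ℕ × ℕ}
    (hN' : N' = thresholdNums n (T - s.length) D (prmList (budget n T₀ D))) :
    LoopState D T₀ f (T - s.length) N' (updateSamples s (xs.take (numSamples N'))).val (s ++ h)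
      (F - termSum n s) ∧
    (F - termSum n s).support.card + s.length = F.support.card ∧
    (isolated F.support fun s => kron D s % prm j).card ≤ s.length := by
  obtain ⟨h1, h2, h3, h4, h5⟩ := st.roundTerms_spec hD hI hx
  rw [← hs] at h1 h2 h3 h4 h5
  obtain ⟨g1, g2⟩ := st.progress.step h1 h2 h3 h4
  have hle : numSamples N' ≤ numSamples N := by
    rw [hN', ← st.thresholds_eq]
    exact numSamples_mono hD (Nat.sub_le _ _) _
  refine ⟨⟨g1, ?_, (Nat.sub_le _ _).trans st.le, hN'.symm, (st.samples.take hle).update h1⟩, g2, h5⟩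
  have := st.card_le
  omega

/-- The choice of a sample. -/
theorem LoopState.bestSample_val (st : LoopState D T₀ f T N xs h F) (hD : 1 ≤ D) :
    ∃ x j, (bestSample xs).val = some ((redImage D (prm j) F).support.card, x) ∧ x ∈ xs ∧
      j < numSamples N ∧ Sample.Valid D F x (prm j) ∧ ∀ i < numSamples N,
        (redImage D (prm i) F).support.card ≤ (redImage D (prm j) F).support.card := by
  obtain ⟨_, _, ⟨c1, _⟩, _⟩ := thresholdNums_spec hD st.le st.thresholds_eq
  have hM : 1 ≤ numSamples N := c1.trans (le_max_right _ _)
  obtain ⟨h1, h2⟩ := bestSample_spec xs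
  rcases hb : (bestSample xs).val with _ | ⟨α, x⟩
  · have := st.samples.length_eq
    rw [h1 hb] at this
    simp at this
    omega
  · obtain ⟨g1, g2, g3⟩ := h2 α x hb
    obtain ⟨j, hj, hx⟩ := st.samples.exists_valid g1
    rw [hx.red.count_val] at g2
    subst g2
    refine ⟨x, j, rfl, g1, hj, hx, fun i hi => ?_⟩
    obtain ⟨y, hy, hyv⟩ := st.samples.exists_sample hi
    rw [← hyv.red.count_val]
    exact g3 y hy

/-- The number of samples is at least `N_3`, so a nonzero remainder would show in one of the reduced
images. -/
theorem LoopState.eq_zero (st : LoopState D T₀ f T N xs h F) (hD : 1 ≤ D)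
    (h0 : ∀ i < numSamples N, (redImage D (prm i) F).support.card = 0) : F = 0 := by
  obtain ⟨_, _, ⟨c1, c2⟩, _⟩ := thresholdNums_spec hD st.le st.thresholds_eq
  by_contra hF
  obtain ⟨j, hj, hne⟩ := exists_redImage_ne_zero hF st.progress.lowDegree st.card_le c1 c2
  exact hne (h0 j (hj.trans_le (le_max_right _ _)))

theorem LoopState.card_lt (st : LoopState D T₀ f T N xs h F) (hD : 1 ≤ D) (hF : F ≠ 0) {j : ℕ}
    (hmax : ∀ i < numSamples N,
      (redImage D (prm i) F).support.card ≤ (redImage D (prm j) F).support.card) :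
    F.support.card < 2 * (isolated F.support fun s => kron D s % prm j).card := by
  obtain ⟨_, _, ⟨c1, c2⟩, _⟩ := thresholdNums_spec hD st.le st.thresholds_eq
  exact card_lt_two_mul_card_isolated hF st.progress.lowDegree st.card_le c1 (le_max_right _ _) c2
    hmax

/-- The form of the requests. -/
def IsRequest (n D K : ℕ) (e : List ℕ) : Prop :=
  ∃ j < K, e = List.ofFn (kronExp n D (prm j)) ∨
    ∃ k : Fin n, e = List.ofFn (kronExpShift n D (prm j) k)

/-! ### Subroutines of a round without requests -/

theorem natPow_queries (D m : ℕ) : (natPow D m).queries = [] := by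
  induction m with
  | zero => rfl
  | succ m ih => simp [natPow, tick, natMul, ih]

theorem thresholds_queries (n T D : ℕ) (ps : List ℕ) : (thresholds n T D ps).queries = [] := by
  have h2 : ∀ B l P m₀, (leastCount B l P m₀).queries = [] := by
    intro B l
    induction l with
    | nil => intro P m₀; rfl
    | cons q l ih =>
      intro P m₀
      simp only [leastCount, bind_queries]
      split_ifs <;> simp [natMul, natAdd, natLe, ih]
  simp [thresholds, natSub, natMul, natPow_queries, h2]

theorem subImageMod_queries (p : ℕ) (w : List ℕ) (s : List (List ℕ × R)) (t : UPoly R) :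
    (subImageMod p w s t).queries = [] := by
  induction s generalizing t with
  | nil => rfl
  | cons a l ih => simp [subImageMod, tick, dot_queries, natMod, subTerm_queries, ih]

theorem updateSamples_queries (s : List (List ℕ × R)) (xs : List (Sample R)) :
    (updateSamples s xs).queries = [] := by
  induction xs with
  | nil => rfl
  | cons x xs ih => simp [updateSamples, tick, subImage_queries, subImageMod_queries, ih]

theorem loweredCount_queries (u : List ℕ × R) (xs : List (Sample R)) :
    (loweredCount u xs).queries = [] := by
  induction xs with
  | nil => rfl
  | cons x xs ih =>
    have h := (coeffAt_within x.red (e := (natMod (dot u.1 x.w).val x.p).val) le_rfl).queries_eq_nil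
    simp only [loweredCount, bind_queries, ih, h, dot_queries]
    split_ifs <;> rfl

theorem selectTerms_queries (N₂ : ℕ) (xs : List (Sample R)) (us : List (List ℕ × R)) :
    (selectTerms N₂ xs us).queries = [] := by
  induction us with
  | nil => rfl
  | cons u us ih => simp [selectTerms, tick, natLe, loweredCount_queries, ih]

theorem fillBlocks_queries (p : ℕ) (l : List (ℕ × R)) (B : Trie ((ℕ × R) × Bool)) :
    (fillBlocks p l B).queries = [] := by
  induction l generalizing B with
  | nil => rfl
  | cons t l ih =>
    obtain ⟨e, c⟩ := t
    simp only [fillBlocks, bind_queries, ih, List.append_nil]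
    exact (Trie.alter_within (r := 0) (b := 0) (g := fun o => match o with
      | none => ret (some ((e, c), true))
      | some (t, _) => ret (some (t, false))) (by
        rintro (_ | ⟨_, _⟩) <;> exact Within.ret _) B (natBits (natMod e p).val).val).queries_eq_nil

theorem blocks_queries (p : ℕ) (t : UPoly R) : (blocks p t).queries = [] := by
  simp only [blocks, bind_queries, fillBlocks_queries,
    (Trie.values_within t []).queries_eq_nil, List.append_nil]

theorem blocksList_queries (p : ℕ) (ts : List (UPoly R)) : (blocksList p ts).queries = [] := by
  induction ts with
  | nil => rfl
  | cons t ts ih => simp [blocksList, tick, blocks_queries, ih]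

theorem recoverExponents_queries (p γ d : ℕ) (a : R) (Bs : List (Trie ((ℕ × R) × Bool))) :
    (recoverExponents p γ d a Bs).queries = [] := by
  induction Bs with
  | nil => rfl
  | cons B Bs ih =>
    simp only [recoverExponents, bind_queries,
      (singleExponent_within B (le_refl (len d)) a).queries_eq_nil]
    rcases (singleExponent B d a).val with _ | β
    · rfl
    · simp only [bind_queries]
      split_ifs
      · simp only [bind_queries]
        split_ifs
        · simp only [bind_queries, ih]
          cases (recoverExponents p γ d a Bs).val <;> rfl
        · rfl
      · rfl

theorem candidate_queries (D p : ℕ) (w : List ℕ) (B : Trie ((ℕ × R) × Bool))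
    (Bs : List (Trie ((ℕ × R) × Bool))) (d : ℕ) (a : R) :
    (candidate D p w B Bs d a).queries = [] := by
  simp only [candidate, bind_queries,
    (singleExponent_within B (le_refl (len d)) a).queries_eq_nil]
  rcases (singleExponent B d a).val with _ | γ
  · rfl
  · simp only [bind_queries, recoverExponents_queries]
    rcases (recoverExponents p γ d a Bs).val with _ | es
    · rfl
    · simp only [bind_queries, dot_queries]
      split_ifs
      · simp only [bind_queries, (sumList_within es le_rfl).queries_eq_nil]
        rfl
      · rfl

theorem candidates_queries (D p : ℕ) (w : List ℕ) (B : Trie ((ℕ × R) × Bool))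
    (Bs : List (Trie ((ℕ × R) × Bool))) (l : List (ℕ × R)) :
    (candidates D p w B Bs l).queries = [] := by
  induction l with
  | nil => rfl
  | cons t l ih =>
    obtain ⟨d, a⟩ := t
    simp only [candidates, bind_queries, candidate_queries, ih]
    cases (candidate D p w B Bs d a).val <;> rfl

theorem tsTerms_queries (D : ℕ) (x : Sample R) (gs : List (UPoly R)) :
    (tsTerms D x gs).queries = [] := by
  simp only [tsTerms, bind_queries, blocks_queries, blocksList_queries,
    (Trie.values_within x.red []).queries_eq_nil, candidates_queries]
  rfl

end Round

end MainLoop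

/-! ### Composition of runs along known values -/

namespace Run

variable {α : Type u} {β : Type v} {x : Run α} {a : α} {g : α → Run β}

/-- The value of the first run is replaced by a known expression before the continuation is
examined. Long programs can then be traversed step by step without unfolding their subroutines. -/
theorem bind_val_eq {v : β} (hx : x.val = a) (hg : (g a).val = v) : (x.bind g).val = v := by
  rw [← hg, ← hx]; rfl

theorem Asks.of_nil {P : List ℕ → Prop} (hx : x.queries = []) : x.Asks P := by
  simp [Asks, hx]

theorem Asks.bind_eq {P : List ℕ → Prop} (hx : x.Asks P) (ha : x.val = a) (hg : (g a).Asks P) :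
    (x.bind g).Asks P := by
  subst ha
  exact hx.bind hg

theorem Within.bind_eq {r b q r' b' q' : ℕ} (hx : x.Within r b q) (ha : x.val = a)
    (hg : (g a).Within r' b' q') : (x.bind g).Within (r + r') (b + b') (q + q') := by
  subst ha
  exact hx.bind hg

end Run

/-! ### Value, requests and cost of one round -/

section Loop

variable {R : Type u} [CommRing R] [DecidableEq R] {n : ℕ}
  {D T₀ T : ℕ} {f F : MvPolynomial (Fin n) R} {I : List ℕ → List (ℕ × R)}
  {N : ℕ × ℕ × ℕ} {xs : List (Sample R)} {h : List (List ℕ × R)}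

/-- The rest of the computation after a round in which the terms `s` were found. -/
def nextLoop (I : List ℕ → List (ℕ × R)) (n D : ℕ) (primes : List ℕ) (rounds T : ℕ)
    (xs : List (Sample R)) (h s : List (List ℕ × R)) : Run (Option (List (List ℕ × R))) :=
  mainLoop I n D primes rounds (T - s.length) (thresholdNums n (T - s.length) D primes).1
    (thresholdNums n (T - s.length) D primes).2.1
    (updateSamples s (xs.take (numSamples (thresholdNums n (T - s.length) D primes)))).val (s ++ h)

theorem loopBody_val (primes : List ℕ) (rounds T N₁ N₂ : ℕ) (xs : List (Sample R))
    (h : List (List ℕ × R)) (x : Sample R) :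
    (loopBody I n D primes rounds T N₁ N₂ xs h x).val =
      (nextLoop I n D primes rounds T xs h (roundTerms I n D N₁ N₂ xs h x)).val := by
  unfold loopBody
  exact Run.bind_val_eq rfl <| Run.bind_val_eq rfl <| Run.bind_val_eq rfl <| Run.bind_val_eq rfl <|
    Run.bind_val_eq (takeList_val _ _) <| Run.bind_val_eq rfl <|
    Run.bind_val_eq (appendList_val _ _) <| Run.bind_val_eq (lengthList_val _) <|
    Run.bind_val_eq rfl <| Run.bind_val_eq (thresholds_val _ _ _ _) <|
    Run.bind_val_eq (sampleCount_val _) <| Run.bind_val_eq (takeList_val _ _) <|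
    Run.bind_val_eq rfl rfl

theorem loopBody_asks (primes : List ℕ) (rounds T N₁ N₂ : ℕ) (xs : List (Sample R))
    (h : List (List ℕ × R)) (x : Sample R) {P : List ℕ → Prop}
    (h1 : (shiftedImages I n x h n).Asks P)
    (h2 : (nextLoop I n D primes rounds T xs h (roundTerms I n D N₁ N₂ xs h x)).Asks P) :
    (loopBody I n D primes rounds T N₁ N₂ xs h x).Asks P := by
  unfold loopBody
  exact h1.bind_eq rfl <| (Run.Asks.of_nil (tsTerms_queries _ _ _)).bind_eq rfl <|
    (Run.Asks.of_nil rfl).bind_eq rfl <|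
    (Run.Asks.of_nil rfl).bind_eq rfl <|
    ((takeList_within _ _ le_rfl).asks P).bind_eq (takeList_val _ _) <|
    (Run.Asks.of_nil (selectTerms_queries _ _ _)).bind_eq rfl <|
    ((appendList_within _ _).asks P).bind_eq (appendList_val _ _) <|
    ((lengthList_within _ le_rfl).asks P).bind_eq (lengthList_val _) <|
    (Run.Asks.of_nil rfl).bind_eq rfl <|
    (Run.Asks.of_nil (thresholds_queries _ _ _ _)).bind_eq (thresholds_val _ _ _ _) <|
    (Run.Asks.of_nil rfl).bind_eq (sampleCount_val _) <|
    ((takeList_within _ _ le_rfl).asks P).bind_eq (takeList_val _ _) <|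
    (Run.Asks.of_nil (updateSamples_queries _ _)).bind_eq rfl h2

theorem LoopState.length_le (st : LoopState D T₀ f T N xs h F) (hT : f.support.card ≤ T₀) :
    h.length ≤ T₀ := by
  have := st.progress.card
  omega

theorem LoopState.shiftedImages_spec (st : LoopState D T₀ f T N xs h F)
    (hI : IsInterpolator f I) {x : Sample R} {p : ℕ} (hx : x.Valid D F p) :
    List.Forall₂ (fun (g : UPoly R) k => Represents g (subst (kronExpShift n D p k) F))
      (shiftedImages I n x h n).val (List.finRange n) := by
  have hgs := KroneckerInterp.shiftedImages_spec hI hx (fun t ht => (st.progress.low t ht).1)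
    st.progress.eq n le_rfl
  rwa [Nat.sub_self, List.drop_zero] at hgs

/-- The cost of a round, without the choice of the sample. -/
theorem loopBody_within {L m j : ℕ} (b : Bounds n T₀ D (budget n T₀ D) L m)
    (st : LoopState D T₀ f T N xs h F) (hD : 1 ≤ D) (hI : IsInterpolator f I)
    (hf : LowDegreePoly D f) (hT : f.support.card ≤ T₀)
    (hsmall : ∀ x ∈ xs, x.Small L m (T₀ + h.length)) {x : Sample R} (hxs : x ∈ xs)
    (hj : j < budget n T₀ D) (hx : x.Valid D F (prm j)) {rounds r' b' q' : ℕ}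
    (hrest : (nextLoop I n D (prmList (budget n T₀ D)) rounds T xs h
      (roundTerms I n D N.1 N.2.1 xs h x)).Within r' b' q') :
    (loopBody I n D (prmList (budget n T₀ D)) rounds T N.1 N.2.1 xs h x).Within
      (7 * (n * T₀) + 9 * (budget n T₀ D * T₀) + r')
      (1600 * ((n * T₀ * L) ^ 2 * m ^ 2) + b') (n + q') := by
  set K := budget n T₀ D with hK
  have hn := b.n_pos
  have hT0 := b.T_pos
  have hm := b.m_pos
  have hL := b.L_pos
  have hgs := st.shiftedImages_spec hI hx
  have hlow := st.progress.low
  have hlen := st.length_le hT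
  have hFT : F.support.card ≤ T₀ := st.card_le.trans st.le
  obtain ⟨-, -, -, c1, c2, c3, -⟩ := thresholdNums_spec hD st.le st.thresholds_eq
  rw [← hK] at c1 c2 c3
  obtain ⟨st', d1, -⟩ := st.next hD hI hx rfl rfl
  set s := roundTerms I n D N.1 N.2.1 xs h x with hs
  obtain ⟨-, -, -, e1, e2, e3, e4⟩ := thresholdNums_spec hD st'.le st'.thresholds_eq
  rw [← hK] at e1 e2 e3 e4
  have hsT : s.length ≤ T₀ := by omega
  obtain ⟨u1, -⟩ := tsTerms_spec (prm_prime j).pos hx hgs st.progress.lowDegree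
  have u2 := (tsTerms_length_le hx (shiftedImages I n x h n).val).trans hFT
  have hslow := (st.roundTerms_spec hD hI hx).1
  rw [← hs] at hslow
  have hrange : ∀ M ≤ K, ∀ i ∈ List.range M, i ≤ K := fun M hM i hi =>
    (List.mem_range.1 hi).le.trans hM
  have hM1 : N.1 + N.2.1 - 1 ≤ numSamples N := le_max_left _ _
  have hys := st.samples.take hM1
  set N' := thresholdNums n (T - s.length) D (prmList K) with hN'
  have hle : numSamples N' ≤ numSamples N := by
    have := numSamples_mono (n := n) hD (Nat.sub_le T s.length) (prmList K)
    rwa [st.thresholds_eq] at this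
  have hzs := st.samples.take hle
  have lenK : ∀ {a}, a ≤ K → len a ≤ m := fun ha => (len_mono ha).trans b.len_K
  have lenT : ∀ {a}, a ≤ T₀ → len a ≤ m := fun ha => (len_mono ha).trans b.len_T
  have w1 := shiftedImages_within b hj.le hf hT hI hx hlow hlen n le_rfl
  have w2 := tsTerms_within b hj.le hx hgs st.progress.lowDegree hFT (by omega) (hsmall x hxs)
    (shiftedImages_nodes b hj.le hf hT hI hx hlow hlen n le_rfl)
  have w3 := natAdd_within (lenK c2) (lenK c3)
  have hadd : len (N.1 + N.2.1) ≤ m + 1 :=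
    (len_add _ _).trans (Nat.succ_le_succ (max_le (lenK c2) (lenK c3)))
  have w4 := natSub_within hadd len_one.le
  have w5 := takeList_within (N.1 + N.2.1 - 1) xs (lenK (hM1.trans c1))
  have hysK : (xs.take (N.1 + N.2.1 - 1)).length ≤ K :=
    hys.length_eq.trans_le (hM1.trans c1)
  have w6 := selectTerms_within b c3 u1 (hrange _ (hM1.trans c1)) hys hysK (by omega)
  have w7 := appendList_within s h
  have w8 := lengthList_within s (lenT hsT)
  have w9 := natSub_within (lenT st.le) (lenT hsT)
  have w10 := thresholds_within (T := T - s.length) hn hT0 ((Nat.sub_le _ _).trans st.le) b.len_D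
    b.len_nT b.len_K (prmList K) (by simp [prmList]) (by
      intro q hq
      obtain ⟨i, hi, rfl⟩ := List.mem_map.1 hq
      exact b.len_of_le_two_prm (List.mem_range.1 hi).le (by omega))
  have w11 := sampleCount_within (lenK e2) (lenK e3) (lenK e4)
  have w12 := takeList_within (numSamples N') xs (lenK (hle.trans c1))
  have w13 := updateSamples_within b hslow hsT (hrange _ (hle.trans c1)) hzs
  have hzsK := hzs.length_eq
  unfold loopBody
  refine Within.mono (w1.bind_eq rfl <| w2.bind_eq rfl <| w3.bind_eq rfl <| w4.bind_eq rfl <|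
    w5.bind_eq (takeList_val _ _) <| w6.bind_eq rfl <| w7.bind_eq (appendList_val _ _) <|
    w8.bind_eq (lengthList_val _) <| w9.bind_eq rfl <| w10.bind_eq (thresholds_val _ _ _ _) <|
    w11.bind_eq (sampleCount_val _) <| w12.bind_eq (takeList_val _ _) <| w13.bind_eq rfl hrest)
    ?_ ?_ ?_
  · have q1 : (tsTerms D x (shiftedImages I n x h n).val).val.length * (3 * K) ≤ T₀ * (3 * K) :=
      Nat.mul_le_mul_right _ u2
    have q2 : (xs.take (numSamples N')).length * (6 * T₀) ≤ K * (6 * T₀) :=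
      Nat.mul_le_mul_right _ (hzsK.trans_le (hle.trans c1))
    have q3 : n * (5 * T₀) = 5 * (n * T₀) := by ring
    have q4 : T₀ * (3 * K) = 3 * (K * T₀) := by ring
    have q5 : K * (6 * T₀) = 6 * (K * T₀) := by ring
    omega
  -- `W` is the common unit: with `K ≤ 4 * (n * T₀) * L`, the term tests, the updates and the
  -- thresholds all contribute a multiple of it.
  · set W := (n * T₀ * L) ^ 2 * m ^ 2 with hW
    have hKle := b.K_le
    have q1 : (tsTerms D x (shiftedImages I n x h n).val).val.length * (16 * (K * (n * L * m))) ≤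
        64 * W := by
      calc _ ≤ T₀ * (16 * (4 * (n * T₀) * L * (n * L * m))) := by gcongr
        _ ≤ 64 * W := le_of_mul_eq m hm (by rw [hW]; ring)
    have q2 : (xs.take (numSamples N')).length * (20 * (n * T₀ * L * m)) ≤ 80 * W := by
      calc _ ≤ 4 * (n * T₀) * L * (20 * (n * T₀ * L * m)) :=
            Nat.mul_le_mul_right _ ((hzsK.trans_le (hle.trans c1)).trans hKle)
        _ ≤ 80 * W := le_of_mul_eq m hm (by rw [hW]; ring)
    have q3 : n * (22 * (n * T₀ * L * m)) ≤ 22 * W :=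
      le_of_mul_eq (T₀ * L * m) (by positivity) (by rw [hW]; ring)
    have q4 : n * T₀ * L * m ≤ W :=
      le_of_mul_eq (n * T₀ * L * m) (by positivity) (by rw [hW]; ring)
    have q5 : m ≤ W :=
      le_of_mul_eq ((n * T₀ * L) ^ 2 * m) (by positivity) (by rw [hW]; ring)
    have q6 : m ^ 2 ≤ W :=
      le_of_mul_eq ((n * T₀ * L) ^ 2) (by positivity) (by rw [hW]; ring)
    have q7 : ∀ M ≤ K, M * m ≤ 4 * W := fun M hM => by
      calc M * m ≤ 4 * (n * T₀) * L * m := Nat.mul_le_mul_right _ (hM.trans hKle)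
        _ = 4 * (n * T₀ * L * m) := by ring
        _ ≤ 4 * W := Nat.mul_le_mul_left 4 q4
    have q8 := q7 _ (hM1.trans c1)
    have q9 := q7 _ (hle.trans c1)
    have q10 : T₀ * (m + 2) ≤ 3 * W := by
      calc T₀ * (m + 2) ≤ T₀ * (3 * m) := Nat.mul_le_mul_left _ (by omega)
        _ = 3 * (T₀ * m) := by ring
        _ ≤ 3 * (n * T₀ * L * m) := Nat.mul_le_mul_left 3
            (le_of_mul_eq (n * L) (by positivity) (by ring))
        _ ≤ 3 * W := Nat.mul_le_mul_left 3 q4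
    have q11 : s.length * (m + 2) ≤ 3 * W := (Nat.mul_le_mul_right _ hsT).trans q10
    have q12 : s.length ≤ 3 * W := (Nat.le_mul_of_pos_right _ (by omega)).trans q11
    have q13 : 18 * (4 * (n * T₀) * L) ^ 2 ≤ 288 * W :=
      le_of_mul_eq (m ^ 2) (by positivity) (by rw [hW]; ring)
    have q14 : 63 * (K * (4 * (n * T₀) * L) * m) ≤ 1008 * W := by
      calc _ ≤ 63 * (4 * (n * T₀) * L * (4 * (n * T₀) * L) * m) := by gcongr
        _ ≤ 1008 * W := le_of_mul_eq m hm (by rw [hW]; ring)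
    have q15 : 1 ≤ W := hm.trans_le q5
    have q16 : len 1 = 2 := len_one
    clear_value W
    clear w1 w2 w3 w4 w5 w6 w7 w8 w9 w10 w11 w12 w13 hrest
    -- Every product becomes an atom already bounded by a multiple of `W`; the remaining inequality
    -- is linear.
    generalize (tsTerms D x (shiftedImages I n x h n).val).val.length *
      (16 * (K * (n * L * m))) = x1 at q1 ⊢
    generalize (xs.take (numSamples N')).length * (20 * (n * T₀ * L * m)) = x2 at q2 ⊢
    generalize n * (22 * (n * T₀ * L * m)) = x3 at q3 ⊢
    generalize n * T₀ * L * m = x4 at q4 ⊢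
    generalize (N.1 + N.2.1 - 1) * m = x5 at q8 ⊢
    generalize numSamples N' * m = x6 at q9 ⊢
    generalize s.length * (m + 2) = x7 at q11 ⊢
    generalize 18 * (4 * (n * T₀) * L) ^ 2 = x8 at q13 ⊢
    generalize 63 * (K * (4 * (n * T₀) * L) * m) = x9 at q14 ⊢
    generalize m ^ 2 = x10 at q6 ⊢
    generalize s.length = x11 at q12 ⊢
    clear q16 q10 q7 hKle hW c1 c2 c3 e1 e2 e3 e4 hlen hFT d1 hsT u2 hM1 hysK hzsK hadd
    omega
  · simp only [zero_add, le_refl]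

end Loop

/-! ### Correctness and total cost of the loop -/

section LoopSpec

variable {R : Type u} [CommRing R] [DecidableEq R] {n : ℕ}
  {D T₀ T : ℕ} {f F : MvPolynomial (Fin n) R} {I : List ℕ → List (ℕ × R)}
  {N : ℕ × ℕ × ℕ} {xs : List (Sample R)} {h : List (List ℕ × R)}

theorem loopTail_zero (I : List ℕ → List (ℕ × R)) (n D : ℕ) (primes : List ℕ)
    (rounds T N₁ N₂ : ℕ) (xs : List (Sample R)) (h : List (List ℕ × R)) (x : Sample R) :
    loopTail I n D primes rounds T N₁ N₂ xs h (some (0, x)) = (natEq 0 0).bind fun _ =>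
      ret (some h) := rfl

theorem loopTail_pos (I : List ℕ → List (ℕ × R)) (n D : ℕ) (primes : List ℕ)
    (rounds T N₁ N₂ : ℕ) (xs : List (Sample R)) (h : List (List ℕ × R)) {α : ℕ} (hα : α ≠ 0)
    (x : Sample R) :
    loopTail I n D primes rounds T N₁ N₂ xs h (some (α, x)) = (natEq α 0).bind fun _ =>
      loopBody I n D primes rounds T N₁ N₂ xs h x := by
  simp [loopTail, Run.bind, natEq, hα]

/-- The bit cost of a test of the `while` condition. -/
theorem LoopState.bestSample_within {L m : ℕ} (b : Bounds n T₀ D (budget n T₀ D) L m)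
    (st : LoopState D T₀ f T N xs h F) (hD : 1 ≤ D) (hT : f.support.card ≤ T₀)
    (hsmall : ∀ x ∈ xs, x.Small L m (T₀ + h.length)) {α : ℕ} (hα : α ≤ T₀)
    {β : Type u} {x : Sample R} (hbest : (bestSample xs).val = some (α, x))
    {g : Option (ℕ × Sample R) → Run β} {g' : Run β}
    (hg : g (some (α, x)) = (natEq α 0).bind fun _ => g') {r' b' q' : ℕ}
    (hw : g'.Within r' b' q') :
    ((bestSample xs).bind g).Within r' (600 * ((n * T₀ * L) ^ 2 * m ^ 2) + b') q' := by
  have hn := b.n_pos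
  have hT0 := b.T_pos
  have hm := b.m_pos
  have hL := b.L_pos
  obtain ⟨-, -, -, c1, -⟩ := thresholdNums_spec hD st.le st.thresholds_eq
  have hlen := st.length_le hT
  have w1 := KroneckerInterp.bestSample_within hT0 hm b.len_T (by omega) xs hsmall
  have w2 := natEq_within ((len_mono hα).trans b.len_T) (len_zero.le.trans hm)
  refine Within.mono (w1.bind_eq hbest (by rw [hg]; exact w2.bind hw)) (by omega) ?_ (by omega)
  set W := (n * T₀ * L) ^ 2 * m ^ 2 with hW
  have q1 : xs.length * (135 * (T₀ * m ^ 2)) ≤ 540 * W := by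
    calc _ ≤ 4 * (n * T₀) * L * (135 * (T₀ * m ^ 2)) :=
          Nat.mul_le_mul_right _ ((st.samples.length_eq.trans_le c1).trans b.K_le)
      _ ≤ 540 * W := le_of_mul_eq (n * L) (by positivity) (by rw [hW]; ring)
  have q2 : m ≤ W := le_of_mul_eq ((n * T₀ * L) ^ 2 * m) (by positivity) (by rw [hW]; ring)
  omega

theorem bestSample_queries (xs : List (Sample R)) : (bestSample xs).queries = [] := by
  induction xs with
  | nil => rfl
  | cons x xs ih =>
    simp only [bestSample, bind_queries, ih, (Trie.count_within x.red le_rfl).queries_eq_nil]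
    rcases (bestSample xs).val with _ | ⟨_, _⟩ <;> rfl

/-- The result and the costs of a loop that is entered with a polynomial of which the terms `h`
are already known. -/
structure LoopResult (D T₀ : ℕ) (f : MvPolynomial (Fin n) R) (xs : List (Sample R))
    (h : List (List ℕ × R)) (r : ℕ) (x : Run (Option (List (List ℕ × R)))) : Prop where
  exists_val : ∃ h', x.val = some h' ∧ IsMvTerms h' f
  asks : x.Asks (IsRequest n D (budget n T₀ D))
  within : ∀ L m, Bounds n T₀ D (budget n T₀ D) L m → f.support.card ≤ T₀ →
      (∀ x ∈ xs, x.Small L m (T₀ + h.length)) →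
      x.Within (r * (7 * (n * T₀) + 9 * (budget n T₀ D * T₀)))
        (r * (2200 * ((n * T₀ * L) ^ 2 * m ^ 2))) (r * n)

/-- If the maximum is zero, all reduced images vanish, so `F` is zero and `h` is complete. -/
theorem LoopState.result_of_zero (st : LoopState D T₀ f T N xs h F) (hD : 1 ≤ D)
    {x : Sample R} (hbest : (bestSample xs).val = some (0, x))
    (hz : ∀ i < numSamples N, (redImage D (prm i) F).support.card = 0) (r : ℕ) :
    LoopResult D T₀ f xs h (r + 1)
      (mainLoop I n D (prmList (budget n T₀ D)) (r + 1) T N.1 N.2.1 xs h) := by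
  have hF : F = 0 := st.eq_zero hD hz
  subst hF
  rw [mainLoop_succ]
  refine ⟨⟨h, bind_val_eq hbest rfl, st.progress.isMvTerms⟩,
    (Asks.of_nil (bestSample_queries xs)).bind_eq hbest (Asks.of_nil rfl),
    fun L m b hT hsmall => ?_⟩
  refine (st.bestSample_within b hD hT hsmall (Nat.zero_le _) hbest (loopTail_zero ..)
    (Within.ret _)).mono (Nat.zero_le _) ?_ (Nat.zero_le _)
  rw [add_mul, one_mul]
  omega

/-- The claim for the next state carries back through one round. The update inserts `s.length` terms
in each dictionary while `h` grows by as many, so the node bound in terms of `T₀ + h.length` is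
preserved. -/
theorem LoopState.result_of_next (st : LoopState D T₀ f T N xs h F) (hD : 1 ≤ D)
    (hI : IsInterpolator f I) (hf : LowDegreePoly D f) {x : Sample R} {j α r : ℕ}
    (hbest : (bestSample xs).val = some (α, x)) (hα : α ≠ 0) (hα' : α ≤ F.support.card)
    (hxs : x ∈ xs) (hj : j < numSamples N) (hx : x.Valid D F (prm j))
    {s : List (List ℕ × R)} (hs : s = roundTerms I n D N.1 N.2.1 xs h x) {N' : ℕ × ℕ × ℕ}
    (hN' : N' = thresholdNums n (T - s.length) D (prmList (budget n T₀ D)))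
    (hres : LoopResult D T₀ f (updateSamples s (xs.take (numSamples N'))).val (s ++ h) r
      (mainLoop I n D (prmList (budget n T₀ D)) r (T - s.length) N'.1 N'.2.1
        (updateSamples s (xs.take (numSamples N'))).val (s ++ h))) :
    LoopResult D T₀ f xs h (r + 1)
      (mainLoop I n D (prmList (budget n T₀ D)) (r + 1) T N.1 N.2.1 xs h) := by
  obtain ⟨-, -, -, c1, -⟩ := thresholdNums_spec hD st.le st.thresholds_eq
  have hrest : mainLoop I n D (prmList (budget n T₀ D)) r (T - s.length) N'.1 N'.2.1
        (updateSamples s (xs.take (numSamples N'))).val (s ++ h) =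
      nextLoop I n D (prmList (budget n T₀ D)) r T xs h
        (roundTerms I n D N.1 N.2.1 xs h x) := by
    rw [← hs, hN', nextLoop]
  rw [hrest] at hres
  have htail := loopTail_pos I n D (prmList (budget n T₀ D)) r T N.1 N.2.1 xs h hα x
  rw [mainLoop_succ]
  refine ⟨?_, ?_, fun L m b hT hsmall => ?_⟩
  · obtain ⟨h', hv, ht⟩ := hres.exists_val
    refine ⟨h', bind_val_eq hbest ?_, ht⟩
    rw [htail, bind_val, loopBody_val, hv]
  · refine (Asks.of_nil (bestSample_queries xs)).bind_eq hbest ?_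
    rw [htail]
    refine (Asks.of_nil rfl).bind (loopBody_asks _ _ _ _ _ _ _ _ ?_ hres.asks)
    exact shiftedImages_asks hx _ (fun k => ⟨j, hj.trans_le c1, Or.inr ⟨k, rfl⟩⟩) n le_rfl
  · have hle : numSamples N' ≤ numSamples N := by
      rw [hN', ← st.thresholds_eq]
      exact numSamples_mono hD (Nat.sub_le _ _) _
    have hslow := (st.roundTerms_spec hD hI hx).1
    rw [← hs] at hslow
    have hsm : ∀ y ∈ (updateSamples s (xs.take (numSamples N'))).val,
        y.Small L m (T₀ + (s ++ h).length) := by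
      intro y hy
      rw [updateSamples_val] at hy
      obtain ⟨z, hz, rfl⟩ := List.mem_map.1 hy
      obtain ⟨i, hi, hv⟩ := (st.samples.take hle).exists_valid hz
      have := (hsmall z (List.mem_of_mem_take hz)).update b
        (hi.le.trans (hle.trans c1)) hslow hv
      rwa [List.length_append, add_comm s.length, ← add_assoc]
    have hw := hres.within L m b hT hsm
    have hw' := loopBody_within b st hD hI hf hT hsmall hxs (hj.trans_le c1) hx hw
    have hfin := st.bestSample_within b hD hT hsmall (hα'.trans (st.card_le.trans st.le)) hbest
      htail hw'
    refine hfin.mono ?_ ?_ ?_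
    · rw [add_mul, one_mul, add_comm]
    · rw [add_mul r, one_mul, ← add_assoc, ← add_mul, add_comm]
    · rw [add_mul, one_mul, add_comm]

/-- The loop ends with the list of the terms of `f`. -/
theorem mainLoop_result (hD : 1 ≤ D) (hI : IsInterpolator f I) (hf : LowDegreePoly D f) (r : ℕ)
    (st : LoopState D T₀ f T N xs h F) (hr : F.support.card < 2 ^ r) :
    LoopResult D T₀ f xs h (r + 1)
      (mainLoop I n D (prmList (budget n T₀ D)) (r + 1) T N.1 N.2.1 xs h) := by
  induction r generalizing T N xs h F with
  | zero =>
    obtain ⟨x, j, hbest, hxs, hj, hx, hmax⟩ := st.bestSample_val hD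
    -- Fewer than `2 ^ 0` monomials means none; the additional unit of `r + 1` pays for this last
    -- test.
    have hz : ∀ i, (redImage D (prm i) F).support.card = 0 := fun i => by
      have := card_support_redImage_le D (prm i) F
      omega
    rw [hz] at hbest
    exact st.result_of_zero hD hbest (fun i _ => hz i) 0
  | succ r ih =>
    obtain ⟨x, j, hbest, hxs, hj, hx, hmax⟩ := st.bestSample_val hD
    by_cases h0 : (redImage D (prm j) F).support.card = 0
    · rw [h0] at hbest hmax
      exact st.result_of_zero hD hbest (fun i hi => Nat.le_zero.1 (hmax i hi)) (r + 1)
    · obtain ⟨st', d1, d2⟩ := st.next hD hI hx rfl rfl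
      have hF : F ≠ 0 := by
        rintro rfl
        have := card_support_redImage_le D (prm j) (0 : MvPolynomial (Fin n) R)
        simp at this
        simp [this] at h0
      -- More than half of the monomials are isolated and all of these were found, so less than half
      -- remain and the exponent of `2` drops by one.
      have hlt := st.card_lt hD hF hmax
      refine st.result_of_next hD hI hf hbest h0 (card_support_redImage_le D (prm j) F) hxs hj hx
        rfl rfl (ih st' ?_)
      rw [pow_succ] at hr
      omega

end LoopSpec

/-! ### The whole algorithm -/

section Algorithm

variable {R : Type u} [CommRing R] [DecidableEq R] {n : ℕ}
  {D T : ℕ} {f : MvPolynomial (Fin n) R} {I : List ℕ → List (ℕ × R)}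

theorem primeBudget_queries (n T D : ℕ) : (primeBudget n T D).queries = [] := by
  simp [primeBudget, natSub, natMul, natAdd, natMax, natCeilLog, natPow_queries]

theorem samplesFor_takeSamples (hI : IsInterpolator f I) (M : ℕ) :
    SamplesFor D f (takeSamples I n D ((List.range M).map prm)).val M := by
  rw [takeSamples_val, List.map_map, SamplesFor, List.forall₂_map_left_iff]
  exact List.forall₂_same.2 fun j _ => takeSample_valid hI

/-- The algorithm returns the terms of `f`, and its costs are those of the preparations and of the
rounds of the loop. -/
theorem mipoly2_spec (hf : f.support.card ≤ T) (hd : f.totalDegree < D) (hI : IsInterpolator f I)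
    {r : ℕ} (hr : f.support.card < 2 ^ r) :
    (∃ h, (mipoly2 I n T D (r + 1)).val = some h ∧ IsMvTerms h f) ∧
    (mipoly2 I n T D (r + 1)).Asks (IsRequest n D (budget n T D)) ∧
    ∀ L m, Bounds n T D (budget n T D) L m →
      (mipoly2 I n T D (r + 1)).Within
        (4 * (budget n T D * T) + (r + 1) * (7 * (n * T) + 9 * (budget n T D * T)))
        (11400 * ((n * T * L) ^ 2 * m ^ 3) + (r + 1) * (2200 * ((n * T * L) ^ 2 * m ^ 2)))
        (budget n T D + (r + 1) * n) := by
  have hD : 1 ≤ D := by omega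
  have hlow := lowDegreePoly_of_totalDegree_lt hd
  set K := budget n T D with hK
  set N := thresholdNums n T D (prmList K) with hN
  have hK1 : 1 ≤ K := (by norm_num : 1 ≤ 4).trans (four_le_budget n T D)
  obtain ⟨-, -, -, c1, c2, c3, c4⟩ := thresholdNums_spec hD le_rfl hN.symm
  rw [← hK] at c1 c2 c3 c4
  set ps := (List.range (numSamples N)).map prm with hps
  have htake : (prmList K).take (numSamples N) = ps := by
    rw [prmList, ← List.map_take, List.take_range, min_eq_left c1]
  have st : LoopState D T f T N (takeSamples I n D ps).val [] f :=
    ⟨Progress.start hlow, hf, le_rfl, hN.symm, samplesFor_takeSamples hI _⟩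
  have hres := mainLoop_result hD hI hlow r st hr
  rw [← hK] at hres
  unfold mipoly2
  refine ⟨?_, ?_, fun L m b => ?_⟩
  · obtain ⟨h, hv, ht⟩ := hres.exists_val
    refine ⟨h, ?_, ht⟩
    exact bind_val_eq (primeBudget_val n T D) <| bind_val_eq (firstPrimes_val K) <|
      bind_val_eq (thresholds_val _ _ _ _) <| bind_val_eq (sampleCount_val _) <|
      bind_val_eq ((takeList_val _ _).trans htake) <| bind_val_eq rfl hv
  · refine (Asks.of_nil (primeBudget_queries n T D)).bind_eq (primeBudget_val n T D) <|
      ((firstPrimes_within hK1 le_rfl).asks _).bind_eq (firstPrimes_val K) <|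
      (Asks.of_nil (thresholds_queries _ _ _ _)).bind_eq (thresholds_val _ _ _ _) <|
      (Asks.of_nil rfl).bind_eq (sampleCount_val _) <|
      ((takeList_within _ _ le_rfl).asks _).bind_eq ((takeList_val _ _).trans htake) <|
      (takeSamples_asks I D ps _ ?_).bind_eq rfl hres.asks
    intro p hp
    obtain ⟨j, hj, rfl⟩ := List.mem_map.1 hp
    exact ⟨j, (List.mem_range.1 hj).trans_le c1, Or.inl rfl⟩
  · have hn := b.n_pos
    have hT0 := b.T_pos
    have hm := b.m_pos
    have hL := b.L_pos
    have lenK : ∀ {a}, a ≤ K → len a ≤ m := fun ha => (len_mono ha).trans b.len_K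
    have w1 := primeBudget_within hn hT0 b.len_D b.len_nT
    have w2 := firstPrimes_within hK1 (b.len_of_le_two_prm le_rfl (by omega))
    have w3 := thresholds_within hn hT0 le_rfl b.len_D
      b.len_nT b.len_K (prmList K) (by simp [prmList]) (by
        intro q hq
        obtain ⟨i, hi, rfl⟩ := List.mem_map.1 hq
        exact b.len_of_le_two_prm (List.mem_range.1 hi).le (by omega))
    have w4 := sampleCount_within (lenK c2) (lenK c3) (lenK c4)
    have w5 := takeList_within (numSamples N) (prmList K) (lenK c1)
    have w6 := takeSamples_within b hlow hf hI (List.range (numSamples N)) fun i hi =>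
      (List.mem_range.1 hi).le.trans c1
    rw [List.length_range] at w6
    have hsmall : ∀ x ∈ (takeSamples I n D ps).val,
        x.Small L m (T + ([] : List (List ℕ × R)).length) := by
      intro x hx
      rw [takeSamples_val, hps, List.map_map] at hx
      obtain ⟨j, hj, rfl⟩ := List.mem_map.1 hx
      exact takeSample_small b ((List.mem_range.1 hj).le.trans c1) hlow hf hI
    have w7 := hres.within L m b hf hsmall
    rw [← hK] at w7
    refine Within.mono (w1.bind_eq (primeBudget_val n T D) <| w2.bind_eq (firstPrimes_val K) <|
      w3.bind_eq (thresholds_val _ _ _ _) <| w4.bind_eq (sampleCount_val _) <|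
      w5.bind_eq ((takeList_val _ _).trans htake) <| w6.bind_eq rfl w7) ?_ ?_ ?_
    · have : numSamples N * (4 * T) ≤ 4 * (K * T) := by
        calc _ ≤ K * (4 * T) := Nat.mul_le_mul_right _ c1
          _ = _ := by ring
      omega
    · set V := (n * T * L) ^ 2 * m ^ 3 with hV
      have hKle := b.K_le
      have q1 : 100 * (4 * (n * T) * L) ^ 2 ≤ 1600 * V :=
        le_of_mul_eq (m ^ 3) (by positivity) (by rw [hV]; ring)
      -- The search for primes is the one step that needs `m ^ 3`: about `prm K = O(K * m)`
      -- candidates, `K` trial divisions each, at price `m ^ 2`.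
      have q2 : 13 * (prm K * (K * m ^ 2)) ≤ 8320 * V := by
        calc _ ≤ 13 * (40 * (K * m) * (K * m ^ 2)) := by gcongr; exact b.prm_le
          _ ≤ 13 * (40 * (4 * (n * T) * L * m) * (4 * (n * T) * L * m ^ 2)) := by gcongr
          _ = 8320 * V := by rw [hV]; ring
      have q3 : 18 * (4 * (n * T) * L) ^ 2 ≤ 288 * V :=
        le_of_mul_eq (m ^ 3) (by positivity) (by rw [hV]; ring)
      have q4 : 63 * (K * (4 * (n * T) * L) * m) ≤ 1008 * V := by
        calc _ ≤ 63 * (4 * (n * T) * L * (4 * (n * T) * L) * m) := by gcongr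
          _ ≤ 1008 * V := le_of_mul_eq (m ^ 2) (by positivity) (by rw [hV]; ring)
      have q5 : m ^ 2 ≤ V := le_of_mul_eq ((n * T * L) ^ 2 * m) (by positivity) (by rw [hV]; ring)
      have q6 : m ≤ V := le_of_mul_eq ((n * T * L) ^ 2 * m ^ 2) (by positivity) (by rw [hV]; ring)
      have q7 : numSamples N * m ≤ 4 * V := by
        calc _ ≤ 4 * (n * T) * L * m := Nat.mul_le_mul_right _ (c1.trans hKle)
          _ ≤ 4 * V := le_of_mul_eq (n * T * L * m ^ 2) (by positivity) (by rw [hV]; ring)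
      have q8 : numSamples N * (20 * (n * T * L * m ^ 2)) ≤ 80 * V := by
        calc _ ≤ 4 * (n * T) * L * (20 * (n * T * L * m ^ 2)) :=
              Nat.mul_le_mul_right _ (c1.trans hKle)
          _ ≤ 80 * V := le_of_mul_eq m (by positivity) (by rw [hV]; ring)
      clear_value V
      generalize (r + 1) * (2200 * ((n * T * L) ^ 2 * m ^ 2)) = B
      clear w1 w2 w3 w4 w5 w6 w7 hsmall hres st hV hKle c1 c2 c3 c4 hr hd hD hf hK1
      omega
    · omega

end Algorithm

/-! ### From bit lengths to logarithms -/

section Estimates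

theorem three_le_len {D : ℕ} (hD : 2 ≤ D) : 3 ≤ len D := by
  have : Nat.size 2 ≤ Nat.size D := Nat.size_le_size hD
  have h2 : Nat.size 2 = 2 := rfl
  unfold len
  omega

theorem two_le_len {a : ℕ} (ha : 1 ≤ a) : 2 ≤ len a := by
  have : Nat.size 1 ≤ Nat.size a := Nat.size_le_size ha
  rw [Nat.size_one] at this
  unfold len
  omega

variable {n T D : ℕ}

theorem size_budget_le (hn : 1 ≤ n) (hT : 1 ≤ T) :
    Nat.size (budget n T D + 3) ≤ len (n * T * len D) + 4 := by
  have h1 := budget_le (D := D) hn hT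
  have h2 : 1 ≤ n * T * len D := Nat.mul_pos (Nat.mul_pos hn hT) (one_le_len D)
  have h3 : budget n T D + 3 ≤ 8 * (n * T * len D) := by
    rw [mul_assoc 4] at h1
    omega
  have h4 := (len_mono h3).trans (len_mul _ _)
  have h5 : len 8 = 5 := rfl
  rw [h5] at h4
  have h6 : len (budget n T D + 3) = Nat.size (budget n T D + 3) + 1 := rfl
  omega

/-- `K ≥ 4` gives `K + 3 ≤ 2 * K`. With `ℓ = len (n * T * len D) ≥ 2` the other factor `2 * (ℓ + 4)
+ 6` is at most `9 * ℓ`. -/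
theorem prm_budget_le (hn : 1 ≤ n) (hT : 1 ≤ T) :
    prm (budget n T D) ≤ 18 * (budget n T D * len (n * T * len D)) := by
  have h1 := size_budget_le (D := D) hn hT
  have h2 : 2 ≤ len (n * T * len D) :=
    two_le_len (Nat.mul_pos (Nat.mul_pos hn hT) (one_le_len D))
  have h3 := four_le_budget n T D
  calc _ ≤ (budget n T D + 3) * (2 * Nat.size (budget n T D + 3) + 6) := prm_le _
    _ ≤ (2 * budget n T D) * (9 * len (n * T * len D)) := Nat.mul_le_mul (by omega) (by omega)
    _ = _ := by ring

/-- The sizes of the numbers that come up in the algorithm. -/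
theorem bounds_of_pos (hn : 1 ≤ n) (hT : 1 ≤ T) (hD : 2 ≤ D) :
    Bounds n T D (budget n T D) (13 * (len D * len (n * T * len D))) (11 * len (n * T * len D)) := by
  have hd := three_le_len hD
  have hnT := Nat.mul_pos hn hT
  have hQ : 1 ≤ n * T * len D := Nat.mul_pos hnT (one_le_len D)
  have h2 : 2 ≤ len (n * T * len D) := two_le_len hQ
  have hnTQ : n * T ≤ n * T * len D := Nat.le_mul_of_pos_right _ (one_le_len D)
  have hnQ : n ≤ n * T * len D := (Nat.le_mul_of_pos_right _ hT).trans hnTQ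
  have hK := budget_le (D := D) hn hT
  have hprm := prm_budget_le (D := D) hn hT
  have hs : len (prm (budget n T D)) ≤ 2 * len (n * T * len D) + 15 := by
    have h1 := size_budget_le (D := D) hn hT
    have h3 := size_prm_le (budget n T D)
    unfold len at *
    omega
  have l2 : len 2 = 3 := rfl
  have l4 : len 4 = 4 := rfl
  have hn' := len_mono hnQ
  have hnT' := len_mono hnTQ
  have hK' : len (budget n T D) ≤ 4 + len (n * T * len D) := by
    rw [mul_assoc 4] at hK
    exact (len_mono hK).trans ((len_mul _ _).trans (by rw [l4]))
  set ℓ := len (n * T * len D)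
  -- `L` is a multiple of the product `len D * ℓ`, so that `len D` can be factored out of the bit
  -- bound. The constants come from `ℓ ≥ 2`: `2 * ℓ + 18 ≤ 11 * ℓ` for `m`, and `3 * ℓ + len D + 18
  -- ≤ 13 * (len D * ℓ)` for `L`.
  have hprod1 : len D ≤ len D * ℓ := Nat.le_mul_of_pos_right _ (by omega)
  have hprod2 : ℓ ≤ len D * ℓ := Nat.le_mul_of_pos_left _ (by omega)
  refine ⟨hn, hT, by omega, ?_, by omega, by omega, ?_, ?_, ?_, ?_⟩
  · refine (len_mul _ _).trans ?_
    rw [l4]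
    omega
  · refine (len_mul _ _).trans ?_
    rw [l2]
    omega
  · have h1 := len_mul 2 (n * D * prm (budget n T D))
    have h3 := len_mul (n * D) (prm (budget n T D))
    have h4 := len_mul n D
    rw [l2] at h1
    omega
  · exact hK.trans (Nat.mul_le_mul_left _ (by omega))
  · refine hprm.trans ?_
    rw [mul_left_comm]
    nlinarith [Nat.zero_le (budget n T D * ℓ)]

variable {R : Type u} [CommRing R]

theorem natDegree_subst_le {f : MvPolynomial (Fin n) R} (hf : LowDegreePoly D f) {B : ℕ}
    {e : Fin n → ℕ} (he : ∀ i, e i ≤ 2 * B) : (subst e f).natDegree ≤ 2 * (D * B) := by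
  by_cases h : subst e f = 0
  · simp [h]
  · obtain ⟨s, hs, heq⟩ :=
      exists_of_mem_support_subst (Polynomial.natDegree_mem_support_of_nonzero h)
    rw [← heq]
    exact (hf s hs).expDot_le he

theorem len_le_logb {a : ℕ} (ha : 1 ≤ a) : (len a : ℝ) ≤ Real.logb 2 a + 2 := by
  have h1 : 2 ^ (Nat.size a - 1) ≤ a := by
    by_contra! h
    rw [← Nat.size_le] at h
    have := Nat.size_pos.2 ha
    omega
  have h2 : ((Nat.size a - 1 : ℕ) : ℝ) ≤ Real.logb 2 a := by
    rw [Real.le_logb_iff_rpow_le (by norm_num) (by exact_mod_cast ha), Real.rpow_natCast]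
    exact_mod_cast h1
  have h3 : len a ≤ (Nat.size a - 1) + 2 := by unfold len; omega
  have h4 : (len a : ℝ) ≤ ((Nat.size a - 1 : ℕ) : ℝ) + 2 := by exact_mod_cast h3
  linarith

theorem one_le_logb {D : ℕ} (hD : 2 ≤ D) : 1 ≤ Real.logb 2 D := by
  rw [Real.le_logb_iff_rpow_le (by norm_num) (by positivity), Real.rpow_one]
  exact_mod_cast hD

theorem len_le_three_mul_logb {D : ℕ} (hD : 2 ≤ D) : (len D : ℝ) ≤ 3 * Real.logb 2 D := by
  have h1 := len_le_logb (a := D) (by omega)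
  have h2 := one_le_logb hD
  linarith

theorem one_le_log {F : ℝ} (hF : 1 ≤ F) : 1 ≤ Real.log (2 + F) := by
  rw [Real.le_log_iff_exp_le (by linarith)]
  have := Real.exp_one_lt_d9
  linarith

theorem logb_two_le {x : ℝ} (hx : 1 ≤ x) : Real.logb 2 x ≤ 2 * Real.log x := by
  have h1 := Real.log_two_gt_d9
  have h2 := Real.log_nonneg hx
  rw [Real.logb, div_le_iff₀ (by linarith)]
  nlinarith

/-- The length is at most `logb 2 (4 * a)`, hence at most `2 * log (4 * a)`, and `4 * a ≤ 12 * F ≤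
(2 + F) ^ 4`. -/
theorem len_le_log {a : ℕ} {F : ℝ} (ha : 1 ≤ a) (hF : 1 ≤ F) (h : (a : ℝ) ≤ 3 * F) :
    (len a : ℝ) ≤ 8 * Real.log (2 + F) := by
  have h1 := len_le_logb ha
  have h2 : Real.logb 2 a + 2 = Real.logb 2 (4 * a) := by
    have : (a : ℝ) ≠ 0 := by positivity
    rw [Real.logb_mul (by norm_num) this, show (4 : ℝ) = 2 ^ (2 : ℕ) by norm_num, Real.logb_pow,
      Real.logb_self_eq_one (by norm_num)]
    push_cast
    ring
  have ha' : (1 : ℝ) ≤ a := by exact_mod_cast ha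
  have h3 : Real.logb 2 (4 * a) ≤ 2 * Real.log (4 * a) := logb_two_le (by linarith)
  have h4 : Real.log (4 * a) ≤ Real.log ((2 + F) ^ 4) := by
    refine Real.log_le_log (by linarith) ?_
    have : (12 : ℝ) * F ≤ (2 + F) ^ 4 := by nlinarith [sq_nonneg F, sq_nonneg (F ^ 2), pow_pos (by linarith : 0 < F) 3]
    linarith
  rw [Real.log_pow] at h4
  push_cast at h4
  linarith

end Estimates

/-! ### Explicit total bounds -/

section Final

variable {R : Type u} [CommRing R] [DecidableEq R] {n T D : ℕ}
  {f : MvPolynomial (Fin n) R} {I : List ℕ → List (ℕ × R)}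

/-- As many tests as the bit length of the number of terms suffice, by halving. The general word
lengths are replaced by those of `bounds_of_pos`, so all bounds are in terms of `n`, `T`, `len D`
and `len (n * T * len D)`. -/
theorem mipoly2_within (hn : 1 ≤ n) (hT : 1 ≤ T) (hD : 2 ≤ D) (hf : f.support.card ≤ T)
    (hd : f.totalDegree < D) (hI : IsInterpolator f I) :
    (mipoly2 I n T D (len f.support.card)).Within
      (60 * (n * T ^ 2 * len D * len (n * T * len D)))
      (2609292400 * ((n * T * len D) ^ 2 * len (n * T * len D) ^ 5))
      (6 * (n * T * len D)) := by
  have hw := (mipoly2_spec hf hd hI (Nat.lt_size_self _)).2.2 _ _ (bounds_of_pos hn hT hD)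
  have hK := budget_le (D := D) hn hT
  have hd1 := one_le_len D
  have hTQ : T ≤ n * T * len D :=
    (Nat.le_mul_of_pos_left _ hn).trans (Nat.le_mul_of_pos_right _ hd1)
  have hr1 : Nat.size f.support.card + 1 ≤ len (n * T * len D) := len_mono (hf.trans hTQ)
  -- This cruder bound on the number of tests serves for the requests: `n` per round is then `O(n *
  -- T)`, with no second logarithm.
  have hr2 : Nat.size f.support.card + 1 ≤ 2 * T := by
    have h1 : len f.support.card ≤ len T := len_mono hf
    have h2 : len T ≤ T + 1 := len_le_self
    unfold len at h1 h2
    omega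
  have hl : 1 ≤ len (n * T * len D) := one_le_len _
  set ℓ := len (n * T * len D)
  set d := len D
  set K := budget n T D
  refine hw.mono ?_ ?_ ?_
  · calc 4 * (K * T) + (Nat.size f.support.card + 1) * (7 * (n * T) + 9 * (K * T))
        ≤ 4 * (4 * (n * T) * d * T) + ℓ * (7 * (n * T) + 9 * (4 * (n * T) * d * T)) := by gcongr
      _ ≤ 16 * (n * T ^ 2 * d * ℓ) + (7 * (n * T ^ 2 * d * ℓ) + 36 * (n * T ^ 2 * d * ℓ)) := by
        refine Nat.add_le_add (le_of_mul_eq ℓ hl (by ring)) ?_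
        rw [mul_add]
        exact Nat.add_le_add (le_of_mul_eq (T * d) (Nat.mul_pos hT hd1) (by ring))
          (le_of_eq (by ring))
      _ ≤ _ := by omega
  -- Of the exponent `5`, two come from `L ^ 2` and three from `m ^ 3`; in the second summand the
  -- number of tests replaces one factor `m`.
  · calc _ ≤ 11400 * ((n * T * (13 * (d * ℓ))) ^ 2 * (11 * ℓ) ^ 3) +
          ℓ * (2200 * ((n * T * (13 * (d * ℓ))) ^ 2 * (11 * ℓ) ^ 2)) := by gcongr
      _ = 2564304600 * ((n * T * d) ^ 2 * ℓ ^ 5) + 44987800 * ((n * T * d) ^ 2 * ℓ ^ 5) := by ring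
      _ = _ := by ring
  · calc _ ≤ 4 * (n * T) * d + 2 * T * n := by gcongr
      _ ≤ 4 * (n * T * d) + 2 * (n * T * d) := by
        refine Nat.add_le_add (le_of_eq (by ring)) (le_of_mul_eq d hd1 (by ring))
      _ = _ := by ring

/-- For `F ≥ 1` the logarithm is at least `1`, so a smaller constant and a smaller exponent may be
enlarged to the common ones. -/
theorem le_softBound {C c k : ℕ} {X a F : ℝ} (hF : 1 ≤ F) (ha : a ≤ C) (hk : k ≤ c)
    (hX : X ≤ a * F * Real.log (2 + F) ^ k) : X ≤ softBound C c F := by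
  have h1 := one_le_log hF
  refine hX.trans ?_
  unfold softBound
  gcongr

end Final

end KroneckerInterp

/-! ### The main theorem -/

open KroneckerInterp in
theorem theorem4p4 :
    ∃ C c : ℕ, ∀ (R : Type u) [CommRing R] [IsDomain R] [DecidableEq R] (n T D : ℕ)
      (f : MvPolynomial (Fin n) R) (I : List ℕ → List (ℕ × R)),
      f.support.card ≤ T → f.totalDegree < D → IsInterpolator f I →
      ∃ (rounds : ℕ) (h : List (List ℕ × R)),
        (mipoly2 I n T D rounds).val = some h ∧ IsMvTerms h f ∧
        (1 ≤ n → 1 ≤ T → 2 ≤ D →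
          (((mipoly2 I n T D rounds).queries.length : ℝ) ≤ C * (n * T * Real.logb 2 D)) ∧
          (∀ q ∈ (mipoly2 I n T D rounds).queries, ∃ (j : ℕ) (e : Fin n → ℕ),
            (j : ℝ) ≤ C * (n * T * Real.logb 2 D) ∧ q = List.ofFn e ∧
            (e = kronExp n D (Nat.nth Nat.Prime j) ∨
              ∃ k : Fin n, e = kronExpShift n D (Nat.nth Nat.Prime j) k) ∧
            ((subst e f).natDegree : ℝ) < softBound C c (n * D * T) ∧
            (subst e f).support.card ≤ T) ∧
          ((mipoly2 I n T D rounds).ringOps : ℝ) ≤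
            softBound C c (n * T ^ 2 * Real.logb 2 D) ∧
          ((mipoly2 I n T D rounds).bitOps : ℝ) ≤
            softBound C c (n ^ 2 * T ^ 2 * Real.logb 2 D ^ 2)) := by
  -- The bit bound dictates both constants: `2609292400 * (9 * 8 ^ 5)` is below `10 ^ 15`, and the
  -- fifth power of the logarithm occurs only there.
  refine ⟨10 ^ 15, 5, fun R _ _ _ n T D f I hf hd hI => ?_⟩
  obtain ⟨⟨h, hv, ht⟩, hasks, -⟩ := mipoly2_spec hf hd hI (Nat.lt_size_self _)
  refine ⟨len f.support.card, h, hv, ht, fun hn hT hD => ?_⟩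
  have hw := mipoly2_within hn hT hD hf hd hI
  have hlow := lowDegreePoly_of_totalDegree_lt hd
  have hlg := one_le_logb hD
  have hd3 := len_le_three_mul_logb hD
  have hn' : (1 : ℝ) ≤ n := by exact_mod_cast hn
  have hT' : (1 : ℝ) ≤ T := by exact_mod_cast hT
  have hD' : (2 : ℝ) ≤ D := by exact_mod_cast hD
  have hQ : 1 ≤ n * T * len D := Nat.mul_pos (Nat.mul_pos hn hT) (one_le_len D)
  have hnT : (1 : ℝ) ≤ n * T := one_le_mul_of_one_le_of_one_le hn' hT'
  have hS : (1 : ℝ) ≤ n * T * Real.logb 2 D := one_le_mul_of_one_le_of_one_le hnT hlg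
  have hQS : ((n * T * len D : ℕ) : ℝ) ≤ 3 * (n * T * Real.logb 2 D) := by
    push_cast
    nlinarith
  have hKnat := budget_le (D := D) hn hT
  have hK : (budget n T D : ℝ) ≤ 12 * (n * T * Real.logb 2 D) := by
    have : budget n T D ≤ 4 * (n * T * len D) := by rwa [mul_assoc 4] at hKnat
    have h2 : (budget n T D : ℝ) ≤ 4 * ((n * T * len D : ℕ) : ℝ) := by exact_mod_cast this
    linarith
  refine ⟨?_, fun q hq => ?_, ?_, ?_⟩
  · have h1 : ((mipoly2 I n T D (len f.support.card)).queries.length : ℝ) ≤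
        6 * ((n * T * len D : ℕ) : ℝ) := by exact_mod_cast hw.query
    push_cast at hQS h1 ⊢
    linarith
  · obtain ⟨j, hj, hq⟩ := hasks q hq
    have hp := (prm_prime j).pos
    have hjK : (j : ℝ) ≤ budget n T D := by exact_mod_cast hj.le
    obtain ⟨e, he, hform, hle⟩ : ∃ e : Fin n → ℕ, q = List.ofFn e ∧
        (e = kronExp n D (prm j) ∨ ∃ k : Fin n, e = kronExpShift n D (prm j) k) ∧
        ∀ i, e i ≤ 2 * prm j := by
      rcases hq with rfl | ⟨k, rfl⟩
      · exact ⟨_, rfl, Or.inl rfl, fun i => (kronExp_le D hp i).trans (by omega)⟩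
      · exact ⟨_, rfl, Or.inr ⟨k, rfl⟩, kronExpShift_le D hp k⟩
    refine ⟨j, e, ?_, he, hform, ?_, (card_support_subst_le e f).trans hf⟩
    · push_cast
      linarith
    · have hdeg := natDegree_subst_le hlow hle
      have hjp : prm j ≤ 18 * (4 * (n * T) * len D * len (n * T * len D)) :=
        (prm_strictMono.monotone hj.le).trans ((prm_budget_le hn hT).trans
          (Nat.mul_le_mul_left _ (Nat.mul_le_mul_right _ hKnat)))
      -- The constant is `2 * 18 * 4`: from the degree bound `2 * (D * p)`, from `prm_budget_le` and
      -- from `budget_le`.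
      have hdeg' : (subst e f).natDegree ≤
          144 * (n * D * T * (len D * len (n * T * len D))) := by
        calc _ ≤ 2 * (D * (18 * (4 * (n * T) * len D * len (n * T * len D)))) :=
              hdeg.trans (Nat.mul_le_mul_left _ (Nat.mul_le_mul_left _ hjp))
          _ = _ := by ring
      have hDF : (D : ℝ) ≤ n * D * T := by
        calc (D : ℝ) ≤ n * T * D := le_mul_of_one_le_left (by linarith) hnT
          _ = _ := by ring
      have hF : (1 : ℝ) ≤ n * D * T := by linarith
      have hQF : ((n * T * len D : ℕ) : ℝ) ≤ 3 * (n * D * T) := by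
        have h1 : len D ≤ 3 * D := len_le_self.trans (by omega)
        have h2 : n * T * len D ≤ 3 * (n * D * T) :=
          (Nat.mul_le_mul_left _ h1).trans_eq (by ring)
        exact_mod_cast h2
      have hl := len_le_log hQ hF hQF
      have hdl : (len D : ℝ) ≤ 6 * Real.log (2 + n * D * T) := by
        have h1 := logb_two_le (x := D) (by linarith)
        have h2 := Real.log_le_log (by linarith) (by linarith : (D : ℝ) ≤ 2 + n * D * T)
        linarith
      have hlog := one_le_log hF
      have h1 : ((subst e f).natDegree : ℝ) ≤
          144 * (n * D * T * (len D * len (n * T * len D))) := by exact_mod_cast hdeg'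
      have h2 : ((subst e f).natDegree : ℝ) <
          6913 * (n * D * T) * Real.log (2 + n * D * T) ^ 2 := by
        calc ((subst e f).natDegree : ℝ)
            ≤ 144 * (n * D * T * (6 * Real.log (2 + n * D * T) *
              (8 * Real.log (2 + n * D * T)))) := h1.trans (by gcongr)
          _ = 6912 * (n * D * T * Real.log (2 + n * D * T) ^ 2) := by ring
          -- The degree bound is strict, so the constant `144 * 6 * 8 = 6912` is raised by one.
          _ < 6913 * (n * D * T * Real.log (2 + n * D * T) ^ 2) := by
            have : (0 : ℝ) < n * D * T * Real.log (2 + n * D * T) ^ 2 := by positivity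
            linarith
          _ = _ := by ring
      exact h2.trans_le (le_softBound (a := 6913) (k := 2) hF (by norm_num)
        (by norm_num) le_rfl)
  · have hF : (1 : ℝ) ≤ n * T ^ 2 * Real.logb 2 D := by
      have : (n * T ^ 2 * Real.logb 2 D : ℝ) = T * (n * T * Real.logb 2 D) := by ring
      rw [this]
      exact one_le_mul_of_one_le_of_one_le hT' hS
    have hSF : n * T * Real.logb 2 D ≤ (n * T ^ 2 * Real.logb 2 D : ℝ) := by
      have : (n * T ^ 2 * Real.logb 2 D : ℝ) = T * (n * T * Real.logb 2 D) := by ring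
      rw [this]
      exact le_mul_of_one_le_left (by linarith) hT'
    have hl := len_le_log hQ hF (hQS.trans (by linarith))
    have h1 : ((mipoly2 I n T D (len f.support.card)).ringOps : ℝ) ≤
        60 * (n * T ^ 2 * len D * len (n * T * len D)) := by exact_mod_cast hw.ring
    refine le_softBound (a := 1440) (k := 1) hF (by norm_num) (by norm_num)
      (h1.trans ?_)
    calc (60 : ℝ) * (n * T ^ 2 * len D * len (n * T * len D))
        ≤ 60 * (n * T ^ 2 * (3 * Real.logb 2 D) *
          (8 * Real.log (2 + n * T ^ 2 * Real.logb 2 D))) := by gcongr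
      _ = _ := by ring
  -- The class is that of `S ^ 2`; as `S ≥ 1`, lengths that are logarithmic in `S` are also bounded
  -- by `log (2 + S ^ 2)`.
  · have hFS : (n ^ 2 * T ^ 2 * Real.logb 2 D ^ 2 : ℝ) = (n * T * Real.logb 2 D) ^ 2 := by ring
    rw [hFS]
    set S : ℝ := n * T * Real.logb 2 D with hSdef
    have hF : (1 : ℝ) ≤ S ^ 2 := one_le_pow₀ hS
    have hSF : S ≤ S ^ 2 := le_self_pow₀ hS (by norm_num)
    have hl := len_le_log hQ hF (hQS.trans (by linarith))
    have h1 : ((mipoly2 I n T D (len f.support.card)).bitOps : ℝ) ≤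
        2609292400 * (((n * T * len D : ℕ) : ℝ) ^ 2 * len (n * T * len D) ^ 5) := by
      exact_mod_cast hw.bit
    refine le_softBound (a := 2609292400 * (9 * 8 ^ 5)) (k := 5) hF (by norm_num)
      le_rfl (h1.trans ?_)
    calc (2609292400 : ℝ) * (((n * T * len D : ℕ) : ℝ) ^ 2 * len (n * T * len D) ^ 5)
        ≤ 2609292400 * ((3 * S) ^ 2 * (8 * Real.log (2 + S ^ 2)) ^ 5) := by gcongr
      _ = _ := by ring
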